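/- **Setting.** Let $N\ge 0$ be an integer, $\omega,\eta,\xi_1,\dots,\xi_N\in\mathbb C$ with $\Im\omega>0$, $\mathsf x,\mathsf y\in\{0,1\}$, $\Gamma=\pi\mathbb Z+\pi\omega\mathbb Z$, and $$\theta(z)=-i\sum_{k\in\mathbb Z}(-1)^k e^{i\pi\omega(k+\frac12)^2}e^{2i(k+\frac12)z},\qquad t_0=-\tfrac{\eta}{2}N+\mathsf x\tfrac{\pi}{2}+\mathsf y\tfrac{\pi}{2}\omega .$$ Assume $\eta\notin\Gamma$ and $t_0+k\eta\notin\Gamma$ for all $k\in\mathbb Z$ (if $k\eta\notin\Gamma$ for all integers $k\neq0$, this only says that $(\mathsf x,\mathsf y)\ne(0,0)$ when $N$ is even), and $\xi_a-\xi_b+\epsilon\eta\notin\Gamma$ for all $a\ne b$ and $\epsilon\in\{-1,0,1\}$. Put $a(\lambda)=\theta(\lambda+\eta)$, $b(\lambda|t)=\theta(\lambda)\theta(t+\eta)/\theta(t)$, $c(\lambda|t)=\theta(\eta)\theta(t+\lambda)/\theta(t)$ and $$R(\lambda|t)=\begin{pmatrix}a(\lambda)&0&0&0\\0&e^{i\mathsf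 y\eta}b(\lambda|t)&e^{i\mathsf y\lambda}c(\lambda|t)&0\\0&e^{-i\mathsf y\lambda}c(\lambda|-t)&e^{-i\mathsf y\eta}b(\lambda|-t)&0\\0&0&0&a(\lambda)\end{pmatrix}\in\mathrm{End}(\mathbb C^2\otimes\mathbb C^2).$$ On $V_0\otimes V_1\otimes\cdots\otimes V_N$, $V_n=\mathbb C^2$, the monodromy matrix is $$\mathsf M_0(\lambda|t)=R_{0,N}\Big(\lambda-\xi_N\Big|t+\eta\sum_{m=1}^{N-1}\sigma^z_m\Big)\cdots R_{0,1}(\lambda-\xi_1|t)=\begin{pmatrix}\mathsf A(\lambda|t)&\mathsf B(\lambda|t)\\ \mathsf C(\lambda|t)&\mathsf D(\lambda|t)\end{pmatrix}_{[0]}.$$ Let $\mathbb D$ have basis $|t(k)\rangle$, $k\in\mathbb Z$, with $\tau|t(k)\rangle=t(k)|t(k)\rangle$, $t(k)=t_0-\eta k$, and $\mathsf T_\tau^{\pm}|t(k)\rangle=|t(k\pm1)\rangle$. On $V_1\otimes\cdots\otimes V_N\otimes\mathbb D$ let $\mathsf A(\lambda|\tau)$, etc. be obtained by substituting $\tau$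 for $t$, and put $\mathcal A(\lambda)=\mathsf A(\lambda|\tau)\mathsf T_\tau^+$, $\mathcal B(\lambda)=\mathsf B(\lambda|\tau)\mathsf T_\tau^-$, $\mathcal C(\lambda)=\mathsf C(\lambda|\tau)\mathsf T_\tau^+$, $\mathcal D(\lambda)=\mathsf D(\lambda|\tau)\mathsf T_\tau^-$. Let $\mathsf S=\sum_n\sigma_n^z$, $\mathsf a(\lambda)=\prod_n a(\lambda-\xi_n)$, $\mathsf d(\lambda)=\mathsf a(\lambda-\eta)$. Operators act on covectors by composition; $\langle n,h_n|$ and $\langle t(k)|$ are the dual bases, where $\sigma^z_n|n,h_n\rangle=(1-2h_n)|n,h_n\rangle$, $h_n\in\{0,1\}$. For $r\in\mathbb Z$ and $\mathbf h\in\{0,1\}^N$ put $\mathsf s_{\mathbf h}=\sum_k(1-2h_k)$, $t_{r,\mathbf h}=-\frac{\eta}{2}\mathsf s_{\mathbf h}+\mathsf x\frac\pi2+\mathsf y\frac\pi2\omega+r\eta$, which is $t(k)$ with $k=-r-\sum_jh_j$; write $|t_{r,\mathbf h}\rangle$, $\langle t_{r,\mathbf h}|$ for the basis vectors with this index $k$.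 Let $\mathbf 0=(0,\dots,0)$, $\mathbf 1=(1,\dots,1)$. With a fixed constant $\mathsf n\ne0$ put $\langle r,\mathbf 0|=\frac1{\mathsf n}(\otimes_n\langle n,0|)\otimes\langle t_{r,\mathbf 0}|$, $|\mathbf 1,r\rangle=\frac1{\mathsf n}(\otimes_n|n,1\rangle)\otimes|t_{r,\mathbf 1}\rangle$ and $$\langle r,\mathbf h|=\langle r,\mathbf 0|\prod_{n=1}^N\Big(\frac{\mathcal C(\xi_n)}{\mathsf d(\xi_n-\eta)}\Big)^{h_n},\qquad |\mathbf h,r\rangle=\prod_{n=1}^N\Big(\frac{\mathcal C(\xi_n-\eta)}{\mathsf d(\xi_n-\eta)}\Big)^{1-h_n}|\mathbf 1,r\rangle .$$ Put $\xi_a^{(k)}=\xi_a-\eta k$, $\mathsf T_a^\pm\mathbf h=(h_1,\dots,h_a\pm1,\dots,h_N)$, and $$\mathsf d_{r,\mathbf h}(\lambda)=e^{-i\mathsf y\eta\frac{\mathsf s_{\mathbf h}-\mathsf s_{\mathbf 1}}2}\frac{\theta(t_{r,\mathbf h})}{\theta(t_{r,\mathbf 1})}\prod_{n}\theta(\lambda-\xi_n^{(h_n)}),\qquad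 \mathsf a^{(\pm)}_{r,\mathbf h}(\lambda)=(-1)^{\mathsf x+\mathsf y+\mathsf x\mathsf y}e^{2i\mathsf yr\eta}\frac{\theta(t_{r,\mathbf h}\pm\eta)}{\theta(t_{-r,\mathbf h}\pm\eta)}\mathsf a(\lambda),$$ $$K_a(\lambda;t,\mathbf h)=e^{i\mathsf y(\xi_a^{(h_a)}-\lambda)}\frac{\theta(t-\lambda+\xi_a^{(h_a)})}{\theta(t)}\prod_{b\neq a}\frac{\theta(\lambda-\xi_b^{(h_b)})}{\theta(\xi_a^{(h_a)}-\xi_b^{(h_b)})}.$$ **Theorem.** For all $\lambda\in\mathbb C$, $r\in\mathbb Z$, $\mathbf h\in\{0,1\}^N$ the following holds (terms with $h_a\pm1\notin\{0,1\}$ have coefficient $0$ and are omitted). I) Left representations: $$\langle r,\mathbf h|\,\mathsf D(\lambda|\tau)=\mathsf d_{r-1,\mathbf h}(\lambda)\,\langle r,\mathbf 0|\prod_{n}\Big(\frac{\mathsf T_\tau^-\mathcal C(\xi_n)\mathsf T_\tau^+}{\mathsf d(\xi_n-\eta)}\Big)^{h_n},$$ $$\langle r,\mathbf h|\,\mathcal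 C(\lambda)=\sum_{a}K_a(\lambda;t_{r,\mathbf h},\mathbf h)\,\mathsf d(\xi_a^{(1-h_a)})\,\langle r,\mathsf T_a^+\mathbf h|,\qquad \langle r,\mathbf h|\,\mathcal B(\lambda)=\sum_{a}K_a(\lambda;t_{-r,\mathbf h},\mathbf h)\,\mathsf a^{(-)}_{r,\mathbf h}(\xi_a^{(1-h_a)})\,\langle r,\mathsf T_a^-\mathbf h|.$$ II) Right representations: $$\mathsf D(\lambda|\tau+\eta)\,|\mathbf h,r\rangle=\mathsf d_{r+1,\mathbf h}(\lambda)\prod_{n}\Big(\frac{\mathsf T_\tau^+\mathcal C(\xi_n-\eta)\mathsf T_\tau^-}{\mathsf d(\xi_n-\eta)}\Big)^{1-h_n}|\mathbf 1,r\rangle,$$ $$\mathcal C(\lambda)|\mathbf h,r\rangle=\sum_{a}K_a(\lambda;t_{r,\mathbf h},\mathbf h)\,\mathsf d(\xi_a^{(h_a)})\,|\mathsf T_a^-\mathbf h,r\rangle,\qquad \mathcal B(\lambda)|\mathbf h,r\rangle=\sum_{a}K_a(\lambda;t_{-r,\mathbf h},\mathbf h)\,\mathsf a^{(+)}_{r,\mathbf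 h}(\xi_a^{(h_a)})\,|\mathsf T_a^+\mathbf h,r\rangle.$$ In both cases the action of $\mathsf A(\lambda|\tau)$ is determined by the quantum determinant relations. That is, for all $\lambda$, $$\mathsf a(\lambda)\mathsf d(\lambda-\eta)=e^{i\mathsf y\eta\mathsf S}\tfrac{\theta(\tau+\eta\mathsf S)}{\theta(\tau)}\big(\mathcal A(\lambda)\mathcal D(\lambda-\eta)-\mathcal B(\lambda)\mathcal C(\lambda-\eta)\big)=e^{i\mathsf y\eta\mathsf S}\tfrac{\theta(\tau+\eta\mathsf S)}{\theta(\tau)}\big(\mathcal D(\lambda)\mathcal A(\lambda-\eta)-\mathcal C(\lambda)\mathcal B(\lambda-\eta)\big),$$ and: (i) if a linear operator $X$ satisfies, in the place of $\mathsf A(\lambda|\tau)$ at a single $\lambda$, the first relation and $\lambda-\eta-\xi_n^{(k)}\notin\Gamma$ for all $n$ and $k\in\{0,1\}$, or the second relation (taken at $\lambda+\eta$) and $\lambda+\eta-\xi_n^{(k)}\notin\Gamma$ for all $n$ and $k$, then $\langle r,\mathbf h|X=\langle r,\mathbf h|\mathsf A(\lambda|\tau)$ and $X|\mathbf h,r\rangle=\mathsf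 A(\lambda|\tau)|\mathbf h,r\rangle$ for all $r,\mathbf h$; (ii) if $X(\lambda)$, $\lambda\in\mathbb C$, is a family of linear operators whose matrix elements are continuous in $\lambda$ and which satisfies one of the two relations for all $\lambda$ in the place of $\mathsf A(\lambda|\tau)$, then the same equalities hold at every $\lambda$. -/

import Mathlib

noncomputable section

/-- A spin configuration `h = (h₁, …, h_N) ∈ {0,1}^N`; `h n = 0` is spin up (`σᶻ = 1`), `h n = 1` is
spin down (`σᶻ = -1`). -/
abbrev SpinConfig (N : ℕ) : Type := Fin N → Fin 2

/-- The space `𝕍_N ⊗ 𝔻`, with basis `(⊗ₙ |n, hₙ⟩) ⊗ |t(a)⟩` indexed by `(h, a)`, `a ∈ ℤ`. -/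
abbrev DynSpace (N : ℕ) : Type := (SpinConfig N × ℤ) →₀ ℂ

/-- Covectors on `𝕍_N ⊗ 𝔻`. An operator `X` acts on a covector `φ` from the right: `φ X = φ ∘ₗ X`. -/
abbrev DynCovector (N : ℕ) : Type := Module.Dual ℂ (DynSpace N)

/-- The parameters of the dynamical 6-vertex model with `N` sites (data only). -/
structure SOSModel (N : ℕ) where
  /-- the ratio of the quasi-periods -/
  ω : ℂ
  /-- the crossing parameter -/
  η : ℂ
  /-- the inhomogeneity parameters -/
  ξ : Fin N → ℂ
  x : Fin 2
  y : Fin 2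

namespace SOSModel

variable {N : ℕ}

/-- The integer `x ∈ {0,1}` as a complex number. -/
def xc (p : SOSModel N) : ℂ := ((p.x : ℕ) : ℂ)

/-- The integer `y ∈ {0,1}` as a complex number. -/
def yc (p : SOSModel N) : ℂ := ((p.y : ℕ) : ℂ)

/-- `Γ = πℤ + πωℤ`. -/
def Γ (p : SOSModel N) : Set ℂ :=
  {z | ∃ m n : ℤ, z = (Real.pi : ℂ) * m + (Real.pi : ℂ) * p.ω * n}

/-- The theta function `θ(z) = θ₁(z|ω)`. -/
def θ (p : SOSModel N) (z : ℂ) : ℂ :=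
  -Complex.I * ∑' k : ℤ, (-1 : ℂ) ^ k
    * Complex.exp (Complex.I * Real.pi * p.ω * ((k : ℂ) + 1 / 2) ^ 2)
    * Complex.exp (2 * Complex.I * ((k : ℂ) + 1 / 2) * z)

/-! ### The dynamical R-matrix -/

def a (p : SOSModel N) (l : ℂ) : ℂ := p.θ (l + p.η)

def b (p : SOSModel N) (l t : ℂ) : ℂ := p.θ l * p.θ (t + p.η) / p.θ t

def c (p : SOSModel N) (l t : ℂ) : ℂ := p.θ p.η * p.θ (t + l) / p.θ t

/-- `R(λ|t) ∈ End(ℂ² ⊗ ℂ²)`; rows are outputs, the index `0` is spin up and `1` is spin down. -/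
def R (p : SOSModel N) (l t : ℂ) : Matrix (Fin 2 × Fin 2) (Fin 2 × Fin 2) ℂ :=
  Matrix.of fun o i =>
    match o, i with
    | (0, 0), (0, 0) => p.a l
    | (0, 1), (0, 1) => Complex.exp (Complex.I * p.yc * p.η) * p.b l t
    | (0, 1), (1, 0) => Complex.exp (Complex.I * p.yc * l) * p.c l t
    | (1, 0), (0, 1) => Complex.exp (-Complex.I * p.yc * l) * p.c l (-t)
    | (1, 0), (1, 0) => Complex.exp (-Complex.I * p.yc * p.η) * p.b l (-t)
    | (1, 1), (1, 1) => p.a l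
    | _, _ => 0

/-- `R_{0,n}(λ - ξₙ | t + η ∑_{m<n} σᶻ_m)` on `V₀ ⊗ V₁ ⊗ ⋯ ⊗ V_N`. -/
def R0 (p : SOSModel N) (l t : ℂ) (n : Fin N) :
    Matrix (Fin 2 × SpinConfig N) (Fin 2 × SpinConfig N) ℂ :=
  Matrix.of fun o i =>
    if ∀ m, m ≠ n → o.2 m = i.2 m then
      p.R (l - p.ξ n) (t + p.η * ∑ m ∈ Finset.univ.filter (· < n), (1 - 2 * ((i.2 m : ℕ) : ℂ)))
        (o.1, o.2 n) (i.1, i.2 n)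
    else 0

/-- The monodromy matrix `M₀(λ|t) = R_{0,N} ⋯ R_{0,1}`. -/
def M (p : SOSModel N) (l t : ℂ) : Matrix (Fin 2 × SpinConfig N) (Fin 2 × SpinConfig N) ℂ :=
  ((List.finRange N).reverse.map (p.R0 l t)).prod

/-- The entry `(i, j)` of `M₀(λ|t)` with respect to the auxiliary space:
`A, B, C, D` are the entries `(0,0), (0,1), (1,0), (1,1)`. -/
def Mentry (p : SOSModel N) (i j : Fin 2) (l t : ℂ) : Matrix (SpinConfig N) (SpinConfig N) ℂ :=
  Matrix.of fun g h => p.M l t (i, g) (j, h)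

/-! ### Dynamical operators -/

/-- `t₀ = -ηN/2 + xπ/2 + yπω/2`. -/
def t0 (p : SOSModel N) : ℂ :=
  -(p.η / 2) * N + p.xc * (Real.pi / 2) + p.yc * (Real.pi / 2) * p.ω

/-- The eigenvalue `t(a) = -ηa + t₀` of `τ` on `|t(a)⟩`. -/
def height (p : SOSModel N) (k : ℤ) : ℂ := -p.η * k + p.t0

/-- `(T_τ⁺)^k : |h⟩ ⊗ |t(a)⟩ ↦ |h⟩ ⊗ |t(a+k)⟩`. -/
def T (N : ℕ) (k : ℤ) : Module.End ℂ (DynSpace N) :=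
  Finsupp.lmapDomain ℂ ℂ fun s => (s.1, s.2 + k)

/-- `F(τ)`, for an operator `F(t)` on the spin space that depends on the dynamical parameter `t`:
`F(τ) (|h⟩ ⊗ |t(a)⟩) = (F(t(a)) |h⟩) ⊗ |t(a)⟩`. -/
def subst (p : SOSModel N) (F : ℂ → Matrix (SpinConfig N) (SpinConfig N) ℂ) :
    Module.End ℂ (DynSpace N) :=
  Finsupp.linearCombination ℂ fun s : SpinConfig N × ℤ =>
    ∑ g, F (p.height s.2) g s.1 • Finsupp.single (g, s.2) (1 : ℂ)

/-- `A(λ|τ)`. -/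
def A (p : SOSModel N) (l : ℂ) : Module.End ℂ (DynSpace N) := p.subst fun t => p.Mentry 0 0 l t

/-- `D(λ|τ)`. -/
def D (p : SOSModel N) (l : ℂ) : Module.End ℂ (DynSpace N) := p.subst fun t => p.Mentry 1 1 l t

/-- `D(λ|τ+η)`. -/
def Dshift (p : SOSModel N) (l : ℂ) : Module.End ℂ (DynSpace N) :=
  p.subst fun t => p.Mentry 1 1 l (t + p.η)

/-- `ℬ(λ) = B(λ|τ) T_τ⁻`. -/
def calB (p : SOSModel N) (l : ℂ) : Module.End ℂ (DynSpace N) :=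
  (p.subst fun t => p.Mentry 0 1 l t) * T N (-1)

/-- `𝒞(λ) = C(λ|τ) T_τ⁺`. -/
def calC (p : SOSModel N) (l : ℂ) : Module.End ℂ (DynSpace N) :=
  (p.subst fun t => p.Mentry 1 0 l t) * T N 1

/-- `𝒟(λ) = D(λ|τ) T_τ⁻`. -/
def calD (p : SOSModel N) (l : ℂ) : Module.End ℂ (DynSpace N) := p.D l * T N (-1)

/-! ### The quantum determinant -/

/-- `𝖺(λ) = ∏ₙ a(λ - ξₙ)`. -/
def aProd (p : SOSModel N) (l : ℂ) : ℂ := ∏ n, p.a (l - p.ξ n)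

/-- `𝖽(λ) = 𝖺(λ - η)`. -/
def dProd (p : SOSModel N) (l : ℂ) : ℂ := p.aProd (l - p.η)

/-- `s_h = ∑ₖ (1 - 2hₖ)`. -/
def spin (h : SpinConfig N) : ℤ := ∑ k, (1 - 2 * ((h k : ℕ) : ℤ))

/-- The operator `e^{iyηS} θ(τ + ηS) / θ(τ)`. -/
def qdetFactor (p : SOSModel N) : Module.End ℂ (DynSpace N) :=
  p.subst fun t => Matrix.diagonal fun h =>
    Complex.exp (Complex.I * p.yc * p.η * spin h) * (p.θ (t + p.η * spin h) / p.θ t)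

/-- The quantum determinant relation
`e^{iyηS} θ(τ+ηS)/θ(τ) (𝒜(λ)𝒟(λ-η) - ℬ(λ)𝒞(λ-η)) = 𝖺(λ)𝖽(λ-η)`
with an arbitrary operator `X` in the place of `A(λ|τ)`, that is, `X T_τ⁺` in the place of `𝒜(λ)`. -/
def QDet1 (p : SOSModel N) (l : ℂ) (X : Module.End ℂ (DynSpace N)) : Prop :=
  p.qdetFactor * ((X * T N 1) * p.calD (l - p.η) - p.calB l * p.calC (l - p.η))
    = (p.aProd l * p.dProd (l - p.η)) • (1 : Module.End ℂ (DynSpace N))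

/-- The quantum determinant relation
`e^{iyηS} θ(τ+ηS)/θ(τ) (𝒟(μ)𝒜(μ-η) - 𝒞(μ)ℬ(μ-η)) = 𝖺(μ)𝖽(μ-η)`, at `μ = λ + η`,
with an arbitrary operator `X` in the place of `A(λ|τ)`, that is, `X T_τ⁺` in the place of `𝒜(λ)`. -/
def QDet2 (p : SOSModel N) (l : ℂ) (X : Module.End ℂ (DynSpace N)) : Prop :=
  p.qdetFactor * (p.calD (l + p.η) * (X * T N 1) - p.calC (l + p.η) * p.calB l)
    = (p.aProd (l + p.η) * p.dProd l) • (1 : Module.End ℂ (DynSpace N))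

/-! ### The SOV states -/

/-- `t_{r,h} = -η s_h/2 + xπ/2 + yπω/2 + rη`. -/
def tval (p : SOSModel N) (r : ℤ) (h : SpinConfig N) : ℂ :=
  -(p.η / 2) * spin h + p.xc * (Real.pi / 2) + p.yc * (Real.pi / 2) * p.ω + r * p.η

/-- The integer `a` with `|t_{r,h}⟩ = |t(a)⟩` and `⟨t_{r,h}| = ⟨t(a)|`. -/
def heightIndex (r : ℤ) (h : SpinConfig N) : ℤ := -(∑ k, ((h k : ℕ) : ℤ)) - r

theorem height_heightIndex (p : SOSModel N) (r : ℤ) (h : SpinConfig N) :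
    p.height (heightIndex r h) = p.tval r h := by
  simp only [height, heightIndex, tval, t0, spin, Finset.sum_sub_distrib, ← Finset.mul_sum]
  push_cast
  simp only [Finset.sum_const, Finset.card_univ, Fintype.card_fin, nsmul_eq_mul, mul_one]
  ring

/-- `⟨r,0| = n⁻¹ (⊗ₙ ⟨n,0|) ⊗ ⟨t_{r,0}|`, for the normalization constant `n = nz`. -/
def leftRef (nz : ℂ) (r : ℤ) : DynCovector N :=
  (1 / nz) • Finsupp.lapply ((fun _ => 0 : SpinConfig N), heightIndex r (fun _ => 0 : SpinConfig N))

/-- `|1,r⟩ = n⁻¹ (⊗ₙ |n,1⟩) ⊗ |t_{r,1}⟩`, for the normalization constant `n = nz`. -/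
def rightRef (nz : ℂ) (r : ℤ) : DynSpace N :=
  (1 / nz) • Finsupp.single
    ((fun _ => 1 : SpinConfig N), heightIndex r (fun _ => 1 : SpinConfig N)) (1 : ℂ)

/-- The product `O₁ O₂ ⋯ O_N` of operators. -/
def opProd (O : Fin N → Module.End ℂ (DynSpace N)) : Module.End ℂ (DynSpace N) :=
  ((List.finRange N).map O).prod

/-- `⟨r,h| = ⟨r,0| ∏ₙ (𝒞(ξₙ)/𝖽(ξₙ-η))^{hₙ}`. -/
def leftState (p : SOSModel N) (nz : ℂ) (r : ℤ) (h : SpinConfig N) : DynCovector N :=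
  leftRef nz r ∘ₗ
    opProd fun n => ((1 / p.dProd (p.ξ n - p.η)) • p.calC (p.ξ n)) ^ (h n : ℕ)

/-- `|h,r⟩ = ∏ₙ (𝒞(ξₙ-η)/𝖽(ξₙ-η))^{1-hₙ} |1,r⟩`. -/
def rightState (p : SOSModel N) (nz : ℂ) (h : SpinConfig N) (r : ℤ) : DynSpace N :=
  opProd (fun n => ((1 / p.dProd (p.ξ n - p.η)) • p.calC (p.ξ n - p.η)) ^ (1 - (h n : ℕ)))
    (rightRef nz r)

/-- `⟨r,0| ∏ₙ (T_τ⁻ 𝒞(ξₙ) T_τ⁺/𝖽(ξₙ-η))^{hₙ}`. -/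
def leftStateShift (p : SOSModel N) (nz : ℂ) (r : ℤ) (h : SpinConfig N) : DynCovector N :=
  leftRef nz r ∘ₗ
    opProd fun n =>
      ((1 / p.dProd (p.ξ n - p.η)) • (T N (-1) * p.calC (p.ξ n) * T N 1)) ^ (h n : ℕ)

/-- `∏ₙ (T_τ⁺ 𝒞(ξₙ-η) T_τ⁻/𝖽(ξₙ-η))^{1-hₙ} |1,r⟩`. -/
def rightStateShift (p : SOSModel N) (nz : ℂ) (h : SpinConfig N) (r : ℤ) : DynSpace N :=
  opProd
    (fun n =>
      ((1 / p.dProd (p.ξ n - p.η)) • (T N 1 * p.calC (p.ξ n - p.η) * T N (-1))) ^ (1 - (h n : ℕ)))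
    (rightRef nz r)

/-! ### The coefficients -/

/-- `T_a⁺ h = (h₁, …, h_a + 1, …, h_N)` when `h_a = 0`. When `h_a = 1`, `h_a + 1` is out of range; the
value is then irrelevant, since `T_a⁺ h` only occurs with a coefficient that contains
`𝖽(ξ_a) = 0` (left) or `𝖺(ξ_a - η) = 0` (right). -/
def raise (i : Fin N) (h : SpinConfig N) : SpinConfig N := Function.update h i 1

/-- `T_a⁻ h = (h₁, …, h_a - 1, …, h_N)` when `h_a = 1`. When `h_a = 0`, `h_a - 1` is out of range; the
value is then irrelevant, since `T_a⁻ h` only occurs with a coefficient that contains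
`𝖺(ξ_a - η) = 0` (left) or `𝖽(ξ_a) = 0` (right). -/
def lower (i : Fin N) (h : SpinConfig N) : SpinConfig N := Function.update h i 0

/-- `ξ_a^{(k)} = ξ_a - ηk`. -/
def ξs (p : SOSModel N) (i : Fin N) (k : ℕ) : ℂ := p.ξ i - p.η * k

/-- `d_{r,h}(λ) = e^{-iyη(s_h - s_1)/2} θ(t_{r,h})/θ(t_{r,1}) ∏ₙ θ(λ - ξₙ^{(hₙ)})`. -/
def dEig (p : SOSModel N) (r : ℤ) (h : SpinConfig N) (l : ℂ) : ℂ :=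
  Complex.exp (-Complex.I * p.yc * p.η
      * (((spin h : ℂ) - (spin (fun _ => 1 : SpinConfig N) : ℂ)) / 2))
    * (p.θ (p.tval r h) / p.θ (p.tval r (fun _ => 1)))
    * ∏ n, p.θ (l - p.ξs n (h n))

/-- The interpolation coefficient
`e^{iy(ξ_a^{(h_a)} - λ)} θ(t - λ + ξ_a^{(h_a)})/θ(t) ∏_{b≠a} θ(λ - ξ_b^{(h_b)})/θ(ξ_a^{(h_a)} - ξ_b^{(h_b)})`. -/
def interp (p : SOSModel N) (t : ℂ) (h : SpinConfig N) (i : Fin N) (l : ℂ) : ℂ :=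
  Complex.exp (Complex.I * p.yc * (p.ξs i (h i) - l))
    * (p.θ (t - l + p.ξs i (h i)) / p.θ t)
    * ∏ j ∈ Finset.univ.erase i, p.θ (l - p.ξs j (h j)) / p.θ (p.ξs i (h i) - p.ξs j (h j))

/-- `𝖺^{(±)}_{x,y,r,h}(λ) = (-1)^{x+y+xy} e^{2iyrη} θ(t_{r,h} ± η)/θ(t_{-r,h} ± η) 𝖺(λ)`, with
`ε = ±1` for the sign. -/
def aPM (p : SOSModel N) (ε : ℤ) (r : ℤ) (h : SpinConfig N) (l : ℂ) : ℂ :=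
  (-1) ^ ((p.x : ℕ) + (p.y : ℕ) + (p.x : ℕ) * (p.y : ℕ))
    * Complex.exp (2 * Complex.I * p.yc * r * p.η)
    * (p.θ (p.tval r h + ε * p.η) / p.θ (p.tval (-r) h + ε * p.η))
    * p.aProd l

end SOSModel

end

/-! ### Theta function: duplication formula, quasi-periods and three-term relation. -/

noncomputable section

open Complex Filter Topology

/-! Everything rests on one identity. Splitting a double theta series by parity gives θ(x+y)θ(x−y) =
F(x)G(y) − G(x)F(y), with F and G theta functions of modulus 2ω (`θ_add_mul_θ_sub`). The Plücker
relation for these 2×2 minors is the three-term relation `θ_three_term`. Dependence of the vectors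
(F, G)(x) and (F, G)(y) is thus governed by zeros of θ, which yields both the zero set of θ
(`θ_eq_zero_iff`) and elliptic Lagrange interpolation (`thetaProd_interpolation`): a product of n
thetas with prescribed sum of zeros is determined by its values at n generic nodes.

With φ(t) = e^{iyt}θ(t) absorbing the gauge factors, the three-term relation gives the dynamical
Yang–Baxter equation and single-site fusion. The ice rule turns the dynamical shift in a product of
two monodromy matrices into a local shift (`MM_succ`), so induction on the sites yields the exchange
relations (`MM_exchange`), the quantum determinant (`MM_sub_MM`) and the degenerations 𝒞(ξ)𝒞(ξ−η) =
0 and ℬ(ξ−η)ℬ(ξ) = 0. The same recursion puts every matrix element, up to an exponential, in an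
interpolation space whose sum of zeros depends only on weights (`exists_Mentry_eq`).

The SOV states are joint eigenvectors of τ and S. For 𝒟, the formula holds on the reference state
and spreads to all h by exchanging 𝒟(λ) with the 𝒞's that build the state; the unwanted term carries
a zero of the coefficient already known. For 𝒞, the action at the nodes ξ_a^{(h_a)} either changes
h_a by construction or vanishes by degeneration, and interpolation gives all λ. For ℬ, the action at
a node comes from the quantum determinant, whose other term dies because 𝒟 annihilates the state
there, or again vanishes by degeneration. The interpolation parameter for ℬ is −(t_{r,h} + ηs_h),
which is t_{−r,h} up to the lattice vector xπ + yπω; this is where −r and the sign (−1)^{x+y+xy}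
come from.

Finally D(λ|t) is triangular in the spins, hence 𝒟(λ) is invertible away from the zeros of its
diagonal, and either quantum determinant relation can be solved for A. The exceptional λ are
countable, so continuity covers them. -/

/-- Pairs of integers, split by the parity of their sum. -/
def intPairParityEquiv : (ℤ × ℤ) ⊕ (ℤ × ℤ) ≃ ℤ × ℤ where
  toFun := Sum.elim (fun z => (z.1 + z.2, z.1 - z.2)) (fun z => (z.1 + z.2 + 1, z.1 - z.2))
  invFun z := if (z.1 + z.2) % 2 = 0 then .inl ((z.1 + z.2) / 2, (z.1 - z.2) / 2)
    else .inr ((z.1 + z.2) / 2, (z.1 - z.2) / 2)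
  left_inv := by
    rintro (⟨m, n⟩ | ⟨m, n⟩)
    · have h : (m + n + (m - n)) % 2 = 0 := by lia
      refine (if_pos h).trans (congrArg Sum.inl (Prod.ext ?_ ?_)) <;>
        simp only [Sum.elim_inl] <;> lia
    · have h : ¬ (m + n + 1 + (m - n)) % 2 = 0 := by lia
      refine (if_neg h).trans (congrArg Sum.inr (Prod.ext ?_ ?_)) <;>
        simp only [Sum.elim_inr] <;> lia
  right_inv := by
    rintro ⟨m, n⟩
    by_cases h : (m + n) % 2 = 0
    · simp only [if_pos h, Sum.elim_inl, Prod.mk.injEq]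
      constructor <;> lia
    · simp only [if_neg h, Sum.elim_inr, Prod.mk.injEq]
      constructor <;> lia

/-- Sum and difference of the indices diagonalize m² + n² into 2a² + 2b²; this is what doubles the
modulus of a product of theta series. -/
theorem tsum_int_prod_parity {f : ℤ × ℤ → ℂ} (hf : Summable f) :
    ∑' z, f z = ∑' z : ℤ × ℤ, f (z.1 + z.2, z.1 - z.2) +
      ∑' z : ℤ × ℤ, f (z.1 + z.2 + 1, z.1 - z.2) := by
  have h := (intPairParityEquiv.summable_iff (f := f)).2 hf
  rw [← intPairParityEquiv.tsum_eq, Summable.tsum_sum]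
  · rfl
  · exact h.comp_injective Sum.inl_injective
  · exact h.comp_injective Sum.inr_injective

/-- The duplication formula for products of theta functions with the same modulus. -/
theorem jacobiTheta₂_mul_jacobiTheta₂ (u v : ℂ) {τ : ℂ} (hτ : 0 < τ.im) :
    jacobiTheta₂ u τ * jacobiTheta₂ v τ =
      jacobiTheta₂ (u + v) (2 * τ) * jacobiTheta₂ (u - v) (2 * τ) +
        cexp (Real.pi * I * τ + 2 * Real.pi * I * u) *
          (jacobiTheta₂ (u + v + τ) (2 * τ) * jacobiTheta₂ (u - v + τ) (2 * τ)) := by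
  have h2 : 0 < (2 * τ).im := by simpa using hτ
  have hs : ∀ z, Summable fun n : ℤ => ‖jacobiTheta₂_term n z τ‖ := fun z =>
    ((summable_jacobiTheta₂_term_iff z τ).2 hτ).norm
  have hs2 : ∀ z, Summable fun n : ℤ => ‖jacobiTheta₂_term n z (2 * τ)‖ := fun z =>
    ((summable_jacobiTheta₂_term_iff z (2 * τ)).2 h2).norm
  have h1 : jacobiTheta₂ u τ * jacobiTheta₂ v τ =
      ∑' z : ℤ × ℤ, jacobiTheta₂_term z.1 u τ * jacobiTheta₂_term z.2 v τ :=
    tsum_mul_tsum_of_summable_norm (hs u) (hs v)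
  have h2 : ∀ u v, jacobiTheta₂ u (2 * τ) * jacobiTheta₂ v (2 * τ) =
      ∑' z : ℤ × ℤ, jacobiTheta₂_term z.1 u (2 * τ) * jacobiTheta₂_term z.2 v (2 * τ) :=
    fun u v => tsum_mul_tsum_of_summable_norm (hs2 u) (hs2 v)
  rw [h1, h2, h2, ← tsum_mul_left,
    tsum_int_prod_parity (summable_mul_of_summable_norm (hs u) (hs v))]
  congr 1
  · refine tsum_congr fun z => ?_
    rw [jacobiTheta₂_term, jacobiTheta₂_term, jacobiTheta₂_term, jacobiTheta₂_term,
      ← Complex.exp_add, ← Complex.exp_add]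
    congr 1
    push_cast
    ring
  -- For m = a+b+1, n = a−b the form is 2a² + 2b² + 2(a+b) + 1: the linear part shifts both
  -- arguments by τ, and the constant part together with the extra u is the exponential prefactor.
  · refine tsum_congr fun z => ?_
    rw [jacobiTheta₂_term, jacobiTheta₂_term, jacobiTheta₂_term, jacobiTheta₂_term,
      ← Complex.exp_add, ← Complex.exp_add, ← Complex.exp_add]
    congr 1
    push_cast
    ring

/-- The constant Fourier coefficient of `jacobiTheta₂ · τ` is `1`. -/
theorem integral_jacobiTheta₂ {τ : ℂ} (hτ : 0 < τ.im) :
    ∫ x in (0 : ℝ)..1, jacobiTheta₂ x τ = 1 := by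
  have hsum := intervalIntegral.hasSum_integral_of_dominated_convergence
    (μ := MeasureTheory.volume) (a := 0) (b := 1)
    (F := fun (n : ℤ) (x : ℝ) => jacobiTheta₂_term n x τ)
    (f := fun x : ℝ => jacobiTheta₂ x τ)
    (fun n _ => ‖jacobiTheta₂_term n 0 τ‖)
    (fun n => by
      apply Continuous.aestronglyMeasurable
      unfold jacobiTheta₂_term
      fun_prop)
    (fun n => by
      refine Eventually.of_forall fun x _ => le_of_eq ?_
      simp [norm_jacobiTheta₂_term])
    (Eventually.of_forall fun x _ => ((summable_jacobiTheta₂_term_iff 0 τ).2 hτ).norm)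
    (by simp)
    (Eventually.of_forall fun x _ => hasSum_jacobiTheta₂_term x hτ)
  have hterm : ∀ n : ℤ, ∫ x in (0 : ℝ)..1, jacobiTheta₂_term n x τ = if n = 0 then 1 else 0 := by
    intro n
    split_ifs with hn
    · subst hn; simp [jacobiTheta₂_term]
    · have hc : (2 * Real.pi * I * n : ℂ) ≠ 0 := by
        simp [Real.pi_ne_zero, hn]
      simp only [jacobiTheta₂_term, Complex.exp_add, intervalIntegral.integral_mul_const]
      rw [integral_exp_mul_complex hc]
      have : cexp (2 * Real.pi * I * n) = 1 := by
        rw [show (2 * Real.pi * I * n : ℂ) = n * (2 * Real.pi * I) by ring]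
        exact exp_int_mul_two_pi_mul_I n
      simp [this]
  simp only [hterm] at hsum
  exact hsum.unique (hasSum_ite_eq 0 1)

theorem exists_jacobiTheta₂_ne_zero {τ : ℂ} (hτ : 0 < τ.im) : ∃ z, jacobiTheta₂ z τ ≠ 0 := by
  by_contra! h
  have := integral_jacobiTheta₂ hτ
  simp [h] at this

namespace SOSModel

variable {N : ℕ}

/-- The sign (−1)^k becomes the shift 1/2 and the half-integer summation the shift ω/2.
Differentiability and quasi-periods are then inherited from `jacobiTheta₂`. -/
theorem θ_eq (p : SOSModel N) (z : ℂ) :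
    p.θ z = -I * cexp (I * Real.pi * p.ω / 4 + I * z) *
      jacobiTheta₂ (z / Real.pi + 1 / 2 + p.ω / 2) p.ω := by
  rw [θ, jacobiTheta₂, mul_assoc (-I), ← tsum_mul_left (a := cexp _)]
  congr 1
  refine tsum_congr fun k => ?_
  have h1 : (-1 : ℂ) ^ k = cexp (k * (Real.pi * I)) := by
    rw [Complex.exp_int_mul, Complex.exp_pi_mul_I]
  have hp : (Real.pi : ℂ) ≠ 0 := by exact_mod_cast Real.pi_ne_zero
  rw [h1, jacobiTheta₂_term, ← Complex.exp_add, ← Complex.exp_add, ← Complex.exp_add]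
  congr 1
  field_simp
  ring

theorem θ_neg (p : SOSModel N) (z : ℂ) : p.θ (-z) = -p.θ z := by
  have hp : (Real.pi : ℂ) ≠ 0 := by exact_mod_cast Real.pi_ne_zero
  rw [θ_eq, θ_eq, ← jacobiTheta₂_neg_left,
    show -(-z / Real.pi + 1 / 2 + p.ω / 2) = (z / Real.pi - 1 / 2 - p.ω / 2) by ring,
    show (z / Real.pi + 1 / 2 + p.ω / 2) = (z / Real.pi - 1 / 2 - p.ω / 2) + p.ω + 1 by ring,
    jacobiTheta₂_add_left, jacobiTheta₂_add_left', ← mul_assoc,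
    mul_assoc (-I) _ (cexp (-Real.pi * I * _)), ← Complex.exp_add]
  rw [show I * Real.pi * p.ω / 4 + I * z +
      -Real.pi * I * (p.ω + 2 * (z / Real.pi - 1 / 2 - p.ω / 2)) =
      I * Real.pi * p.ω / 4 + I * -z + Real.pi * I by field_simp; ring,
      Complex.exp_add _ (Real.pi * I), Complex.exp_pi_mul_I]
  ring

theorem θ_zero (p : SOSModel N) : p.θ 0 = 0 := by
  have := p.θ_neg 0
  rw [neg_zero] at this
  linear_combination this / 2

theorem θ_add_pi (p : SOSModel N) (z : ℂ) : p.θ (z + Real.pi) = -p.θ z := by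
  have hp : (Real.pi : ℂ) ≠ 0 := by exact_mod_cast Real.pi_ne_zero
  rw [θ_eq, θ_eq, show (z + Real.pi) / Real.pi + 1 / 2 + p.ω / 2
    = z / Real.pi + 1 / 2 + p.ω / 2 + 1 by field_simp; ring, jacobiTheta₂_add_left,
    show I * Real.pi * p.ω / 4 + I * (z + Real.pi) = I * Real.pi * p.ω / 4 + I * z + Real.pi * I by
      ring, Complex.exp_add, Complex.exp_pi_mul_I]
  ring

theorem θ_add_pi_mul_ω (p : SOSModel N) (z : ℂ) :
    p.θ (z + Real.pi * p.ω) = -cexp (-I * Real.pi * p.ω - 2 * I * z) * p.θ z := by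
  have hp : (Real.pi : ℂ) ≠ 0 := by exact_mod_cast Real.pi_ne_zero
  rw [θ_eq, θ_eq, show (z + Real.pi * p.ω) / Real.pi + 1 / 2 + p.ω / 2
    = z / Real.pi + 1 / 2 + p.ω / 2 + p.ω by field_simp; ring, jacobiTheta₂_add_left',
    ← mul_assoc, mul_assoc (-I) _ (cexp (-Real.pi * I * _)), ← Complex.exp_add,
    show I * Real.pi * p.ω / 4 + I * (z + Real.pi * p.ω) +
      -Real.pi * I * (p.ω + 2 * (z / Real.pi + 1 / 2 + p.ω / 2)) =
      (-I * Real.pi * p.ω - 2 * I * z) + (I * Real.pi * p.ω / 4 + I * z) - Real.pi * I by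
      field_simp; ring, Complex.exp_sub, Complex.exp_pi_mul_I, Complex.exp_add]
  ring

/-- The first of the two functions of modulus `2ω` through which `θ` factors. -/
def thetaF (p : SOSModel N) (x : ℂ) : ℂ := jacobiTheta₂ (2 * x / Real.pi) (2 * p.ω)

/-- The second of the two functions of modulus `2ω` through which `θ` factors. -/
def thetaG (p : SOSModel N) (x : ℂ) : ℂ :=
  cexp (I * Real.pi * p.ω / 2 + 2 * I * x) * jacobiTheta₂ (2 * x / Real.pi + p.ω) (2 * p.ω)

/-- The duplication formula at the half-period-shifted arguments; the sign of the second term is the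
e^{iπ} produced when the odd class is reduced by quasi-periodicity. As a 2×2 minor it makes
quadratic theta identities a matter of linear algebra. -/
theorem θ_add_mul_θ_sub (p : SOSModel N) (hω : 0 < p.ω.im) (x y : ℂ) :
    p.θ (x + y) * p.θ (x - y) = p.thetaF x * p.thetaG y - p.thetaG x * p.thetaF y := by
  have hp : (Real.pi : ℂ) ≠ 0 := by exact_mod_cast Real.pi_ne_zero
  have key := jacobiTheta₂_mul_jacobiTheta₂ ((x + y) / Real.pi + 1 / 2 + p.ω / 2)
    ((x - y) / Real.pi + 1 / 2 + p.ω / 2) hω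
  rw [show (x + y) / Real.pi + 1 / 2 + p.ω / 2 + ((x - y) / Real.pi + 1 / 2 + p.ω / 2)
      = 2 * x / Real.pi + p.ω + 1 by ring,
    show (x + y) / Real.pi + 1 / 2 + p.ω / 2 - ((x - y) / Real.pi + 1 / 2 + p.ω / 2)
      = 2 * y / Real.pi by ring, jacobiTheta₂_add_left,
    show 2 * x / Real.pi + p.ω + 1 + p.ω = 2 * x / Real.pi + 2 * p.ω + 1 by ring,
    jacobiTheta₂_add_left, jacobiTheta₂_add_left'] at key
  rw [θ_eq, θ_eq, thetaF, thetaF, thetaG, thetaG]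
  have e1 : cexp (I * Real.pi * p.ω / 4 + I * (x + y)) * cexp (I * Real.pi * p.ω / 4 + I * (x - y))
      = cexp (I * Real.pi * p.ω / 2 + 2 * I * x) := by
    rw [← Complex.exp_add]; congr 1; ring
  have e2 : cexp (I * Real.pi * p.ω / 2 + 2 * I * x) *
      cexp (Real.pi * I * p.ω + 2 * Real.pi * I * ((x + y) / Real.pi + 1 / 2 + p.ω / 2)) *
      cexp (-Real.pi * I * (2 * p.ω + 2 * (2 * x / Real.pi))) =
      -cexp (I * Real.pi * p.ω / 2 + 2 * I * y) := by
    rw [← Complex.exp_add, ← Complex.exp_add, show I * Real.pi * p.ω / 2 + 2 * I * x +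
      (Real.pi * I * p.ω + 2 * Real.pi * I * ((x + y) / Real.pi + 1 / 2 + p.ω / 2)) +
      -Real.pi * I * (2 * p.ω + 2 * (2 * x / Real.pi)) =
      I * Real.pi * p.ω / 2 + 2 * I * y + Real.pi * I by field_simp; ring, Complex.exp_add,
      Complex.exp_pi_mul_I]
    ring
  linear_combination (I ^ 2 * cexp (I * Real.pi * p.ω / 2 + 2 * I * x)) * key
    + (I ^ 2 * jacobiTheta₂ ((x + y) / Real.pi + 1 / 2 + p.ω / 2) p.ω
      * jacobiTheta₂ ((x - y) / Real.pi + 1 / 2 + p.ω / 2) p.ω) * e1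
    + (I ^ 2 * jacobiTheta₂ (2 * x / Real.pi) (2 * p.ω)
      * jacobiTheta₂ (2 * y / Real.pi + p.ω) (2 * p.ω)) * e2
    + (cexp (I * Real.pi * p.ω / 2 + 2 * I * x) *
        jacobiTheta₂ (2 * x / Real.pi + p.ω) (2 * p.ω) * jacobiTheta₂ (2 * y / Real.pi) (2 * p.ω)
      - jacobiTheta₂ (2 * x / Real.pi) (2 * p.ω)
      * jacobiTheta₂ (2 * y / Real.pi + p.ω) (2 * p.ω)
      * cexp (I * Real.pi * p.ω / 2 + 2 * I * y)) * Complex.I_sq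

/-- The three-term (Weierstrass) relation. -/
theorem θ_three_term (p : SOSModel N) (hω : 0 < p.ω.im) (a b c d : ℂ) :
    p.θ (a + b) * p.θ (a - b) * (p.θ (c + d) * p.θ (c - d))
      - p.θ (a + c) * p.θ (a - c) * (p.θ (b + d) * p.θ (b - d))
      + p.θ (a + d) * p.θ (a - d) * (p.θ (b + c) * p.θ (b - c)) = 0 := by
  -- The six products are the 2×2 minors of the 2×4 matrix with columns (F, G) at a, b, c, d, so the
  -- claim is the Plücker relation.
  simp only [p.θ_add_mul_θ_sub hω]
  ring

theorem differentiable_θ (p : SOSModel N) (hω : 0 < p.ω.im) : Differentiable ℂ p.θ := by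
  have : p.θ = fun z => -I * cexp (I * Real.pi * p.ω / 4 + I * z) *
      jacobiTheta₂ (z / Real.pi + 1 / 2 + p.ω / 2) p.ω := funext p.θ_eq
  rw [this]
  have hJ : Differentiable ℂ fun z => jacobiTheta₂ z p.ω := fun z =>
    differentiableAt_jacobiTheta₂_fst z hω
  have : Differentiable ℂ fun z : ℂ => jacobiTheta₂ (z / Real.pi + 1 / 2 + p.ω / 2) p.ω :=
    hJ.comp (g := fun z => jacobiTheta₂ z p.ω) (by fun_prop)
  fun_prop

theorem exists_θ_ne_zero (p : SOSModel N) (hω : 0 < p.ω.im) : ∃ z, p.θ z ≠ 0 := by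
  have hp : (Real.pi : ℂ) ≠ 0 := by exact_mod_cast Real.pi_ne_zero
  obtain ⟨w, hw⟩ := exists_jacobiTheta₂_ne_zero hω
  refine ⟨Real.pi * (w - 1 / 2 - p.ω / 2), ?_⟩
  rw [θ_eq, show Real.pi * (w - 1 / 2 - p.ω / 2) / Real.pi + 1 / 2 + p.ω / 2 = w by
    field_simp; ring]
  simp [hw, Complex.exp_ne_zero]

theorem differentiable_thetaF (p : SOSModel N) (hω : 0 < p.ω.im) : Differentiable ℂ p.thetaF := by
  have h2 : 0 < (2 * p.ω).im := by simpa using hω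
  have hJ : Differentiable ℂ fun z => jacobiTheta₂ z (2 * p.ω) := fun z =>
    differentiableAt_jacobiTheta₂_fst z h2
  exact hJ.comp (g := fun z => jacobiTheta₂ z (2 * p.ω)) (f := fun x : ℂ => 2 * x / Real.pi)
    (by fun_prop)

theorem differentiable_thetaG (p : SOSModel N) (hω : 0 < p.ω.im) : Differentiable ℂ p.thetaG := by
  have h2 : 0 < (2 * p.ω).im := by simpa using hω
  have hJ : Differentiable ℂ fun z => jacobiTheta₂ z (2 * p.ω) := fun z =>
    differentiableAt_jacobiTheta₂_fst z h2
  have : Differentiable ℂ fun x : ℂ => jacobiTheta₂ (2 * x / Real.pi + p.ω) (2 * p.ω) :=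
    hJ.comp (g := fun z => jacobiTheta₂ z (2 * p.ω)) (by fun_prop)
  unfold thetaG
  fun_prop

end SOSModel
end

/-! ### The zeros of θ. -/

noncomputable section

open Complex Filter Topology

/-- A product of two entire functions vanishes identically only if one of the factors does. -/
theorem Differentiable.eq_zero_or_eq_zero_of_mul_eq_zero {f g : ℂ → ℂ} (hf : Differentiable ℂ f)
    (hg : Differentiable ℂ g) (h : ∀ z, f z * g z = 0) : (∀ z, f z = 0) ∨ ∀ z, g z = 0 := by
  have := AnalyticOnNhd.eq_zero_or_eq_zero_of_mul_eq_zero (U := Set.univ)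
    (fun z _ => hf.analyticAt z) (fun z _ => hg.analyticAt z) (fun z _ => h z)
    isPreconnected_univ
  simpa using this

/-- An entire function with the periods `π` and `πω`, `Im ω > 0`, is constant. -/
theorem Differentiable.apply_eq_of_doubly_periodic {f : ℂ → ℂ} (hf : Differentiable ℂ f) {ω : ℂ}
    (hω : 0 < ω.im) (h₁ : ∀ z, f (z + Real.pi) = f z) (h₂ : ∀ z, f (z + Real.pi * ω) = f z)
    (z w : ℂ) : f z = f w := by
  have hpi : (0 : ℝ) < Real.pi := Real.pi_pos
  have h₁' : ∀ (n : ℤ) z, f (z + n * Real.pi) = f z := fun n z => by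
    simpa using (show Function.Periodic f (Real.pi : ℂ) from h₁).int_mul n z
  have h₂' : ∀ (n : ℤ) z, f (z + n * (Real.pi * ω)) = f z := fun n z => by
    simpa using (show Function.Periodic f (Real.pi * ω) from h₂).int_mul n z
  apply hf.apply_eq_apply_of_bounded
  have hc : IsCompact (f '' Metric.closedBall 0 (Real.pi + Real.pi * ‖ω‖)) :=
    (isCompact_closedBall _ _).image hf.continuous
  refine hc.isBounded.subset ?_
  rintro _ ⟨z, rfl⟩
  -- Real coordinates in the basis π, πω; their fractional parts place a translate of z in a bounded
  -- parallelogram.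
  set t : ℝ := z.im / (Real.pi * ω.im) with ht
  set s : ℝ := (z.re - t * Real.pi * ω.re) / Real.pi with hs
  have hz : z = s * Real.pi + t * (Real.pi * ω) := by
    apply Complex.ext
    · simp only [add_re, mul_re, ofReal_re, ofReal_im, mul_im, zero_mul, mul_zero, sub_zero,
        add_zero]
      rw [hs]; field_simp; ring
    · simp only [add_im, mul_im, mul_re, ofReal_re, ofReal_im, zero_mul, mul_zero, sub_zero,
        add_zero, zero_add]
      rw [ht]; field_simp
  refine ⟨Int.fract s * Real.pi + Int.fract t * (Real.pi * ω), ?_, ?_⟩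
  · rw [mem_closedBall_zero_iff]
    refine (norm_add_le _ _).trans (add_le_add ?_ ?_)
    · rw [norm_mul, norm_real, norm_real, Real.norm_of_nonneg (Int.fract_nonneg s),
        Real.norm_of_nonneg hpi.le]
      exact mul_le_of_le_one_left hpi.le (Int.fract_lt_one s).le
    · rw [norm_mul, norm_mul, norm_real, norm_real, Real.norm_of_nonneg (Int.fract_nonneg t),
        Real.norm_of_nonneg hpi.le]
      exact mul_le_of_le_one_left (by positivity) (Int.fract_lt_one t).le
  · conv_rhs => rw [hz]
    have e : (s * Real.pi + t * (Real.pi * ω) : ℂ) =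
        (Int.fract s * Real.pi + Int.fract t * (Real.pi * ω)) + (⌊s⌋ : ℤ) * (Real.pi : ℂ)
          + (⌊t⌋ : ℤ) * (Real.pi * ω) := by
      have h1 : (s : ℂ) = (Int.fract s : ℝ) + (⌊s⌋ : ℤ) := by
        rw [← ofReal_intCast, ← ofReal_add, Int.fract_add_floor]
      have h2 : (t : ℂ) = (Int.fract t : ℝ) + (⌊t⌋ : ℤ) := by
        rw [← ofReal_intCast, ← ofReal_add, Int.fract_add_floor]
      linear_combination Real.pi * h1 + Real.pi * ω * h2
    rw [e, h₂', h₁']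

/-- A nowhere vanishing entire function with constant multipliers for the lattice `πℤ + πωℤ` is an
exponential. -/
theorem exists_eq_exp_of_multipliers {e : ℂ → ℂ} (he : Differentiable ℂ e)
    (he0 : ∀ z, e z ≠ 0) {ω m₁ m₂ : ℂ} (hω : 0 < ω.im) (h₁ : ∀ z, e (z + Real.pi) = m₁ * e z)
    (h₂ : ∀ z, e (z + Real.pi * ω) = m₂ * e z) : ∃ c, ∀ z, e z = e 0 * cexp (c * z) := by
  have hd : Differentiable ℂ (deriv e) := he.contDiff.differentiable_deriv_two
  -- Constant multipliers cancel in the logarithmic derivative, which is therefore entire and doubly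
  -- periodic, hence constant.
  have hL : Differentiable ℂ fun z => deriv e z / e z := hd.div he he0
  have hper : ∀ {a m : ℂ}, (∀ z, e (z + a) = m * e z) →
      ∀ z, deriv e (z + a) / e (z + a) = deriv e z / e z := by
    intro a m h z
    have hm : m ≠ 0 := fun h0 => he0 (z + a) (by rw [h, h0, zero_mul])
    have : deriv e (z + a) = m * deriv e z := by
      rw [← deriv_comp_add_const, show (fun x => e (x + a)) = fun x => m * e x from funext h,
        deriv_const_mul _ (he z)]
    rw [this, h, mul_div_mul_left _ _ hm]
  have hconst := hL.apply_eq_of_doubly_periodic hω (hper h₁) (hper h₂)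
  set c := deriv e 0 / e 0 with hc
  refine ⟨c, fun z => ?_⟩
  have hg : Differentiable ℂ fun z => e z * cexp (-(c * z)) := by fun_prop
  have hg' : ∀ z, deriv (fun z => e z * cexp (-(c * z))) z = 0 := by
    intro z
    have h1 : HasDerivAt (fun z => cexp (-(c * z))) (cexp (-(c * z)) * -(c * 1)) z :=
      (((hasDerivAt_id z).const_mul c).neg).cexp
    refine ((he z).hasDerivAt.mul h1).deriv.trans ?_
    have : deriv e z = c * e z := by
      rw [← div_eq_iff (he0 z)]; exact hconst z 0
    rw [this]; ring
  have := is_const_of_deriv_eq_zero hg hg' z 0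
  simp only [mul_zero, neg_zero, Complex.exp_zero, mul_one] at this
  rw [← this, mul_assoc, ← Complex.exp_add, neg_add_cancel, Complex.exp_zero, mul_one]

namespace SOSModel

variable {N : ℕ}

theorem thetaF_add_pi (p : SOSModel N) (x : ℂ) : p.thetaF (x + Real.pi) = p.thetaF x := by
  have hp : (Real.pi : ℂ) ≠ 0 := by exact_mod_cast Real.pi_ne_zero
  rw [thetaF, thetaF, show 2 * (x + Real.pi) / Real.pi = 2 * x / Real.pi + 1 + 1 by
    field_simp; ring, jacobiTheta₂_add_left, jacobiTheta₂_add_left]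

theorem thetaG_add_pi (p : SOSModel N) (x : ℂ) : p.thetaG (x + Real.pi) = p.thetaG x := by
  have hp : (Real.pi : ℂ) ≠ 0 := by exact_mod_cast Real.pi_ne_zero
  rw [thetaG, thetaG, show 2 * (x + Real.pi) / Real.pi + p.ω = 2 * x / Real.pi + p.ω + 1 + 1 by
    field_simp; ring, jacobiTheta₂_add_left, jacobiTheta₂_add_left,
    show I * Real.pi * p.ω / 2 + 2 * I * (x + Real.pi) =
      I * Real.pi * p.ω / 2 + 2 * I * x + 2 * Real.pi * I by ring, Complex.exp_add _ (2 * _ * _),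
    Complex.exp_two_pi_mul_I, mul_one]

theorem thetaF_add_pi_mul_ω (p : SOSModel N) (x : ℂ) :
    p.thetaF (x + Real.pi * p.ω) = cexp (-2 * I * Real.pi * p.ω - 4 * I * x) * p.thetaF x := by
  have hp : (Real.pi : ℂ) ≠ 0 := by exact_mod_cast Real.pi_ne_zero
  rw [thetaF, thetaF, show 2 * (x + Real.pi * p.ω) / Real.pi = 2 * x / Real.pi + 2 * p.ω by
    field_simp, jacobiTheta₂_add_left']
  congr 2
  field_simp
  ring

theorem thetaG_add_pi_mul_ω (p : SOSModel N) (x : ℂ) :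
    p.thetaG (x + Real.pi * p.ω) = cexp (-2 * I * Real.pi * p.ω - 4 * I * x) * p.thetaG x := by
  have hp : (Real.pi : ℂ) ≠ 0 := by exact_mod_cast Real.pi_ne_zero
  rw [thetaG, thetaG, show 2 * (x + Real.pi * p.ω) / Real.pi + p.ω =
    2 * x / Real.pi + p.ω + 2 * p.ω by field_simp; ring, jacobiTheta₂_add_left', ← mul_assoc,
    ← mul_assoc, ← Complex.exp_add, ← Complex.exp_add]
  congr 2
  field_simp
  ring

/-- At a common zero x the product θ(x+y)θ(x−y) would vanish for all y. So (F : G) is a well-defined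
point of the projective line. -/
theorem exists_thetaF_ne_zero_or_thetaG_ne_zero (p : SOSModel N) (hω : 0 < p.ω.im) (x : ℂ) :
    p.thetaF x ≠ 0 ∨ p.thetaG x ≠ 0 := by
  by_contra! h
  obtain ⟨w, hw⟩ := p.exists_θ_ne_zero hω
  have hθ := p.differentiable_θ hω
  rcases Differentiable.eq_zero_or_eq_zero_of_mul_eq_zero (f := fun y => p.θ (x + y))
    (g := fun y => p.θ (x - y)) (by fun_prop) (by fun_prop)
    (fun y => by rw [p.θ_add_mul_θ_sub hω, h.1, h.2]; ring) with h0 | h0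
  · exact hw (by simpa using h0 (w - x))
  · exact hw (by simpa using h0 (x - w))

/-- A zero of `θ` is a half-period. -/
theorem exists_two_mul_eq_of_θ_eq_zero (p : SOSModel N) (hω : 0 < p.ω.im) {w : ℂ}
    (hw : p.θ w = 0) : ∃ m n : ℤ, 2 * w = Real.pi * m + Real.pi * p.ω * n := by
  have hp : (Real.pi : ℂ) ≠ 0 := by exact_mod_cast Real.pi_ne_zero
  have hF := p.differentiable_thetaF hω
  have hG := p.differentiable_thetaG hω
  -- The minor at x+w and x contains θ(w) = 0, so (F, G)(x+w) = e(x)·(F, G)(x). The factor e is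
  -- entire without zeros and has multipliers 1 and e^{−4iw}; being an exponential, it forces 2w
  -- into the lattice.
  have hFG : ∀ x, p.thetaF (x + w) * p.thetaG x = p.thetaG (x + w) * p.thetaF x := fun x => by
    have := p.θ_add_mul_θ_sub hω (x + w) x
    rw [add_sub_cancel_left, hw, mul_zero] at this
    linear_combination -this
  have hne := p.exists_thetaF_ne_zero_or_thetaG_ne_zero hω
  have hex : ∀ x, ∃ e, p.thetaF (x + w) = e * p.thetaF x ∧ p.thetaG (x + w) = e * p.thetaG x := by
    intro x
    rcases hne x with h | h
    · exact ⟨p.thetaF (x + w) / p.thetaF x, by field_simp, by field_simp; rw [hFG]⟩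
    · exact ⟨p.thetaG (x + w) / p.thetaG x, by field_simp; rw [hFG], by field_simp⟩
  choose e heF heG using hex
  have he0 : ∀ x, e x ≠ 0 := fun x h0 => by
    rcases hne (x + w) with h | h
    · exact h (by rw [heF, h0, zero_mul])
    · exact h (by rw [heG, h0, zero_mul])
  have huniq : ∀ x a, p.thetaF (x + w) = a * p.thetaF x → p.thetaG (x + w) = a * p.thetaG x →
      e x = a := fun x a h1 h2 => by
    rcases hne x with h | h
    · exact mul_right_cancel₀ h ((heF x).symm.trans h1)
    · exact mul_right_cancel₀ h ((heG x).symm.trans h2)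
  have hed : Differentiable ℂ e := fun x => by
    rcases hne x with h | h
    · have hev : e =ᶠ[𝓝 x] fun z => p.thetaF (z + w) / p.thetaF z := by
        filter_upwards [hF.continuous.continuousAt.eventually_ne h] with z hz
        rw [heF, mul_div_cancel_right₀ _ hz]
      refine DifferentiableAt.congr_of_eventuallyEq ?_ hev
      exact DifferentiableAt.div (by fun_prop) (by fun_prop) h
    · have hev : e =ᶠ[𝓝 x] fun z => p.thetaG (z + w) / p.thetaG z := by
        filter_upwards [hG.continuous.continuousAt.eventually_ne h] with z hz
        rw [heG, mul_div_cancel_right₀ _ hz]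
      refine DifferentiableAt.congr_of_eventuallyEq ?_ hev
      exact DifferentiableAt.div (by fun_prop) (by fun_prop) h
  have hm1 : ∀ x, e (x + Real.pi) = 1 * e x := fun x => by
    rw [one_mul]
    apply huniq
    · rw [add_right_comm, thetaF_add_pi, thetaF_add_pi, heF]
    · rw [add_right_comm, thetaG_add_pi, thetaG_add_pi, heG]
  have hm2 : ∀ x, e (x + Real.pi * p.ω) = cexp (-4 * I * w) * e x := fun x => by
    have hx : cexp (-2 * I * Real.pi * p.ω - 4 * I * (x + w)) =
        cexp (-4 * I * w) * cexp (-2 * I * Real.pi * p.ω - 4 * I * x) := by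
      rw [← Complex.exp_add]; congr 1; ring
    apply huniq
    · rw [add_right_comm, thetaF_add_pi_mul_ω, thetaF_add_pi_mul_ω, heF, hx]
      ring
    · rw [add_right_comm, thetaG_add_pi_mul_ω, thetaG_add_pi_mul_ω, heG, hx]
      ring
  obtain ⟨c, hc⟩ := exists_eq_exp_of_multipliers hed he0 hω hm1 hm2
  have h1 : cexp (c * Real.pi) = 1 := by
    have := hm1 0
    rw [zero_add, hc, one_mul] at this
    exact mul_left_cancel₀ (he0 0) (by rw [this, mul_one])
  have h2 : cexp (c * (Real.pi * p.ω)) = cexp (-4 * I * w) := by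
    have := hm2 0
    rw [zero_add, hc, mul_comm (cexp (-4 * I * w))] at this
    exact mul_left_cancel₀ (he0 0) this
  obtain ⟨k, hk⟩ := Complex.exp_eq_one_iff.1 h1
  obtain ⟨m, hm⟩ := Complex.exp_eq_exp_iff_exists_int.1 h2
  have hck : c = 2 * k * I := mul_right_cancel₀ hp (by rw [hk]; ring)
  refine ⟨m, -k, ?_⟩
  have h2I : (2 * I : ℂ) ≠ 0 := by simp
  apply mul_left_cancel₀ h2I
  rw [hck] at hm
  push_cast
  linear_combination hm

theorem θ_add_int_mul_pi (p : SOSModel N) (m : ℤ) (z : ℂ) :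
    p.θ (z + Real.pi * m) = (-1) ^ m * p.θ z := by
  induction m using Int.induction_on with
  | zero => simp
  | succ k ih =>
    rw [show z + Real.pi * ((k : ℤ) + 1 : ℤ) = z + Real.pi * (k : ℤ) + Real.pi by push_cast; ring,
      θ_add_pi, ih, zpow_add₀ (by norm_num)]
    ring
  | pred k ih =>
    have := p.θ_add_pi (z + Real.pi * ((-k - 1 : ℤ) : ℂ))
    rw [show z + Real.pi * ((-k - 1 : ℤ) : ℂ) + Real.pi = z + Real.pi * ((-k : ℤ) : ℂ) by
      push_cast; ring, ih] at this
    rw [zpow_sub₀ (by norm_num)]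
    linear_combination this

theorem θ_add_pi_mul_ω_mul_int (p : SOSModel N) (n : ℤ) (z : ℂ) :
    p.θ (z + Real.pi * p.ω * n) =
      (-1) ^ n * cexp (-I * Real.pi * p.ω * n ^ 2 - 2 * I * n * z) * p.θ z := by
  induction n using Int.induction_on with
  | zero => simp
  | succ k ih =>
    rw [show z + Real.pi * p.ω * ((k : ℤ) + 1 : ℤ) =
      z + Real.pi * p.ω * (k : ℤ) + Real.pi * p.ω by push_cast; ring,
      θ_add_pi_mul_ω, ih, zpow_add₀ (by norm_num),
      show -I * Real.pi * p.ω * (((k : ℤ) + 1 : ℤ) : ℂ) ^ 2 - 2 * I * (((k : ℤ) + 1 : ℤ) : ℂ) * z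
        = (-I * Real.pi * p.ω - 2 * I * (z + Real.pi * p.ω * (k : ℤ))) +
          (-I * Real.pi * p.ω * ((k : ℤ) : ℂ) ^ 2 - 2 * I * ((k : ℤ) : ℂ) * z) by push_cast; ring,
      Complex.exp_add]
    ring
  | pred k ih =>
    have := p.θ_add_pi_mul_ω (z + Real.pi * p.ω * ((-k - 1 : ℤ) : ℂ))
    rw [show z + Real.pi * p.ω * ((-k - 1 : ℤ) : ℂ) + Real.pi * p.ω =
      z + Real.pi * p.ω * ((-k : ℤ) : ℂ) by push_cast; ring, ih] at this
    have he := Complex.exp_ne_zero (-I * Real.pi * p.ω -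
      2 * I * (z + Real.pi * p.ω * ((-k - 1 : ℤ) : ℂ)))
    rw [zpow_sub₀ (by norm_num)]
    apply mul_left_cancel₀ he
    have hx : cexp (-I * Real.pi * p.ω * ((-k : ℤ) : ℂ) ^ 2 - 2 * I * ((-k : ℤ) : ℂ) * z) =
        cexp (-I * Real.pi * p.ω - 2 * I * (z + Real.pi * p.ω * ((-k - 1 : ℤ) : ℂ))) *
        cexp (-I * Real.pi * p.ω * ((-k - 1 : ℤ) : ℂ) ^ 2 - 2 * I * ((-k - 1 : ℤ) : ℂ) * z) := by
      rw [← Complex.exp_add]; congr 1; push_cast; ring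
    rw [hx] at this
    linear_combination this

/-- If the translate of `θ` by `w` is `θ` up to an exponential, then `w ∈ Γ`. -/
theorem mem_Γ_of_θ_add_eq (p : SOSModel N) (hω : 0 < p.ω.im) {w c : ℂ} {n : ℤ}
    (h : ∀ x, p.θ (x + w) = c * cexp (-(I * n * x)) * p.θ x) : w ∈ p.Γ := by
  obtain ⟨x, hx⟩ := p.exists_θ_ne_zero hω
  have hp : (Real.pi : ℂ) ≠ 0 := by exact_mod_cast Real.pi_ne_zero
  have hc : c ≠ 0 := fun h0 => hx (by
    have := h (x - w)
    rwa [sub_add_cancel, h0, zero_mul, zero_mul] at this)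
  -- Translating x by π in two ways makes n even; translating by πω in two ways then fixes w modulo
  -- π.
  have h1 : cexp (-(I * n * Real.pi)) = 1 := by
    have h2 := h (x + Real.pi)
    rw [add_right_comm, θ_add_pi, h, θ_add_pi, mul_add, neg_add, Complex.exp_add] at h2
    have h3 : c * cexp (-(I * n * x)) * p.θ x ≠ 0 :=
      mul_ne_zero (mul_ne_zero hc (Complex.exp_ne_zero _)) hx
    apply mul_left_cancel₀ h3
    linear_combination h2
  have h2 : cexp (-(2 * I * w)) = cexp (-(I * n * (Real.pi * p.ω))) := by
    have h2 := h (x + Real.pi * p.ω)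
    rw [add_right_comm, θ_add_pi_mul_ω, h, θ_add_pi_mul_ω, mul_add (I * n), neg_add,
      Complex.exp_add _ (-(I * n * (Real.pi * p.ω))),
      show -I * Real.pi * p.ω - 2 * I * (x + w) = -I * Real.pi * p.ω - 2 * I * x + -(2 * I * w)
        by ring, Complex.exp_add _ (-(2 * I * w))] at h2
    have h3 : c * cexp (-(I * n * x)) * p.θ x * cexp (-I * Real.pi * p.ω - 2 * I * x) ≠ 0 :=
      mul_ne_zero (mul_ne_zero (mul_ne_zero hc (Complex.exp_ne_zero _)) hx) (Complex.exp_ne_zero _)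
    apply mul_left_cancel₀ h3
    linear_combination -h2
  obtain ⟨k, hk⟩ := Complex.exp_eq_one_iff.1 h1
  obtain ⟨m, hm⟩ := Complex.exp_eq_exp_iff_exists_int.1 h2
  have hn : (n : ℂ) = -2 * k := by
    apply mul_right_cancel₀ (mul_ne_zero Complex.I_ne_zero hp)
    linear_combination -hk
  refine ⟨-m, -k, ?_⟩
  have h2I : (2 * I : ℂ) ≠ 0 := by simp
  apply mul_left_cancel₀ h2I
  rw [hn] at hm
  push_cast
  linear_combination -hm

/-- The zeros of `θ` are the points of `Γ`. -/
theorem θ_eq_zero_iff (p : SOSModel N) (hω : 0 < p.ω.im) {w : ℂ} : p.θ w = 0 ↔ w ∈ p.Γ := by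
  constructor
  · intro hw
    obtain ⟨m, n, hmn⟩ := p.exists_two_mul_eq_of_θ_eq_zero hω hw
    obtain ⟨y, hy⟩ := p.exists_θ_ne_zero hω
    have hθ := p.differentiable_θ hω
    set κ := p.θ (y + w) * p.θ (y - w) / p.θ y ^ 2 with hκ
    -- The three-term relation at (x, y, w, 0) loses its first term because θ(w) = 0.
    have h1 : ∀ x, p.θ (x + w) * p.θ (x - w) = κ * p.θ x ^ 2 := fun x => by
      have := p.θ_three_term hω x y w 0
      simp only [add_zero, sub_zero, hw] at this
      rw [hκ]
      field_simp
      linear_combination -this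
    set C := (-1) ^ m * ((-1) ^ n * cexp (-I * Real.pi * p.ω * n ^ 2 + 2 * I * n * w)) with hC
    -- Since 2w is already a lattice vector, θ(x+w) is a multiple of θ(x−w), so its square is θ(x)²
    -- up to an exponential. The difference of squares factors, and one entire factor must vanish
    -- identically.
    have hsq : ∀ x, p.θ (x + w) ^ 2 = C * κ * cexp (-(2 * I * n * x)) * p.θ x ^ 2 := fun x => by
      have h2 : p.θ (x + w) = C * cexp (-(2 * I * n * x)) * p.θ (x - w) := by
        rw [show x + w = x - w + Real.pi * p.ω * n + Real.pi * m by linear_combination hmn,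
          θ_add_int_mul_pi, θ_add_pi_mul_ω_mul_int, hC,
          show -I * Real.pi * p.ω * n ^ 2 - 2 * I * n * (x - w) =
            -I * Real.pi * p.ω * n ^ 2 + 2 * I * n * w + -(2 * I * n * x) by ring,
          Complex.exp_add _ (-(2 * I * n * x))]
        ring
      linear_combination p.θ (x + w) * h2 + C * cexp (-(2 * I * n * x)) * h1 x
    obtain ⟨c, hc⟩ := IsAlgClosed.exists_pow_nat_eq (C * κ) (n := 2) (by norm_num)
    have hexp : ∀ x, cexp (-(2 * I * n * x)) = cexp (-(I * n * x)) ^ 2 := fun x => by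
      rw [sq, ← Complex.exp_add]; congr 1; ring
    rcases Differentiable.eq_zero_or_eq_zero_of_mul_eq_zero
      (f := fun x => p.θ (x + w) - c * cexp (-(I * n * x)) * p.θ x)
      (g := fun x => p.θ (x + w) + c * cexp (-(I * n * x)) * p.θ x) (by fun_prop) (by fun_prop)
      (fun x => by
        have := hsq x
        rw [hexp, ← hc] at this
        linear_combination this) with h | h
    · exact p.mem_Γ_of_θ_add_eq hω (c := c) (n := n) fun x => by linear_combination h x
    · exact p.mem_Γ_of_θ_add_eq hω (c := -c) (n := n) fun x => by linear_combination h x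
  · rintro ⟨m, n, rfl⟩
    have := p.θ_add_pi_mul_ω_mul_int n (0 + Real.pi * m)
    rw [θ_add_int_mul_pi, θ_zero, zero_add] at this
    rw [this]
    ring

theorem sub_mem_Γ (p : SOSModel N) {z w : ℂ} (hz : z ∈ p.Γ) (hw : w ∈ p.Γ) : z - w ∈ p.Γ := by
  obtain ⟨m, n, rfl⟩ := hz
  obtain ⟨m', n', rfl⟩ := hw
  exact ⟨m - m', n - n', by push_cast; ring⟩

/-! ### Elliptic Lagrange interpolation. -/

/-- `∏ⱼ θ(λ - uⱼ)`. -/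
def thetaProd (p : SOSModel N) (L : List ℂ) (l : ℂ) : ℂ := (L.map fun u => p.θ (l - u)).prod

@[simp] theorem thetaProd_nil (p : SOSModel N) (l : ℂ) : p.thetaProd [] l = 1 := rfl

@[simp] theorem thetaProd_cons (p : SOSModel N) (u : ℂ) (L : List ℂ) (l : ℂ) :
    p.thetaProd (u :: L) l = p.θ (l - u) * p.thetaProd L l := by
  simp [thetaProd]

section interpolation

variable {ι : Type*} [DecidableEq ι]

/-- The numerator `θ(s + z_a - λ) ∏_{b ≠ a} θ(λ - z_b)/θ(z_a - z_b)` of an interpolation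
coefficient for the nodes `z_b`, `b ∈ A`. -/
def lagrangeNum (p : SOSModel N) (A : Finset ι) (z : ι → ℂ) (s l : ℂ) (a : ι) : ℂ :=
  p.θ (s + z a - l) * ∏ b ∈ A.erase a, (p.θ (l - z b) / p.θ (z a - z b))

/-- Elliptic interpolation passes from fewer nodes to more nodes when a zero sits at a node. -/
theorem thetaProd_interpolation_cons_node (p : SOSModel N) {A : Finset ι} {z : ι → ℂ}
    (hz : ∀ a ∈ A, ∀ b ∈ A, a ≠ b → p.θ (z a - z b) ≠ 0) {s l : ℂ} {L : List ℂ} {a : ι}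
    (ha : a ∈ A)
    (h : p.θ s * p.thetaProd L l =
      ∑ b ∈ A.erase a, p.lagrangeNum (A.erase a) z s l b * p.thetaProd L (z b)) :
    p.θ s * p.thetaProd (z a :: L) l =
      ∑ b ∈ A, p.lagrangeNum A z s l b * p.thetaProd (z a :: L) (z b) := by
  rw [← Finset.add_sum_erase A _ ha, thetaProd_cons, thetaProd_cons, sub_self, θ_zero, zero_mul,
    mul_zero, zero_add, mul_left_comm, h, Finset.mul_sum]
  refine Finset.sum_congr rfl fun b hb => ?_
  obtain ⟨hba, hbA⟩ := Finset.mem_erase.1 hb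
  have hne := hz b hbA a ha hba
  rw [lagrangeNum, lagrangeNum, thetaProd_cons,
    ← Finset.mul_prod_erase (A.erase b) _ (Finset.mem_erase.2 ⟨hba.symm, ha⟩),
    Finset.erase_right_comm]
  field_simp

/-- Two nodes whose sum differs from `σ` modulo the periods. -/
theorem exists_pair_θ_ne_zero (p : SOSModel N) (hω : 0 < p.ω.im) {A : Finset ι} {z : ι → ℂ}
    (hz : ∀ a ∈ A, ∀ b ∈ A, a ≠ b → p.θ (z a - z b) ≠ 0) {σ : ℂ} (hA : 2 ≤ A.card)
    (hσ : A.card = 2 → p.θ (∑ a ∈ A, z a - σ) ≠ 0) :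
    ∃ a ∈ A, ∃ b ∈ A, a ≠ b ∧ p.θ (z a + z b - σ) ≠ 0 := by
  rcases hA.eq_or_lt with h | h
  · obtain ⟨a, b, hab, rfl⟩ := Finset.card_eq_two.1 h.symm
    refine ⟨a, by simp, b, by simp, hab, ?_⟩
    have := hσ h.symm
    rwa [Finset.sum_pair hab] at this
  · obtain ⟨a, b, c, ha, hb, hc, hab, hac, hbc⟩ := Finset.two_lt_card_iff.1 h
    -- If both z_a + z_b and z_a + z_c were congruent to σ, then z_b and z_c would be congruent.
    by_cases h1 : p.θ (z a + z b - σ) = 0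
    · refine ⟨a, ha, c, hc, hac, fun h2 => hz b hb c hc hbc ?_⟩
      rw [p.θ_eq_zero_iff hω] at h1 h2 ⊢
      have := p.sub_mem_Γ h1 h2
      rwa [show z a + z b - σ - (z a + z c - σ) = z b - z c by ring] at this
    · exact ⟨a, ha, b, hb, hab, h1⟩

/-- Fix all zeros but two, and the sum σ of those two. The defect of the formula is then a linear
combination of F(d) and G(d), where 2d is their difference. By induction it vanishes when one of the
two zeros sits at a node, and two suitable nodes give independent conditions, so it vanishes
identically. -/
theorem thetaProd_interpolation (p : SOSModel N) (hω : 0 < p.ω.im) (l : ℂ) (n : ℕ) :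
    ∀ (A : Finset ι) (z : ι → ℂ) (L : List ℂ), A.card = n → L.length = n →
      (∀ a ∈ A, ∀ b ∈ A, a ≠ b → p.θ (z a - z b) ≠ 0) → ∀ s, s = L.sum - ∑ a ∈ A, z a →
      p.θ s ≠ 0 →
      p.θ s * p.thetaProd L l = ∑ a ∈ A, p.lagrangeNum A z s l a * p.thetaProd L (z a) := by
  induction n with
  | zero =>
    intro A z L hA hL hz s hs hs0
    rw [List.length_eq_zero_iff] at hL
    rw [Finset.card_eq_zero] at hA
    subst hL hA
    -- Without nodes s = 0, which the hypothesis θ(s) ≠ 0 excludes.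
    simp [hs, θ_zero] at hs0
  | succ n ih =>
    intro A z L hA hL hz s hs hs0
    match L, hL with
    | [u], hL =>
      have hn : n = 0 := by simpa using hL.symm
      subst hn
      obtain ⟨a, rfl⟩ := Finset.card_eq_one.1 hA
      simp only [Finset.sum_singleton, List.sum_cons, List.sum_nil, add_zero] at hs
      simp only [thetaProd_cons, thetaProd_nil, Finset.sum_singleton, lagrangeNum,
        Finset.erase_singleton, Finset.prod_empty, mul_one, hs]
      rw [show l - u = -(u - z a + z a - l) by ring, θ_neg, show u - z a = -(z a - u) by ring,
        θ_neg]
      ring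
    | u₁ :: u₂ :: V, hL =>
      have hV : V.length + 1 = n := by simpa using hL
      set σ := u₁ + u₂ with hσ
      have hs' : s = σ + V.sum - ∑ a ∈ A, z a := by
        rw [hs, List.sum_cons, List.sum_cons]; ring
      set α := fun f : ℂ → ℂ => p.θ s * (f (l - σ / 2) * p.thetaProd V l) -
        ∑ a ∈ A, p.lagrangeNum A z s l a * (f (z a - σ / 2) * p.thetaProd V (z a)) with hα
      have key : ∀ d, p.θ s * p.thetaProd ((σ / 2 + d) :: (σ / 2 - d) :: V) l -
          ∑ a ∈ A, p.lagrangeNum A z s l a * p.thetaProd ((σ / 2 + d) :: (σ / 2 - d) :: V) (z a) =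
          α p.thetaF * p.thetaG d - α p.thetaG * p.thetaF d := by
        intro d
        have hd : ∀ x, p.thetaProd ((σ / 2 + d) :: (σ / 2 - d) :: V) x =
            (p.thetaF (x - σ / 2) * p.thetaProd V x) * p.thetaG d -
            (p.thetaG (x - σ / 2) * p.thetaProd V x) * p.thetaF d := fun x => by
          rw [thetaProd_cons, thetaProd_cons, show x - (σ / 2 + d) = x - σ / 2 - d by ring,
            show x - (σ / 2 - d) = x - σ / 2 + d by ring]
          linear_combination (p.thetaProd V x) * p.θ_add_mul_θ_sub hω (x - σ / 2) d
        simp only [hd, hα, mul_sub, sub_mul, Finset.sum_sub_distrib, Finset.sum_mul, ← mul_assoc]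
        ring
      have hnode : ∀ a ∈ A, α p.thetaF * p.thetaG (z a - σ / 2) -
          α p.thetaG * p.thetaF (z a - σ / 2) = 0 := by
        intro a ha
        rw [← key, sub_eq_zero, show σ / 2 + (z a - σ / 2) = z a by ring]
        refine p.thetaProd_interpolation_cons_node hz ha
          (ih (A.erase a) z _ (by rw [Finset.card_erase_of_mem ha, hA]; rfl) (by simpa using hV)
            (fun b hb c hc => hz b (Finset.mem_of_mem_erase hb) c (Finset.mem_of_mem_erase hc))
            s ?_ hs0)
        rw [hs', ← Finset.add_sum_erase A _ ha, List.sum_cons]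
        ring
      -- With exactly two nodes no zeros remain besides the pair, so ∑ z − σ = −s and the hypothesis
      -- on s supplies the nondegeneracy.
      obtain ⟨a, ha, b, hb, hab, hne⟩ := p.exists_pair_θ_ne_zero hω hz (σ := σ)
        (by rw [hA, ← hV]; lia) (fun h2 => by
          have : V.length = 0 := by lia
          rw [List.length_eq_zero_iff] at this
          rw [show ∑ a ∈ A, z a - σ = -s by rw [hs', this, List.sum_nil]; ring, θ_neg]
          exact neg_ne_zero.2 hs0)
      have hdet : p.thetaF (z a - σ / 2) * p.thetaG (z b - σ / 2) -
          p.thetaG (z a - σ / 2) * p.thetaF (z b - σ / 2) ≠ 0 := by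
        rw [← p.θ_add_mul_θ_sub hω, show z a - σ / 2 + (z b - σ / 2) = z a + z b - σ by ring,
          show z a - σ / 2 - (z b - σ / 2) = z a - z b by ring]
        exact mul_ne_zero hne (hz a ha b hb hab)
      have h1 := hnode a ha
      have h2 := hnode b hb
      have hF : α p.thetaF = 0 := by
        apply mul_right_cancel₀ hdet
        linear_combination p.thetaF (z a - σ / 2) * h2 - p.thetaF (z b - σ / 2) * h1
      have hG : α p.thetaG = 0 := by
        apply mul_right_cancel₀ hdet
        linear_combination p.thetaG (z a - σ / 2) * h2 - p.thetaG (z b - σ / 2) * h1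
      have := key ((u₁ - u₂) / 2)
      rw [hF, hG, show σ / 2 + (u₁ - u₂) / 2 = u₁ by rw [hσ]; ring,
        show σ / 2 - (u₁ - u₂) / 2 = u₂ by rw [hσ]; ring] at this
      linear_combination this

/-- The span of the products `∏ⱼ θ(λ - uⱼ)` of `n` factors with `∑ⱼ uⱼ = U`. -/
def thetaSpan (p : SOSModel N) (n : ℕ) (U : ℂ) : Submodule ℂ (ℂ → ℂ) :=
  Submodule.span ℂ {f | ∃ L : List ℂ, L.length = n ∧ L.sum = U ∧ f = p.thetaProd L}

theorem mul_θ_mem_thetaSpan (p : SOSModel N) {n : ℕ} {U : ℂ} {f : ℂ → ℂ}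
    (hf : f ∈ p.thetaSpan n U) (u c : ℂ) :
    (fun l => c * p.θ (l - u) * f l) ∈ p.thetaSpan (n + 1) (u + U) := by
  induction hf using Submodule.span_induction with
  | mem f hf =>
    obtain ⟨L, rfl, rfl, rfl⟩ := hf
    have : (fun l => c * p.θ (l - u) * p.thetaProd L l) = c • p.thetaProd (u :: L) := by
      funext l
      simp [mul_assoc]
    rw [this]
    exact Submodule.smul_mem _ _ (Submodule.subset_span ⟨u :: L, by simp, by simp, rfl⟩)
  | zero =>
    convert Submodule.zero_mem (p.thetaSpan (n + 1) (u + U)) using 1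
    funext l
    simp
  | add f g _ _ hf hg =>
    convert Submodule.add_mem _ hf hg using 1
    funext l
    simp [mul_add]
  | smul a f _ hf =>
    convert Submodule.smul_mem _ a hf using 1
    funext l
    simp only [Pi.smul_apply, smul_eq_mul]
    ring

theorem interpolation_of_mem_thetaSpan (p : SOSModel N) (hω : 0 < p.ω.im) {A : Finset ι}
    {z : ι → ℂ} (hz : ∀ a ∈ A, ∀ b ∈ A, a ≠ b → p.θ (z a - z b) ≠ 0) {s : ℂ} (hs : p.θ s ≠ 0)
    {f : ℂ → ℂ} (hf : f ∈ p.thetaSpan A.card (s + ∑ a ∈ A, z a)) (l : ℂ) :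
    p.θ s * f l = ∑ a ∈ A, p.lagrangeNum A z s l a * f (z a) := by
  induction hf using Submodule.span_induction with
  | mem f hf =>
    obtain ⟨L, hL, hU, rfl⟩ := hf
    exact p.thetaProd_interpolation hω l A.card A z L rfl hL hz s (by rw [hU]; ring) hs
  | zero => simp
  | add f g _ _ hf hg => simp only [Pi.add_apply, mul_add, hf, hg, Finset.sum_add_distrib]
  | smul a f _ hf =>
    simp only [Pi.smul_apply, smul_eq_mul]
    rw [mul_left_comm, hf, Finset.mul_sum]
    exact Finset.sum_congr rfl fun _ _ => by ring

end interpolation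

/-! ### The R-matrix: three-term relations for φ, fusion and the Yang–Baxter equation. -/

/-- `φ(t) = e^{iyt} θ(t)`. -/
def φ (p : SOSModel N) (t : ℂ) : ℂ := Complex.exp (Complex.I * p.yc * t) * p.θ t

/-- The eigenvalue of `σᶻ`. -/
def sgn (i : Fin 2) : ℂ := 1 - 2 * ((i : ℕ) : ℂ)

@[simp] theorem sgn_zero : sgn 0 = 1 := by simp [sgn]

@[simp] theorem sgn_one : sgn 1 = -1 := by simp [sgn]; norm_num

/-- The three-term relation with two factors `φ` in each term. -/
theorem φ_three_term (p : SOSModel N) (hω : 0 < p.ω.im) (a b c d : ℂ) :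
    p.φ (a + b) * p.φ (c + d) * (p.θ (a - b) * p.θ (c - d))
      - p.φ (a + c) * p.φ (b + d) * (p.θ (a - c) * p.θ (b - d))
      - p.φ (a + d) * p.φ (b + c) * (p.θ (a - d) * p.θ (c - b)) = 0 := by
  have h : ∀ u v, p.φ u * p.φ v =
      Complex.exp (Complex.I * p.yc * (u + v)) * (p.θ u * p.θ v) := fun u v => by
    rw [φ, φ, mul_add, Complex.exp_add]; ring
  -- In each term the two arguments of φ add up to a+b+c+d, so the exponential is a common factor.
  rw [h, h, h, show a + c + (b + d) = a + b + (c + d) by ring,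
    show a + d + (b + c) = a + b + (c + d) by ring, show c - b = -(b - c) by ring, θ_neg]
  linear_combination Complex.exp (Complex.I * p.yc * (a + b + (c + d))) *
    p.θ_three_term hω a b c d

theorem differentiable_φ (p : SOSModel N) (hω : 0 < p.ω.im) : Differentiable ℂ p.φ := by
  have := p.differentiable_θ hω
  unfold φ
  fun_prop

/-- A relation of degree six that follows from the three-term relation. -/
theorem six_factor_relation (p : SOSModel N) (hω : 0 < p.ω.im) {ψ : ℂ → ℂ}
    (hψ : Differentiable ℂ ψ)
    (H : ∀ a b c d, ψ (a + b) * ψ (c + d) * (p.θ (a - b) * p.θ (c - d))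
      - ψ (a + c) * ψ (b + d) * (p.θ (a - c) * p.θ (b - d))
      - ψ (a + d) * ψ (b + c) * (p.θ (a - d) * p.θ (c - b)) = 0) (x v e : ℂ) :
    p.θ x * p.θ v * p.θ (x + v + e) * (ψ (e + e) * ψ 0 ^ 3 - ψ (-e) * ψ e ^ 3) =
      p.θ e ^ 3 * (ψ (-v) * ψ (e + (x + v)) * ψ (-x) * ψ e -
        ψ (e + x) * ψ (-(x + v)) * ψ (e + v) * ψ 0) := by
  have hθ := p.differentiable_θ hω
  -- The three-term relations `e1` and `e3` only produce the claim multiplied by θ(v). As an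
  -- identity of entire functions of v, it can be divided by that factor.
  have key : ∀ v, p.θ v * (p.θ x * p.θ v * p.θ (x + v + e) *
      (ψ (e + e) * ψ 0 ^ 3 - ψ (-e) * ψ e ^ 3) -
      p.θ e ^ 3 * (ψ (-v) * ψ (e + (x + v)) * ψ (-x) * ψ e -
        ψ (e + x) * ψ (-(x + v)) * ψ (e + v) * ψ 0)) = 0 := by
    intro v
    have e1 : p.θ v * p.θ e * ψ (e + (x + v)) * ψ (-x) =
        p.θ (x + v) * p.θ (x + e) * ψ (e + v) * ψ 0 - ψ v * ψ e * p.θ (x + v + e) * p.θ x := by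
      linear_combination (norm := ring_nf)
        -H ((e + v + (x + v)) / 2) ((e - x) / 2) ((x + e) / 2) (-(x + e) / 2)
    have e3 : p.θ v * p.θ e * ψ (e + x) * ψ (-(x + v)) =
        p.θ (x + v) * p.θ (x + e) * ψ (-v) * ψ e - ψ (e - v) * ψ 0 * p.θ (x + v + e) * p.θ x := by
      linear_combination (norm := ring_nf) -H (x / 2 + e) (-x / 2) (x / 2) (-v - x / 2)
    have e5 : ψ (e + v) * ψ (e - v) * p.θ e ^ 2 =
        ψ e ^ 2 * p.θ (e + v) * p.θ (e - v) + p.θ v ^ 2 * ψ (e + e) * ψ 0 := by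
      linear_combination (norm := ring_nf) H (e + v / 2) (v / 2) (e - v / 2) (-v / 2)
    have e6 : ψ v * ψ (-v) * p.θ e ^ 2 =
        ψ 0 ^ 2 * p.θ (e + v) * p.θ (e - v) + p.θ v ^ 2 * ψ e * ψ (-e) := by
      linear_combination (norm := ring_nf)
        H ((v + e) / 2) ((v - e) / 2) ((e - v) / 2) ((-v - e) / 2)
    linear_combination -p.θ e ^ 2 * ψ (-v) * ψ e * e1 + p.θ e ^ 2 * ψ (e + v) * ψ 0 * e3
      - p.θ x * p.θ (x + v + e) * ψ 0 ^ 2 * e5 + p.θ x * p.θ (x + v + e) * ψ e ^ 2 * e6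
  rcases Differentiable.eq_zero_or_eq_zero_of_mul_eq_zero hθ (by fun_prop) key with h | h
  · obtain ⟨w, hw⟩ := p.exists_θ_ne_zero hω
    exact absurd (h w) hw
  · exact sub_eq_zero.1 (h v)

/-- This moves the exponentials carrying y into ratios of φ, so the local relations need no case
distinction on y. -/
theorem exp_mul_θ_div (p : SOSModel N) (t u : ℂ) :
    Complex.exp (Complex.I * p.yc * (u - t)) * (p.θ u / p.θ t) = p.φ u / p.φ t := by
  rw [φ, φ, mul_div_mul_comm, ← Complex.exp_sub]
  congr 2; ring

section entries

variable (p : SOSModel N) (l t : ℂ)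

@[simp] theorem R_00_00 : p.R l t (0, 0) (0, 0) = p.θ (l + p.η) := rfl

@[simp] theorem R_11_11 : p.R l t (1, 1) (1, 1) = p.θ (l + p.η) := rfl

@[simp] theorem R_01_01 : p.R l t (0, 1) (0, 1) = p.θ l * (p.φ (t + p.η) / p.φ t) := by
  rw [← exp_mul_θ_div]
  simp only [R, b, Matrix.of_apply, add_sub_cancel_left]
  ring

@[simp] theorem R_01_10 : p.R l t (0, 1) (1, 0) = p.θ p.η * (p.φ (t + l) / p.φ t) := by
  rw [← exp_mul_θ_div]
  simp only [R, c, Matrix.of_apply, add_sub_cancel_left]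
  ring

@[simp] theorem R_10_01 : p.R l t (1, 0) (0, 1) = p.θ p.η * (p.φ (t - l) / p.φ t) := by
  rw [← exp_mul_θ_div, show t - l - t = -l by ring]
  simp only [R, c, Matrix.of_apply]
  rw [show -t + l = -(t - l) by ring, θ_neg, θ_neg, mul_neg, neg_div_neg_eq,
    show -Complex.I * p.yc * l = Complex.I * p.yc * -l by ring]
  ring

@[simp] theorem R_10_10 : p.R l t (1, 0) (1, 0) = p.θ l * (p.φ (t - p.η) / p.φ t) := by
  rw [← exp_mul_θ_div, show t - p.η - t = -p.η by ring]
  simp only [R, b, Matrix.of_apply]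
  rw [show -t + p.η = -(t - p.η) by ring, θ_neg, θ_neg, mul_neg, neg_div_neg_eq,
    show -Complex.I * p.yc * p.η = Complex.I * p.yc * -p.η by ring]
  ring

@[simp] theorem R_00_01 : p.R l t (0, 0) (0, 1) = 0 := rfl
@[simp] theorem R_00_10 : p.R l t (0, 0) (1, 0) = 0 := rfl
@[simp] theorem R_00_11 : p.R l t (0, 0) (1, 1) = 0 := rfl
@[simp] theorem R_01_00 : p.R l t (0, 1) (0, 0) = 0 := rfl
@[simp] theorem R_01_11 : p.R l t (0, 1) (1, 1) = 0 := rfl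
@[simp] theorem R_10_00 : p.R l t (1, 0) (0, 0) = 0 := rfl
@[simp] theorem R_10_11 : p.R l t (1, 0) (1, 1) = 0 := rfl
@[simp] theorem R_11_00 : p.R l t (1, 1) (0, 0) = 0 := rfl
@[simp] theorem R_11_01 : p.R l t (1, 1) (0, 1) = 0 := rfl
@[simp] theorem R_11_10 : p.R l t (1, 1) (1, 0) = 0 := rfl

end entries

/-- The ice rule for the R-matrix. -/
theorem sgn_add_sgn_of_R_ne_zero (p : SOSModel N) {l t : ℂ} {i a j b : Fin 2}
    (h : p.R l t (i, a) (j, b) ≠ 0) : sgn i + sgn a = sgn j + sgn b := by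
  revert i a j b
  simp [Fin.forall_fin_two]

/-- The dynamical parameter `t` is generic: `φ` does not vanish on `t + ℤη`. -/
def IsGeneric (p : SOSModel N) (t : ℂ) : Prop := ∀ k : ℤ, p.φ (t + k * p.η) ≠ 0

theorem IsGeneric.add_sgn {p : SOSModel N} {t : ℂ} (h : p.IsGeneric t) (i : Fin 2) :
    p.IsGeneric (t + p.η * sgn i) := by
  intro k
  have := h (k + (1 - 2 * (i : ℕ)))
  rw [sgn]
  convert this using 2
  push_cast
  ring

/-- Fusion for a single site. -/
theorem R_fusion (p : SOSModel N) (hω : 0 < p.ω.im) {T : ℂ} (hT : p.IsGeneric T) (l : ℂ) :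
    ∀ i j α β : Fin 2, ∑ γ, (p.R l T (i, α) (0, γ) * p.R (l - p.η) (T + p.η * sgn 0) (j, γ) (1, β)
        - p.R l T (i, α) (1, γ) * p.R (l - p.η) (T + p.η * sgn 1) (j, γ) (0, β)) =
      if α = β ∧ i ≠ j then
        sgn i * (p.θ (l + p.η) * p.θ (l - p.η)) * (p.φ T / p.φ (T + p.η * sgn α)) else 0 := by
  have h0 : p.φ T ≠ 0 := by simpa using hT 0
  have h1 : p.φ (T + p.η) ≠ 0 := by simpa using hT 1
  have h2 : p.φ (T - p.η) ≠ 0 := by simpa [← sub_eq_add_neg] using hT (-1)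
  simp only [Fin.forall_fin_two, Fin.sum_univ_two]
  simp [← sub_eq_add_neg]
  constructorm* _ ∧ _
  all_goals first | rfl | field_simp
  -- In the cases α = β, i ≠ j where both terms survive, the identity is `φ_three_term`; the other
  -- cases are cancellations.
  · ring
  · linear_combination (norm := ring_nf)
      p.φ_three_term hω ((T + p.η + l) / 2) ((T + p.η - l) / 2) ((T + l - p.η) / 2)
        ((T - p.η - l) / 2)
  · linear_combination (norm := ring_nf)
      -p.φ_three_term hω ((T + p.η + l) / 2) ((T + p.η - l) / 2) ((T + l - p.η) / 2)
        ((T - p.η - l) / 2)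
  · ring

/-- The dynamical Yang–Baxter equation in components. -/
theorem R_yangBaxter (p : SOSModel N) (hω : 0 < p.ω.im) {T : ℂ} (hT : p.IsGeneric T) (x v : ℂ) :
    ∀ i j α k m β : Fin 2,
      ∑ a, ∑ b, p.R x (T + p.η * sgn α) (i, j) (a, b) *
        ∑ γ, p.R (x + v) T (a, α) (k, γ) * p.R v (T + p.η * sgn k) (b, γ) (m, β) =
      ∑ a, ∑ b, (∑ γ, p.R v T (j, α) (b, γ) * p.R (x + v) (T + p.η * sgn b) (i, γ) (a, β)) *
        p.R x T (a, b) (k, m) := by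
  have h0 : p.φ T ≠ 0 := by simpa using hT 0
  have h1 : p.φ (T + p.η) ≠ 0 := by simpa using hT 1
  have h2 : p.φ (T - p.η) ≠ 0 := by simpa [← sub_eq_add_neg] using hT (-1)
  have hφ := p.differentiable_φ hω
  -- The ice rule kills most components. The others are cancellations or multiples of one three-term
  -- relation, except two of higher degree.
  simp only [Fin.forall_fin_two, Fin.sum_univ_two]
  simp [← sub_eq_add_neg]
  constructorm* _ ∧ _
  all_goals first | ring1 | field_simp
  · linear_combination (norm := ring_nf)
      (p.θ p.η) * p.φ_three_term hω (T / 2 + (p.η + v + (x + v)) / 2) (T / 2 + (p.η - x) / 2)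
        (T / 2 + (x + p.η) / 2) (T / 2 + (-(x + p.η) / 2))
  · linear_combination (norm := ring_nf)
      (p.θ p.η) * p.φ_three_term hω (T / 2 + ((x + v) + x + p.η) / 2) (T / 2 + (v - p.η) / 2)
        (T / 2 + (v + p.η) / 2) (T / 2 + (-(v + p.η) / 2))
  · linear_combination (norm := ring_nf)
      -(p.θ p.η * p.φ (T + p.η + p.η)) * p.φ_three_term hω (T / 2 + (x / 2 + p.η))
        (T / 2 + (-x / 2)) (T / 2 + x / 2) (T / 2 + (-v - x / 2))
  -- A component with six φ's after clearing denominators. Its mirror image below uses φ(T − u),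
  -- which obeys the same three-term relation with the arguments reversed.
  · have := p.six_factor_relation hω (ψ := fun u => p.φ (T + u)) (by fun_prop)
      (fun a b c d => by
        linear_combination (norm := ring_nf)
          p.φ_three_term hω (T / 2 + a) (T / 2 + b) (T / 2 + c) (T / 2 + d))
      x v p.η
    linear_combination (norm := ring_nf) this
  · linear_combination (norm := ring_nf)
      (p.θ p.η) * p.φ_three_term hω (T / 2 + (p.η + x + (v + x)) / 2) (T / 2 + (p.η - v) / 2)
        (T / 2 + (v + p.η) / 2) (T / 2 + (-(v + p.η) / 2))
  · linear_combination (norm := ring_nf)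
      -(p.θ p.η) * p.φ_three_term hω (T / 2 - (-x - v / 2)) (T / 2 - v / 2) (T / 2 - (-v / 2))
        (T / 2 - (v / 2 + p.η))
  · linear_combination (norm := ring_nf)
      -(p.θ p.η) * p.φ_three_term hω ((T - p.η) / 2 + ((x + v) + x + p.η) / 2)
        ((T - p.η) / 2 + (v - p.η) / 2) ((T - p.η) / 2 + (v + p.η) / 2)
        ((T - p.η) / 2 + (-(v + p.η) / 2))
  · linear_combination (norm := ring_nf)
      -(p.θ p.η) * p.φ_three_term hω ((T + p.η) / 2 - (-(v + p.η) / 2))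
        ((T + p.η) / 2 - (v + p.η) / 2) ((T + p.η) / 2 - (v - p.η) / 2)
        ((T + p.η) / 2 - ((x + v) + x + p.η) / 2)
  · linear_combination (norm := ring_nf)
      -(p.θ p.η) * p.φ_three_term hω (T / 2 + (v / 2 + p.η)) (T / 2 + (-v / 2)) (T / 2 + v / 2)
        (T / 2 + (-x - v / 2))
  · linear_combination (norm := ring_nf)
      (p.θ p.η) * p.φ_three_term hω (T / 2 - (-(v + p.η) / 2)) (T / 2 - (v + p.η) / 2)
        (T / 2 - (p.η - v) / 2) (T / 2 - (p.η + x + (v + x)) / 2)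
  · have := p.six_factor_relation hω (ψ := fun u => p.φ (T - u)) (by fun_prop)
      (fun a b c d => by
        linear_combination (norm := ring_nf)
          p.φ_three_term hω (T / 2 - d) (T / 2 - c) (T / 2 - b) (T / 2 - a))
      x v p.η
    linear_combination (norm := ring_nf) this
  · linear_combination (norm := ring_nf)
      -(p.θ p.η * p.φ (T - p.η - p.η)) * p.φ_three_term hω (T / 2 - (-v - x / 2))
        (T / 2 - x / 2) (T / 2 - (-x / 2)) (T / 2 - (x / 2 + p.η))
  · linear_combination (norm := ring_nf)
      (p.θ p.η) * p.φ_three_term hω (T / 2 - (-(v + p.η) / 2)) (T / 2 - (v + p.η) / 2)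
        (T / 2 - (v - p.η) / 2) (T / 2 - ((x + v) + x + p.η) / 2)
  · linear_combination (norm := ring_nf)
      (p.θ p.η) * p.φ_three_term hω (T / 2 - (-(x + p.η) / 2)) (T / 2 - (x + p.η) / 2)
        (T / 2 - (p.η - x) / 2) (T / 2 - (p.η + v + (x + v)) / 2)
-- The monodromy matrix by recursion on the sites.
/-- The model on the first `N` of `N + 1` sites. -/
def dropLast (p : SOSModel (N + 1)) : SOSModel N where
  ω := p.ω
  η := p.η
  ξ n := p.ξ n.castSucc
  x := p.x
  y := p.y

/-- The restriction of a configuration to the first `N` sites. -/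
def trunc (h : SpinConfig (N + 1)) : SpinConfig N := fun n => h n.castSucc

/-- The configuration `h` with the spin `a` on an additional last site. -/
def extend (h : SpinConfig N) (a : Fin 2) : SpinConfig (N + 1) := Fin.snoc (α := fun _ => Fin 2) h a

@[simp] theorem trunc_extend (h : SpinConfig N) (a : Fin 2) : trunc (extend h a) = h := by
  funext n
  simp [trunc, extend]

@[simp] theorem extend_last (h : SpinConfig N) (a : Fin 2) : extend h a (Fin.last N) = a := by
  simp [extend]

theorem extend_trunc (h : SpinConfig (N + 1)) : extend (trunc h) (h (Fin.last N)) = h :=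
  Fin.snoc_init_self h

theorem sum_spinConfig_succ {A : Type*} [AddCommMonoid A] (F : SpinConfig (N + 1) → A) :
    ∑ f, F f = ∑ f, ∑ a, F (extend f a) := by
  rw [← (Fin.snocEquiv fun _ => Fin 2).sum_comp, Fintype.sum_prod_type, Finset.sum_comm]
  rfl

theorem eq_iff_trunc_eq {g h : SpinConfig (N + 1)} :
    g = h ↔ trunc g = trunc h ∧ g (Fin.last N) = h (Fin.last N) := by
  constructor
  · rintro rfl; exact ⟨rfl, rfl⟩
  · rintro ⟨h1, h2⟩
    rw [← extend_trunc g, ← extend_trunc h, h1, h2]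

theorem coe_spin (h : SpinConfig N) : (spin h : ℂ) = ∑ n, sgn (h n) := by
  simp [spin, sgn]

theorem coe_spin_succ (h : SpinConfig (N + 1)) :
    (spin h : ℂ) = spin (trunc h) + sgn (h (Fin.last N)) := by
  rw [coe_spin, coe_spin, Fin.sum_univ_castSucc]
  rfl

section monodromy

theorem R0_castSucc (p : SOSModel (N + 1)) (l t : ℂ) (n : Fin N) (o i : Fin 2)
    (g h : SpinConfig (N + 1)) :
    p.R0 l t n.castSucc (o, g) (i, h) =
      if g (Fin.last N) = h (Fin.last N) then p.dropLast.R0 l t n (o, trunc g) (i, trunc h)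
      else 0 := by
  have hc : (∀ m, m ≠ n.castSucc → g m = h m) ↔
      (g (Fin.last N) = h (Fin.last N) ∧ ∀ m, m ≠ n → trunc g m = trunc h m) := by
    constructor
    · intro H
      exact ⟨H _ (Fin.castSucc_lt_last n).ne', fun m hm => H _ (by simpa using hm)⟩
    · rintro ⟨h1, h2⟩ m
      induction m using Fin.lastCases with
      | last => exact fun _ => h1
      | cast m => exact fun hm => h2 m (by rintro rfl; exact hm rfl)
  have hs : ∑ m ∈ Finset.univ.filter (· < n.castSucc), (1 - 2 * ((h m : ℕ) : ℂ)) =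
      ∑ m ∈ Finset.univ.filter (· < n), (1 - 2 * ((trunc h m : ℕ) : ℂ)) := by
    rw [Finset.sum_filter, Finset.sum_filter, Fin.sum_univ_castSucc,
      if_neg (not_lt.2 (Fin.le_last _)), add_zero]
    simp [trunc]
  simp only [R0, Matrix.of_apply, hc, hs, ite_and]
  rfl

theorem R0_last (p : SOSModel (N + 1)) (l t : ℂ) (o i : Fin 2) (g h : SpinConfig (N + 1)) :
    p.R0 l t (Fin.last N) (o, g) (i, h) =
      if trunc g = trunc h then p.R (l - p.ξ (Fin.last N)) (t + p.η * spin (trunc h))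
        (o, g (Fin.last N)) (i, h (Fin.last N)) else 0 := by
  have hc : (∀ m, m ≠ Fin.last N → g m = h m) ↔ trunc g = trunc h := by
    constructor
    · exact fun H => funext fun m => H _ (Fin.castSucc_lt_last m).ne
    · intro H m
      induction m using Fin.lastCases with
      | last => exact fun h => absurd rfl h
      | cast m => exact fun _ => congrFun H m
  have hs : ∑ m ∈ Finset.univ.filter (· < Fin.last N), (1 - 2 * ((h m : ℕ) : ℂ)) =
      spin (trunc h) := by
    rw [Finset.sum_filter, Fin.sum_univ_castSucc, if_neg (lt_irrefl _), add_zero, coe_spin]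
    simp [trunc, sgn, Fin.castSucc_lt_last]
  simp only [R0, Matrix.of_apply, hc, hs]

theorem prod_map_R0_castSucc (p : SOSModel (N + 1)) (l t : ℂ) (L : List (Fin N)) (o i : Fin 2)
    (g h : SpinConfig (N + 1)) :
    ((L.map fun n => p.R0 l t n.castSucc).prod) (o, g) (i, h) =
      if g (Fin.last N) = h (Fin.last N) then
        ((L.map (p.dropLast.R0 l t)).prod) (o, trunc g) (i, trunc h) else 0 := by
  induction L generalizing o g with
  | nil =>
    simp only [List.map_nil, List.prod_nil, Matrix.one_apply, Prod.mk.injEq,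
      eq_iff_trunc_eq (g := g)]
    split_ifs <;> simp_all
  | cons n L ih =>
    simp only [List.map_cons, List.prod_cons, Matrix.mul_apply, Fintype.sum_prod_type,
      sum_spinConfig_succ, ih, R0_castSucc, extend_last, trunc_extend]
    split_ifs with hgh
    · refine Finset.sum_congr rfl fun k _ => Finset.sum_congr rfl fun f _ => ?_
      rw [Finset.sum_eq_single (g (Fin.last N)) (fun b _ hb => by simp [hb.symm]) (by simp)]
      simp [hgh]
    · refine Finset.sum_eq_zero fun k _ => Finset.sum_eq_zero fun f _ =>
        Finset.sum_eq_zero fun b _ => ?_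
      by_cases hb : g (Fin.last N) = b
      · subst hb; simp [hgh]
      · simp [hb]

/-- The monodromy matrix of `N + 1` sites in terms of that of the first `N` sites. -/
theorem Mentry_succ (p : SOSModel (N + 1)) (i j : Fin 2) (l t : ℂ) (g h : SpinConfig (N + 1)) :
    p.Mentry i j l t g h =
      ∑ k, p.R (l - p.ξ (Fin.last N)) (t + p.η * spin (trunc g)) (i, g (Fin.last N))
        (k, h (Fin.last N)) * p.dropLast.Mentry k j l t (trunc g) (trunc h) := by
  simp only [Mentry, M, Matrix.of_apply, List.finRange_succ_last, List.reverse_append,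
    List.reverse_cons, List.reverse_nil, List.nil_append, List.cons_append, List.map_cons,
    List.prod_cons, ← List.map_reverse, List.map_map, Function.comp_def, Matrix.mul_apply,
    Fintype.sum_prod_type, prod_map_R0_castSucc, R0_last, sum_spinConfig_succ, extend_last,
    trunc_extend]
  refine Finset.sum_congr rfl fun k _ => ?_
  -- The last factor changes only the last spin, so its dynamical argument can be read off from the
  -- outgoing configuration g.
  rw [Finset.sum_eq_single (trunc g) (fun f _ hf => by simp [hf.symm]) (by simp),
    Finset.sum_eq_single (h (Fin.last N)) (fun b _ hb => by simp [hb]) (by simp)]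
  simp

theorem Mentry_zero (p : SOSModel 0) (i j : Fin 2) (l t : ℂ) (g h : SpinConfig 0) :
    p.Mentry i j l t g h = if i = j then 1 else 0 := by
  have : g = h := Subsingleton.elim _ _
  simp [Mentry, M, Matrix.one_apply, this]

/-- The ice rule. -/
theorem spin_add_sgn_of_Mentry_ne_zero (p : SOSModel N) {i j : Fin 2} {l t : ℂ}
    {g h : SpinConfig N} (hne : p.Mentry i j l t g h ≠ 0) :
    (spin g : ℂ) + sgn i = spin h + sgn j := by
  induction N generalizing i with
  | zero =>
    rw [Mentry_zero] at hne
    have : g = h := Subsingleton.elim _ _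
    by_cases hij : i = j
    · rw [this, hij]
    · simp [hij] at hne
  | succ N ih =>
    rw [Mentry_succ] at hne
    obtain ⟨k, _, hk⟩ := Finset.exists_ne_zero_of_sum_ne_zero hne
    have h1 := p.sgn_add_sgn_of_R_ne_zero (left_ne_zero_of_mul hk)
    have h2 := ih p.dropLast (right_ne_zero_of_mul hk)
    rw [coe_spin_succ g, coe_spin_succ h]
    linear_combination h1 + h2

end monodromy

theorem IsGeneric.add_int {p : SOSModel N} {t : ℂ} (h : p.IsGeneric t) (n : ℤ) :
    p.IsGeneric (t + p.η * n) := by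
  intro k
  have := h (k + n)
  convert this using 2
  push_cast
  ring

/-- The product `M_{ij}(λ|t) M_{i'j'}(μ|t + ησ_j)`, the coefficient of a product of two dynamical
monodromy matrices. -/
def MM (p : SOSModel N) (i j i' j' : Fin 2) (l u t : ℂ) :
    Matrix (SpinConfig N) (SpinConfig N) ℂ :=
  p.Mentry i j l t * p.Mentry i' j' u (t + p.η * sgn j)

theorem MM_zero (p : SOSModel 0) (i j i' j' : Fin 2) (l u t : ℂ) (g h : SpinConfig 0) :
    p.MM i j i' j' l u t g h = (if i = j then 1 else 0) * (if i' = j' then 1 else 0) := by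
  simp only [MM, Matrix.mul_apply, Mentry_zero]
  simp

/-- By the ice rule for the first N sites, s_f + σ_j = s_g + σ_k for the intermediate configuration
f. So the global shift ησ_j becomes the shift ησ_k at the last site, as in the local R-matrix
relations, which can therefore be applied site by site. -/
theorem MM_succ (p : SOSModel (N + 1)) (i j i' j' : Fin 2) (l u t : ℂ)
    (g h : SpinConfig (N + 1)) :
    p.MM i j i' j' l u t g h = ∑ γ, ∑ k, ∑ m,
      p.R (l - p.ξ (Fin.last N)) (t + p.η * spin (trunc g)) (i, g (Fin.last N)) (k, γ) *
      p.R (u - p.ξ (Fin.last N)) (t + p.η * spin (trunc g) + p.η * sgn k) (i', γ)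
        (m, h (Fin.last N)) * p.dropLast.MM k j m j' l u t (trunc g) (trunc h) := by
  simp only [MM, Matrix.mul_apply, sum_spinConfig_succ, Mentry_succ, trunc_extend, extend_last]
  rw [Finset.sum_comm]
  refine Finset.sum_congr rfl fun γ _ => ?_
  simp only [Finset.sum_mul_sum]
  simp only [Finset.mul_sum]
  rw [Finset.sum_comm]
  refine Finset.sum_congr rfl fun k _ => ?_
  rw [Finset.sum_comm]
  refine Finset.sum_congr rfl fun m _ => Finset.sum_congr rfl fun f _ => ?_
  by_cases h0 : p.dropLast.Mentry k j l t (trunc g) f = 0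
  · simp [h0]
  · have := p.dropLast.spin_add_sgn_of_Mentry_ne_zero h0
    rw [show t + p.η * sgn j + p.η * (spin f : ℂ) =
      t + p.η * spin (trunc g) + p.η * sgn k by linear_combination -p.η * this]
    simp only [show p.dropLast.η = p.η from rfl]
    ring

/-- The exchange relations of the monodromy matrix. -/
theorem MM_exchange (p : SOSModel N) (hω : 0 < p.ω.im) {t : ℂ} (ht : p.IsGeneric t) (l u : ℂ)
    (i j i' j' : Fin 2) (g h : SpinConfig N) :
    ∑ a, ∑ b, p.R (l - u) (t + p.η * spin g) (i, i') (a, b) * p.MM a j b j' l u t g h =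
      ∑ a, ∑ b, p.MM i' b i a u l t g h * p.R (l - u) t (a, b) (j, j') := by
  induction N generalizing i i' with
  | zero =>
    have hs : (spin g : ℂ) = 0 := by simp [spin]
    simp only [MM_zero, hs, mul_zero, add_zero]
    simp
  | succ N ih =>
    have hT : p.IsGeneric (t + p.η * spin (trunc g)) := ht.add_int _
    have hY := p.R_yangBaxter hω hT (l - u) (u - p.ξ (Fin.last N)) i i' (g (Fin.last N))
    have IH := fun a b => ih p.dropLast hω ht a b (trunc g) (trunc h)
    rw [coe_spin_succ g, mul_add, ← add_assoc]
    simp only [MM_succ]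
    rw [show l - u + (u - p.ξ (Fin.last N)) = l - p.ξ (Fin.last N) by ring] at hY
    set T := t + p.η * spin (trunc g)
    set X := fun k m => p.dropLast.MM k j m j' l u t (trunc g) (trunc h) with hX
    have IH' : ∀ a b, ∑ k, ∑ m, p.R (l - u) T (a, b) (k, m) * X k m =
      ∑ k, ∑ m, p.dropLast.MM b m a k u l t (trunc g) (trunc h) * p.R (l - u) t (k, m) (j, j') :=
      IH
    have hY' := fun k m => hY k m (h (Fin.last N))
    -- The Yang–Baxter equation carries R(l − u) past the last site, which resets its dynamical
    -- argument to T; the inductive hypothesis then carries it past the others.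
    have IH2 : ∀ a b, (∑ γ, p.R (u - p.ξ (Fin.last N)) T (i', g (Fin.last N)) (b, γ) *
        p.R (l - p.ξ (Fin.last N)) (T + p.η * sgn b) (i, γ) (a, h (Fin.last N))) *
        ∑ k, ∑ m, p.R (l - u) T (a, b) (k, m) * X k m = _ := fun a b =>
      congrArg (_ * ·) (IH' a b)
    simp only [Fin.sum_univ_two] at hY' IH2 ⊢
    linear_combination X 0 0 * hY' 0 0 + X 0 1 * hY' 0 1 + X 1 0 * hY' 1 0 + X 1 1 * hY' 1 1 +
      IH2 0 0 + IH2 0 1 + IH2 1 0 + IH2 1 1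

theorem dProd_eq (p : SOSModel N) (l : ℂ) : p.dProd l = ∏ n, p.θ (l - p.ξ n) := by
  simp only [dProd, aProd, a]
  exact Finset.prod_congr rfl fun n _ => by congr 1; ring

theorem aProd_eq (p : SOSModel N) (l : ℂ) : p.aProd l = ∏ n, p.θ (l - p.ξ n + p.η) := rfl

/-- The quantum determinant of the monodromy matrix. -/
theorem MM_sub_MM (p : SOSModel N) (hω : 0 < p.ω.im) {t : ℂ} (ht : p.IsGeneric t) (l : ℂ)
    (i j : Fin 2) (g h : SpinConfig N) :
    p.MM i 0 j 1 l (l - p.η) t g h - p.MM i 1 j 0 l (l - p.η) t g h =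
      if g = h ∧ i ≠ j then
        sgn i * (p.aProd l * p.dProd (l - p.η)) * (p.φ t / p.φ (t + p.η * spin g)) else 0 := by
  induction N generalizing i j with
  | zero =>
    have hgh : g = h := Subsingleton.elim _ _
    have h0 : p.φ t ≠ 0 := by simpa using ht 0
    have hs : (spin g : ℂ) = 0 := by simp [spin]
    rw [MM_zero, MM_zero, hs, aProd_eq, dProd_eq]
    revert i j
    simp [Fin.forall_fin_two, hgh, h0]
  | succ N ih =>
    have hT : p.IsGeneric (t + p.η * spin (trunc g)) := ht.add_int _
    have hF := p.R_fusion hω hT (l - p.ξ (Fin.last N)) i j (g (Fin.last N)) (h (Fin.last N))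
    have IH := fun k m => ih p.dropLast hω ht k m (trunc g) (trunc h)
    have h0 : p.φ (t + p.η * spin (trunc g)) ≠ 0 := by simpa using hT 0
    rw [MM_succ, MM_succ, coe_spin_succ g, mul_add, ← add_assoc,
      show l - p.η - p.ξ (Fin.last N) = l - p.ξ (Fin.last N) - p.η by ring]
    set T := t + p.η * spin (trunc g)
    have hprod : p.aProd l * p.dProd (l - p.η) = p.dropLast.aProd l * p.dropLast.dProd (l - p.η) *
        (p.θ (l - p.ξ (Fin.last N) + p.η) * p.θ (l - p.ξ (Fin.last N) - p.η)) := by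
      rw [aProd_eq, dProd_eq, aProd_eq, dProd_eq, Fin.prod_univ_castSucc, Fin.prod_univ_castSucc,
        show l - p.η - p.ξ (Fin.last N) = l - p.ξ (Fin.last N) - p.η by ring]
      simp only [show p.dropLast.θ = p.θ from rfl, show p.dropLast.η = p.η from rfl,
        show ∀ n, p.dropLast.ξ n = p.ξ n.castSucc from fun _ => rfl]
      ring
    set A := fun k γ => p.R (l - p.ξ (Fin.last N)) T (i, g (Fin.last N)) (k, γ) with hA
    set B := fun k γ m => p.R (l - p.ξ (Fin.last N) - p.η) (T + p.η * sgn k) (j, γ)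
      (m, h (Fin.last N)) with hB
    set Q := p.dropLast.aProd l * p.dropLast.dProd (l - p.η) with hQ
    -- Factoring out the last site leaves the antisymmetrized N-site product, already known to be
    -- scalar; what remains is `R_fusion` at the last site, and the φ-ratios telescope.
    have hlhs : ∀ X Y : Fin 2 → Fin 2 → ℂ,
        ∑ γ, ∑ k, ∑ m, A k γ * B k γ m * X k m - ∑ γ, ∑ k, ∑ m, A k γ * B k γ m * Y k m =
        ∑ k, ∑ m, (∑ γ, A k γ * B k γ m) * (X k m - Y k m) := fun X Y => by
      simp only [Fin.sum_univ_two]; ring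
    rw [hlhs (fun k m => p.dropLast.MM k 0 m 1 l (l - p.η) t (trunc g) (trunc h))
      (fun k m => p.dropLast.MM k 1 m 0 l (l - p.η) t (trunc g) (trunc h))]
    have IH' : ∀ k m, p.dropLast.MM k 0 m 1 l (l - p.η) t (trunc g) (trunc h) -
      p.dropLast.MM k 1 m 0 l (l - p.η) t (trunc g) (trunc h) =
        if trunc g = trunc h ∧ k ≠ m then sgn k * Q * (p.φ t / p.φ T) else 0 := IH
    simp only [IH', hprod]
    have hF' : ∑ γ, (A 0 γ * B 0 γ 1 - A 1 γ * B 1 γ 0) = _ := hF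
    simp only [eq_iff_trunc_eq (g := g)]
    by_cases hg : trunc g = trunc h
    · have hr : (if g (Fin.last N) = h (Fin.last N) ∧ i ≠ j then sgn i * (Q *
          (p.θ (l - p.ξ (Fin.last N) + p.η) * p.θ (l - p.ξ (Fin.last N) - p.η))) *
          (p.φ t / p.φ (T + p.η * sgn (g (Fin.last N)))) else 0) = Q * (p.φ t / p.φ T) *
          ∑ γ, (A 0 γ * B 0 γ 1 - A 1 γ * B 1 γ 0) := by
        rw [hF']
        split_ifs
        · field_simp
        · ring
      simp only [hg, true_and]
      rw [hr]
      simp [Fin.sum_univ_two]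
      ring
    · simp [hg]

theorem R_zero (p : SOSModel N) {t : ℂ} (ht : p.φ t ≠ 0) (i a k c : Fin 2) :
    p.R 0 t (i, a) (k, c) = if i = c ∧ a = k then p.θ p.η else 0 := by
  revert i a k c
  simp [Fin.forall_fin_two, θ_zero, ht]

/-- At −η the weight a vanishes and the remaining block is antisymmetric in its outputs. Paired with
R(0), a multiple of the permutation, this drives the vanishing relations at an inhomogeneity. -/
theorem R_neg_η_add (p : SOSModel N) (t : ℂ) (i i' k c : Fin 2) :
    p.R (-p.η) t (i, i') (k, c) + p.R (-p.η) t (i', i) (k, c) = 0 := by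
  revert i i' k c
  simp [Fin.forall_fin_two, θ_zero, θ_neg, sub_eq_add_neg]

theorem R_neg_η_diag (p : SOSModel N) (t : ℂ) (i i' j : Fin 2) :
    p.R (-p.η) t (i, i') (j, j) = 0 := by
  revert i i' j
  simp [Fin.forall_fin_two, θ_zero]

/-- At the inhomogeneity `ξ_n`, products of monodromy matrices are antisymmetric in the row
indices. -/
theorem MM_ξ_add (p : SOSModel N) (hω : 0 < p.ω.im) {t : ℂ} (ht : p.IsGeneric t) (n : Fin N)
    (i j i' j' : Fin 2) (g h : SpinConfig N) :
    p.MM i j i' j' (p.ξ n) (p.ξ n - p.η) t g h +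
      p.MM i' j i j' (p.ξ n) (p.ξ n - p.η) t g h = 0 := by
  induction N generalizing i i' with
  | zero => exact n.elim0
  | succ N ih =>
    have hT : p.IsGeneric (t + p.η * spin (trunc g)) := ht.add_int _
    rw [MM_succ, MM_succ]
    set T := t + p.η * spin (trunc g)
    have h0 : p.φ T ≠ 0 := by simpa using hT 0
    induction n using Fin.lastCases with
    | last =>
      rw [sub_self, show p.ξ (Fin.last N) - p.η - p.ξ (Fin.last N) = -p.η by ring]
      have h1 := fun m => p.R_neg_η_add (T + p.η * sgn (g (Fin.last N))) i' i m (h (Fin.last N))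
      -- R(0) permutes the row index into the site, which leaves R(−η) with the two row indices as
      -- its outputs.
      simp only [R_zero _ h0, ite_and, ite_mul, zero_mul, Finset.sum_ite_eq, Finset.mem_univ,
        if_true, Finset.sum_const_zero, Finset.sum_ite_irrel]
      rw [← Finset.sum_add_distrib]
      exact Finset.sum_eq_zero fun m _ => by
        linear_combination p.θ p.η * p.dropLast.MM (g (Fin.last N)) j m j' (p.ξ (Fin.last N))
          (p.ξ (Fin.last N) - p.η) t (trunc g) (trunc h) * h1 m
    | cast n =>
      have IH := fun k m => ih p.dropLast hω ht n k m (trunc g) (trunc h)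
      rw [show p.ξ n.castSucc - p.η - p.ξ (Fin.last N) = p.ξ n.castSucc - p.ξ (Fin.last N) - p.η by
        ring]
      have hF := fun i i' => p.R_fusion hω hT (p.ξ n.castSucc - p.ξ (Fin.last N)) i i'
        (g (Fin.last N)) (h (Fin.last N))
      set X := fun k m => p.dropLast.MM k j m j' (p.ξ n.castSucc) (p.ξ n.castSucc - p.η) t
        (trunc g) (trunc h) with hX
      have IH' : ∀ k m, X k m + X m k = 0 := IH
      -- An antisymmetric X is determined by X 0 1, and its coefficient is the fused pair of
      -- R-matrices, antisymmetric in i, i' by `R_fusion`.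
      have h00 : X 0 0 = 0 := by simpa using IH' 0 0
      have h11 : X 1 1 = 0 := by simpa using IH' 1 1
      have h10 : X 1 0 = -X 0 1 := eq_neg_of_add_eq_zero_left (IH' 1 0)
      have hF' := congrArg₂ (· + ·) (hF i i') (hF i' i)
      have hs : ∀ k m : Fin 2, k ≠ m → sgn m = -sgn k := by simp [Fin.forall_fin_two]
      have hr : ∀ (P : Prop) [Decidable P] (a b : ℂ), (if P ∧ i ≠ i' then sgn i * a * b else 0) +
          (if P ∧ i' ≠ i then sgn i' * a * b else 0) = 0 := fun P _ a b => by
        by_cases hP : P <;> by_cases hi : i = i' <;> simp [hP, hi, Ne.symm]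
        rw [hs i i' hi]
        ring
      rw [hr] at hF'
      simp only [Fin.sum_univ_two] at hF' ⊢
      simp only [show ∀ k m, p.dropLast.MM k j m j' (p.ξ n.castSucc) (p.ξ n.castSucc - p.η) t
        (trunc g) (trunc h) = X k m from fun _ _ => rfl, h00, h11, h10]
      linear_combination X 0 1 * hF'

theorem MM_ξ_same_row (p : SOSModel N) (hω : 0 < p.ω.im) {t : ℂ} (ht : p.IsGeneric t) (n : Fin N)
    (i j j' : Fin 2) : p.MM i j i j' (p.ξ n) (p.ξ n - p.η) t = 0 := by
  ext g h
  have := p.MM_ξ_add hω ht n i j i j' g h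
  simpa using this

/-- At the inhomogeneity `ξ_n`, products of monodromy matrices with equal column indices vanish. -/
theorem MM_ξ_same_column (p : SOSModel N) (hω : 0 < p.ω.im) {t : ℂ} (ht : p.IsGeneric t)
    (n : Fin N) (i i' j : Fin 2) : p.MM i j i' j (p.ξ n - p.η) (p.ξ n) t = 0 := by
  ext g h
  change _ = (0 : ℂ)
  induction N generalizing i i' with
  | zero => exact n.elim0
  | succ N ih =>
    rw [MM_succ]
    induction n using Fin.lastCases with
    | last =>
      have hT : ∀ k, p.φ (t + p.η * spin (trunc g) + p.η * sgn k) ≠ 0 := fun k => by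
        simpa using ((ht.add_int (spin (trunc g))).add_sgn k) 0
      -- Here R(0) sits in the second factor, so the last site contributes R(−η) acting on the rows
      -- of the shorter product. The exchange relation moves it to the columns, where it kills equal
      -- indices.
      have hE := p.dropLast.MM_exchange hω ht (p.ξ (Fin.last N) - p.η) (p.ξ (Fin.last N))
        i j (g (Fin.last N)) j (trunc g) (trunc h)
      simp only [show p.ξ (Fin.last N) - p.η - p.ξ (Fin.last N) = -p.η by ring, sub_self,
        R_zero _ (hT _)] at hE ⊢
      have hE' : ∑ a, ∑ b, p.R (-p.η) (t + p.η * spin (trunc g)) (i, g (Fin.last N)) (a, b) *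
          p.dropLast.MM a j b j (p.ξ (Fin.last N) - p.η) (p.ξ (Fin.last N)) t (trunc g)
            (trunc h) = 0 := by
        refine hE.trans (Finset.sum_eq_zero fun a _ => Finset.sum_eq_zero fun b _ => ?_)
        rw [show p.dropLast.R (-p.η) t (a, b) (j, j) = 0 from p.dropLast.R_neg_η_diag t a b j,
          mul_zero]
      by_cases hb : i' = h (Fin.last N)
      · simp only [hb, true_and, mul_ite, mul_zero, ite_mul, zero_mul]
        simp only [Finset.sum_ite_eq, Finset.mem_univ, if_true]
        rw [Finset.sum_comm]
        simp only [Fin.sum_univ_two] at hE' ⊢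
        linear_combination p.θ p.η * hE'
      · simp [hb]
    | cast n =>
      refine Finset.sum_eq_zero fun γ _ => Finset.sum_eq_zero fun k _ =>
        Finset.sum_eq_zero fun m _ => ?_
      rw [show p.dropLast.MM k j m j (p.ξ n.castSucc - p.η) (p.ξ n.castSucc) t (trunc g) (trunc h)
        = 0 from ih p.dropLast hω ht n k m (trunc g) (trunc h), mul_zero]

/-! ### Dependence on the spectral parameter; the entry D(λ|t). -/

/-- A matrix element of the R-matrix as a function of the spectral parameter. -/
theorem exists_R_eq (p : SOSModel N) (t : ℂ) (i a k c : Fin 2) : ∃ C : ℂ, ∀ l,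
    p.R l t (i, a) (k, c) = Complex.exp (Complex.I * p.yc * ((sgn i - sgn k) / 2) * l) *
      (C * p.θ (l - ((sgn k - sgn i) / 2 * t - p.η * ((1 + sgn i * sgn a) / 2)))) := by
  have h01 : ∀ l, p.R l t (0, 1) (1, 0) = Complex.exp (Complex.I * p.yc * l) *
      (p.θ p.η * Complex.exp (Complex.I * p.yc * t) / p.φ t * p.θ (l + t)) := fun l => by
    rw [R_01_10, φ, mul_add, Complex.exp_add, add_comm t]; ring
  have h10 : ∀ l, p.R l t (1, 0) (0, 1) = Complex.exp (-(Complex.I * p.yc * l)) *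
      (-p.θ p.η * Complex.exp (Complex.I * p.yc * t) / p.φ t * p.θ (l - t)) := fun l => by
    rw [R_10_01, φ, mul_sub, sub_eq_add_neg (_ * t), Complex.exp_add, ← neg_sub l, θ_neg]; ring
  have hz : ∀ e f : ℂ → ℂ, ∃ C : ℂ, ∀ l, 0 = e l * (C * f l) := fun e f => ⟨0, fun l => by ring⟩
  revert i a k c
  simp only [Fin.forall_fin_two]
  refine ⟨⟨⟨⟨⟨1, fun l => by simp⟩, hz _ _⟩, hz _ _, hz _ _⟩,
    ⟨hz _ _, ⟨p.φ (t + p.η) / p.φ t, fun l => ?_⟩⟩,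
      ⟨p.θ p.η * Complex.exp (Complex.I * p.yc * t) / p.φ t,
      fun l => (h01 l).trans ?_⟩, hz _ _⟩,
    ⟨⟨hz _ _, ⟨-p.θ p.η * Complex.exp (Complex.I * p.yc * t) / p.φ t,
      fun l => (h10 l).trans ?_⟩⟩, ⟨p.φ (t - p.η) / p.φ t, fun l => ?_⟩, hz _ _⟩,
    ⟨hz _ _, hz _ _⟩, hz _ _, ⟨1, fun l => ?_⟩⟩
  · simp [mul_comm]
  · rw [sgn_zero, sgn_one]
    congr 2 <;> ring_nf
  · rw [sgn_zero, sgn_one]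
    congr 2 <;> ring_nf
  · simp [mul_comm]
  · simp

/-- A matrix element of the monodromy matrix as a function of the spectral parameter. -/
theorem exists_Mentry_eq (p : SOSModel N) (t : ℂ) (i j : Fin 2) (g h : SpinConfig N) :
    ∃ f ∈ p.thetaSpan N (∑ n, p.ξ n - p.η * ((N + sgn i * spin g) / 2) + (sgn j - sgn i) / 2 * t),
      ∀ l, p.Mentry i j l t g h =
        Complex.exp (Complex.I * p.yc * ((sgn i - sgn j) / 2) * l) * f l := by
  induction N generalizing i with
  | zero =>
    by_cases hij : i = j
    · subst hij
      refine ⟨p.thetaProd [], Submodule.subset_span ⟨[], rfl, ?_, rfl⟩, fun l => ?_⟩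
      · simp [spin]
      · simp [Mentry_zero]
    · exact ⟨0, Submodule.zero_mem _, fun l => by simp [Mentry_zero, hij]⟩
  | succ N ih =>
    have hterm : ∀ k, ∃ f ∈ p.thetaSpan (N + 1) (∑ n, p.ξ n -
        p.η * (((N + 1 : ℕ) + sgn i * spin g) / 2) + (sgn j - sgn i) / 2 * t), ∀ l,
        p.R (l - p.ξ (Fin.last N)) (t + p.η * spin (trunc g)) (i, g (Fin.last N))
          (k, h (Fin.last N)) * p.dropLast.Mentry k j l t (trunc g) (trunc h) =
        Complex.exp (Complex.I * p.yc * ((sgn i - sgn j) / 2) * l) * f l := by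
      intro k
      obtain ⟨f, hf, hMf⟩ := ih p.dropLast k (trunc g) (trunc h)
      obtain ⟨C, hC⟩ := p.exists_R_eq (t + p.η * spin (trunc g)) i (g (Fin.last N)) k
        (h (Fin.last N))
      -- The zero contributed by the last site. Added to the N-site sum of zeros it gives a total
      -- independent of the internal index k, so all terms lie in one space.
      set u := p.ξ (Fin.last N) + ((sgn k - sgn i) / 2 * (t + p.η * spin (trunc g)) -
        p.η * ((1 + sgn i * sgn (g (Fin.last N))) / 2)) with hu
      set c := Complex.exp (-(Complex.I * p.yc * ((sgn i - sgn k) / 2) * p.ξ (Fin.last N))) * C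
      refine ⟨fun l => c * p.θ (l - u) * f l, ?_, fun l => ?_⟩
      · have hmem : (fun l => c * p.θ (l - u) * f l) ∈ p.thetaSpan (N + 1) _ :=
          p.dropLast.mul_θ_mem_thetaSpan hf u c
        convert hmem using 1
        congr 1
        rw [Fin.sum_univ_castSucc, coe_spin_succ g, hu]
        simp only [show p.dropLast.η = p.η from rfl,
          show ∀ n, p.dropLast.ξ n = p.ξ n.castSucc from fun _ => rfl]
        push_cast
        ring
      · rw [hC, hMf, show l - p.ξ (Fin.last N) - ((sgn k - sgn i) / 2 *
          (t + p.η * spin (trunc g)) - p.η * ((1 + sgn i * sgn (g (Fin.last N))) / 2)) = l - u by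
          rw [hu]; ring, show Complex.I * p.yc * ((sgn i - sgn j) / 2) * l =
          Complex.I * p.yc * ((sgn i - sgn k) / 2) * (l - p.ξ (Fin.last N)) +
          Complex.I * p.dropLast.yc * ((sgn k - sgn j) / 2) * l +
          Complex.I * p.yc * ((sgn i - sgn k) / 2) * p.ξ (Fin.last N) by
            rw [show p.dropLast.yc = p.yc from rfl]; ring, Complex.exp_add, Complex.exp_add]
        simp only [c, Complex.exp_neg]
        field_simp
    choose f hf hMf using hterm
    refine ⟨∑ k, f k, Submodule.sum_mem _ fun k _ => hf k, fun l => ?_⟩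
    simp only [Mentry_succ, hMf, Finset.sum_apply, Finset.mul_sum]

theorem differentiable_of_mem_thetaSpan (p : SOSModel N) (hω : 0 < p.ω.im) {n : ℕ} {U : ℂ}
    {f : ℂ → ℂ} (hf : f ∈ p.thetaSpan n U) : Differentiable ℂ f := by
  induction hf using Submodule.span_induction with
  | mem f hf =>
    obtain ⟨L, -, -, rfl⟩ := hf
    have hθ := p.differentiable_θ hω
    induction L with
    | nil => exact differentiable_const 1
    | cons u L ih =>
      rw [show p.thetaProd (u :: L) = (fun l => p.θ (l - u)) * p.thetaProd L from
        funext fun l => p.thetaProd_cons u L l]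
      exact (hθ.comp (differentiable_id.sub_const u)).mul ih
  | zero => exact differentiable_const 0
  | add f g _ _ hf hg => exact hf.add hg
  | smul c f _ hf => exact hf.const_smul c

theorem differentiable_Mentry (p : SOSModel N) (hω : 0 < p.ω.im) (t : ℂ) (i j : Fin 2)
    (g h : SpinConfig N) : Differentiable ℂ fun l => p.Mentry i j l t g h := by
  obtain ⟨f, hf, hM⟩ := p.exists_Mentry_eq t i j g h
  simp only [hM]
  have := p.differentiable_of_mem_thetaSpan hω hf
  fun_prop

/-- The operator `D(λ|t)` is invertible outside of the zeros of its eigenvalues. -/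
theorem isUnit_Mentry_one_one (p : SOSModel N) {t l : ℂ} (ht : p.IsGeneric t)
    (h0 : ∀ n, p.θ (l - p.ξ n) ≠ 0) (h1 : ∀ n, p.θ (l - p.ξ n + p.η) ≠ 0) :
    IsUnit (p.Mentry 1 1 l t) := by
  rw [← Matrix.mulVec_injective_iff_isUnit, ← Matrix.coe_mulVecLin,
    injective_iff_map_eq_zero]
  simp only [Matrix.coe_mulVecLin, funext_iff, Matrix.mulVec, dotProduct, Pi.zero_apply]
  intro v hv
  induction N with
  | zero =>
    intro h
    have := hv h
    rwa [Fintype.sum_eq_single h fun x hx => absurd (Subsingleton.elim x h) hx, Mentry_zero,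
      if_pos rfl, one_mul] at this
  | succ N ih =>
    have ih' := fun v => ih p.dropLast ht (fun n => h0 n.castSucc)
      (fun n => h1 n.castSucc) v
    have hrow : ∀ g a, ∑ k, ∑ c, p.R (l - p.ξ (Fin.last N)) (t + p.η * spin g) (1, a) (k, c) *
        ∑ h, p.dropLast.Mentry k 1 l t g h * v (extend h c) = 0 := fun g a => by
      have := hv (extend g a)
      simp only [sum_spinConfig_succ, Mentry_succ, trunc_extend, extend_last] at this
      rw [← this]
      simp only [Fin.sum_univ_two, add_mul, Finset.sum_add_distrib, Finset.mul_sum, mul_assoc]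
      ring
    -- D(λ|t) is block triangular in the last spin: an outgoing spin down only receives spin down.
    -- The spin-down component vanishes first, and the remaining diagonal block then removes the
    -- spin-up component.
    have hv1 : ∀ h, v (extend h 1) = 0 := ih' _ fun g => by
      have := hrow g 1
      simp only [Fin.sum_univ_two, R_11_00, R_11_01, R_11_10, R_11_11, zero_mul, zero_add] at this
      exact (mul_eq_zero.mp this).resolve_left (h1 _)
    have hv0 : ∀ h, v (extend h 0) = 0 := ih' _ fun g => by
      have := hrow g 0
      have hT : p.IsGeneric (t + p.η * spin g) := ht.add_int _
      simp only [Fin.sum_univ_two, R_10_00, R_10_10, zero_mul, zero_add, hv1,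
        mul_zero, Finset.sum_const_zero, add_zero] at this
      refine (mul_eq_zero.mp this).resolve_left (mul_ne_zero (h0 _) (div_ne_zero ?_ ?_))
      · simpa [← sub_eq_add_neg] using hT (-1)
      · simpa using hT 0
    intro h
    rw [← extend_trunc h]
    generalize h (Fin.last N) = c
    revert c
    simp [Fin.forall_fin_two, hv0, hv1]

theorem spin_const_zero : spin (fun _ => 0 : SpinConfig N) = N := by
  simp [spin]

theorem spin_le (h : SpinConfig N) : spin h ≤ N := by
  refine (Finset.sum_le_card_nsmul _ _ 1 fun n _ => ?_).trans_eq (by simp)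
  omega

theorem neg_le_spin (h : SpinConfig N) : -(N : ℤ) ≤ spin h := by
  refine (by simp : -(N : ℤ) = Finset.card (Finset.univ : Finset (Fin N)) • (-1 : ℤ)).trans_le
    (Finset.card_nsmul_le_sum _ _ _ fun n _ => ?_)
  omega

theorem spin_const_one : spin (fun _ => 1 : SpinConfig N) = -N := by
  simp [spin]

/-- All spins up has maximal total spin, so the ice rule excludes the path through the entry B of
the shorter chain. The factors φ(T − η)/φ(T), with T growing by η at each site, telescope. -/
theorem Mentry_one_one_zero (p : SOSModel N) {t : ℂ} (ht : p.IsGeneric t) (l : ℂ)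
    (h : SpinConfig N) :
    p.Mentry 1 1 l t (fun _ => 0) h = if h = fun _ => 0 then
      (∏ n, p.θ (l - p.ξ n)) * (p.φ (t - p.η) / p.φ (t + (N - 1) * p.η)) else 0 := by
  induction N with
  | zero =>
    have h0 : p.φ (t - p.η) ≠ 0 := by simpa [← sub_eq_add_neg] using ht (-1)
    have : h = fun _ => 0 := Subsingleton.elim _ _
    simp [Mentry_zero, this, ← sub_eq_add_neg, h0]
  | succ N ih =>
    have IH := ih p.dropLast ht (trunc h)
    have hs : trunc (fun _ => 0 : SpinConfig (N + 1)) = fun _ => 0 := rfl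
    have hice : p.dropLast.Mentry 0 1 l t (fun _ => 0) (trunc h) = 0 := by
      by_contra hne
      have := p.dropLast.spin_add_sgn_of_Mentry_ne_zero hne
      rw [spin_const_zero, sgn_zero, sgn_one] at this
      have h1 : (N : ℤ) + 1 = spin (trunc h) + -1 := by exact_mod_cast this
      linarith [spin_le (trunc h)]
    have hc : (h = fun _ => 0) ↔ trunc h = (fun _ => 0) ∧ h (Fin.last N) = 0 := eq_iff_trunc_eq
    rw [Mentry_succ, Fin.sum_univ_two, hs, hice, mul_zero, zero_add, IH, spin_const_zero,
      Fin.prod_univ_castSucc]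
    simp only [hc]
    have h1 : p.φ (t + p.η * N) ≠ 0 := by simpa [mul_comm] using ht N
    have h2 : p.φ (t + (N - 1) * p.η) ≠ 0 := by simpa [mul_comm] using ht (N - 1)
    by_cases h' : trunc h = fun _ => 0
    · generalize h (Fin.last N) = c
      revert c
      simp only [Fin.forall_fin_two, h', if_true, true_and, R_10_10, R_10_11, zero_mul]
      refine ⟨?_, by simp⟩
      rw [show t + p.η * (N : ℤ) - p.η = t + (N - 1) * p.η by push_cast; ring,
        show t + ((N + 1 : ℕ) - 1) * p.η = t + p.η * N by push_cast; ring]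
      simp only [show p.dropLast.θ = p.θ from rfl, show p.dropLast.η = p.η from rfl,
        show p.dropLast.φ = p.φ from rfl,
        show ∀ n, p.dropLast.ξ n = p.ξ n.castSucc from fun _ => rfl,
        Int.cast_natCast]
      field_simp
    · simp [h']

/-- The minimal-spin counterpart: only the weights a occur, so no dynamical factor appears. -/
theorem Mentry_one_one_one (p : SOSModel N) (l t : ℂ) (g : SpinConfig N) :
    p.Mentry 1 1 l t g (fun _ => 1) =
      if g = fun _ => 1 then ∏ n, p.θ (l - p.ξ n + p.η) else 0 := by
  induction N with
  | zero =>
    have : g = fun _ => 1 := Subsingleton.elim _ _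
    simp [Mentry_zero, this]
  | succ N ih =>
    have IH := ih p.dropLast (trunc g)
    have hs : trunc (fun _ => 1 : SpinConfig (N + 1)) = fun _ => 1 := rfl
    have hice : p.dropLast.Mentry 0 1 l t (trunc g) (fun _ => 1) = 0 := by
      by_contra hne
      have := p.dropLast.spin_add_sgn_of_Mentry_ne_zero hne
      rw [spin_const_one, sgn_zero, sgn_one] at this
      have h1 : spin (trunc g) + 1 = -(N : ℤ) + -1 := by exact_mod_cast this
      linarith [neg_le_spin (trunc g)]
    have hc : (g = fun _ => 1) ↔ trunc g = (fun _ => 1) ∧ g (Fin.last N) = 1 := eq_iff_trunc_eq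
    rw [Mentry_succ, Fin.sum_univ_two, hs, IH, hice, mul_zero, zero_add, Fin.prod_univ_castSucc]
    simp only [hc]
    by_cases h' : trunc g = fun _ => 1
    · generalize g (Fin.last N) = c
      revert c
      simp only [Fin.forall_fin_two, h', if_true, true_and]
      simp
      rw [mul_comm]; rfl
    · simp [h']

/-! ### Operators on the space extended by the dynamical variable. -/

/-- The eigenvalue of `σᶻ` as an integer. -/
def sgnZ (i : Fin 2) : ℤ := 1 - 2 * ((i : ℕ) : ℤ)

@[simp] theorem sgnZ_zero : sgnZ 0 = 1 := rfl

@[simp] theorem sgnZ_one : sgnZ 1 = -1 := rfl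

theorem coe_sgnZ (i : Fin 2) : (sgnZ i : ℂ) = sgn i := by simp [sgnZ, sgn]

theorem end_ext {X Y : Module.End ℂ (DynSpace N)}
    (h : ∀ s, X (Finsupp.single s 1) = Y (Finsupp.single s 1)) : X = Y :=
  Finsupp.lhom_ext' fun s => LinearMap.ext_ring (h s)

theorem subst_single (p : SOSModel N) (F : ℂ → Matrix (SpinConfig N) (SpinConfig N) ℂ)
    (s : SpinConfig N × ℤ) : p.subst F (Finsupp.single s 1) =
      ∑ g, F (p.height s.2) g s.1 • Finsupp.single (g, s.2) (1 : ℂ) := by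
  rw [subst, Finsupp.linearCombination_single, one_smul]

theorem T_single (k : ℤ) (s : SpinConfig N × ℤ) (c : ℂ) :
    T N k (Finsupp.single s c) = Finsupp.single (s.1, s.2 + k) c := by
  rw [T, Finsupp.lmapDomain_apply, Finsupp.mapDomain_single]

theorem T_mul_T (k m : ℤ) : T N k * T N m = T N (k + m) :=
  end_ext fun s => by
    rw [Module.End.mul_apply, T_single, T_single, T_single, add_assoc, add_comm m]

@[simp] theorem T_zero : T N 0 = 1 :=
  end_ext fun s => by simp [T_single]

theorem subst_congr (p : SOSModel N) {F G : ℂ → Matrix (SpinConfig N) (SpinConfig N) ℂ}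
    (h : ∀ k, F (p.height k) = G (p.height k)) : p.subst F = p.subst G :=
  end_ext fun s => by rw [subst_single, subst_single, h]

theorem subst_mul_subst (p : SOSModel N) (F G : ℂ → Matrix (SpinConfig N) (SpinConfig N) ℂ) :
    p.subst F * p.subst G = p.subst fun t => F t * G t :=
  end_ext fun s => by
    simp only [Module.End.mul_apply, subst_single, map_sum, map_smul, Finset.smul_sum, smul_smul,
      Matrix.mul_apply, Finset.sum_smul]
    rw [Finset.sum_comm]
    simp only [mul_comm]

theorem subst_add (p : SOSModel N) (F G : ℂ → Matrix (SpinConfig N) (SpinConfig N) ℂ) :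
    p.subst (fun t => F t + G t) = p.subst F + p.subst G :=
  end_ext fun s => by
    simp only [LinearMap.add_apply, subst_single, Matrix.add_apply, add_smul,
      Finset.sum_add_distrib]

theorem subst_sub (p : SOSModel N) (F G : ℂ → Matrix (SpinConfig N) (SpinConfig N) ℂ) :
    p.subst (fun t => F t - G t) = p.subst F - p.subst G :=
  end_ext fun s => by
    simp only [LinearMap.sub_apply, subst_single, Matrix.sub_apply, sub_smul,
      Finset.sum_sub_distrib]

theorem subst_smul_one (p : SOSModel N) (c : ℂ) :
    p.subst (fun _ => c • (1 : Matrix (SpinConfig N) (SpinConfig N) ℂ)) = c • 1 :=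
  end_ext fun s => by
    rw [subst_single, Finset.sum_eq_single s.1 (fun g _ hg => by simp [hg]) (by simp)]
    simp

theorem subst_one (p : SOSModel N) : p.subst (fun _ => 1) = 1 := by
  simpa using p.subst_smul_one 1

theorem subst_zero (p : SOSModel N) : p.subst (fun _ => 0) = 0 := by
  simpa using p.subst_smul_one 0

theorem subst_sum (p : SOSModel N) {ι : Type*} (s : Finset ι)
    (F : ι → ℂ → Matrix (SpinConfig N) (SpinConfig N) ℂ) :
    p.subst (fun t => ∑ i ∈ s, F i t) = ∑ i ∈ s, p.subst (F i) := by
  classical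
  induction s using Finset.induction_on with
  | empty => simpa using p.subst_zero
  | insert a s ha ih => simp only [Finset.sum_insert ha, subst_add, ih]

theorem height_add (p : SOSModel N) (a k : ℤ) :
    p.height (a + k) + p.η * k = p.height a := by
  simp only [height]; push_cast; ring

theorem T_mul_subst (p : SOSModel N) (F : ℂ → Matrix (SpinConfig N) (SpinConfig N) ℂ) (k : ℤ) :
    T N k * p.subst F = p.subst (fun t => F (t + p.η * k)) * T N k :=
  end_ext fun s => by
    simp only [Module.End.mul_apply, T_single, subst_single, map_sum, map_smul, height_add]

theorem isUnit_T (k : ℤ) : IsUnit (T N k) :=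
  ⟨⟨T N k, T N (-k), by simp [T_mul_T], by simp [T_mul_T]⟩, rfl⟩

theorem isUnit_subst (p : SOSModel N) {F : ℂ → Matrix (SpinConfig N) (SpinConfig N) ℂ}
    (h : ∀ k, IsUnit (F (p.height k))) : IsUnit (p.subst F) := by
  have h' := fun k => (Matrix.isUnit_iff_isUnit_det _).mp (h k)
  refine ⟨⟨p.subst F, p.subst fun t => (F t)⁻¹, ?_, ?_⟩, rfl⟩ <;>
    rw [subst_mul_subst, ← p.subst_one] <;> refine p.subst_congr fun k => ?_
  · exact Matrix.mul_nonsing_inv _ (h' k)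
  · exact Matrix.nonsing_inv_mul _ (h' k)

/-! ### Functions of `τ` and `S` -/

/-- The operator `f(τ, S)`. -/
def dynFun (p : SOSModel N) (f : ℂ → ℤ → ℂ) : Module.End ℂ (DynSpace N) :=
  p.subst fun t => Matrix.diagonal fun h => f t (spin h)

/-- The dynamical monodromy matrix. -/
def calM (p : SOSModel N) (i j : Fin 2) (l : ℂ) : Module.End ℂ (DynSpace N) :=
  p.subst (p.Mentry i j l) * T N (sgnZ j)

theorem calB_eq (p : SOSModel N) (l : ℂ) : p.calB l = p.calM 0 1 l := rfl

theorem calC_eq (p : SOSModel N) (l : ℂ) : p.calC l = p.calM 1 0 l := rfl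

theorem calD_eq (p : SOSModel N) (l : ℂ) : p.calD l = p.calM 1 1 l := rfl

theorem dynFun_single (p : SOSModel N) (f : ℂ → ℤ → ℂ) (s : SpinConfig N × ℤ) :
    p.dynFun f (Finsupp.single s 1) = f (p.height s.2) (spin s.1) • Finsupp.single s 1 := by
  rw [dynFun, subst_single, Finset.sum_eq_single s.1 (fun g _ hg => by simp [hg]) (by simp)]
  simp

theorem dynFun_const (p : SOSModel N) (c : ℂ) : p.dynFun (fun _ _ => c) = c • 1 :=
  end_ext fun _ => dynFun_single _ _ _

theorem dynFun_zero (p : SOSModel N) : p.dynFun (fun _ _ => 0) = 0 := by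
  rw [dynFun_const, zero_smul]

theorem dynFun_apply (p : SOSModel N) (f : ℂ → ℤ → ℂ) (v : DynSpace N) (s : SpinConfig N × ℤ) :
    p.dynFun f v s = f (p.height s.2) (spin s.1) * v s := by
  induction v using Finsupp.induction_linear with
  | zero => simp
  | add v w hv hw => simp [hv, hw, mul_add]
  | single a c =>
    rw [← mul_one c, ← smul_eq_mul, ← Finsupp.smul_single, map_smul, dynFun_single]
    by_cases h : a = s
    · subst h; simp [mul_comm]
    · simp [h]

theorem calM_single_apply (p : SOSModel N) (i j : Fin 2) (l : ℂ) (s b : SpinConfig N × ℤ) :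
    p.calM i j l (Finsupp.single s 1) b =
      if b.2 = s.2 + sgnZ j then p.Mentry i j l (p.height b.2) b.1 s.1 else 0 := by
  rw [calM, Module.End.mul_apply, T_single, subst_single, Finsupp.finsetSum_apply]
  obtain ⟨g, k⟩ := b
  rw [Finset.sum_eq_single g (fun g' _ hg => by simp [hg]) (by simp)]
  by_cases h : k = s.2 + sgnZ j
  · simp [h]
  · simp [h]

/-- The operator form of the ice rule. -/
theorem calM_mul_dynFun (p : SOSModel N) (i j : Fin 2) (l : ℂ) (f : ℂ → ℤ → ℂ) :
    p.calM i j l * p.dynFun f =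
      p.dynFun (fun t s => f (t + p.η * sgn j) (s + sgnZ i - sgnZ j)) * p.calM i j l := by
  rw [calM, dynFun, dynFun, mul_assoc, T_mul_subst, ← mul_assoc, ← mul_assoc, subst_mul_subst,
    subst_mul_subst]
  congr 2
  funext t
  ext g h
  rw [Matrix.mul_diagonal, Matrix.diagonal_mul, mul_comm]
  by_cases hM : p.Mentry i j l t g h = 0
  · simp [hM]
  · have := p.spin_add_sgn_of_Mentry_ne_zero hM
    simp only [← coe_sgnZ] at this ⊢
    have h1 : spin g + sgnZ i = spin h + sgnZ j := by exact_mod_cast this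
    rw [h1, add_sub_cancel_right]

/-- Moving the shift operator past the second factor produces exactly the shift built into `MM`, so
operator relations reduce to matrix identities at each height. -/
theorem calM_mul_calM (p : SOSModel N) (i j i' j' : Fin 2) (l u : ℂ) :
    p.calM i j l * p.calM i' j' u = p.subst (p.MM i j i' j' l u) * T N (sgnZ j + sgnZ j') := by
  rw [calM, calM, mul_assoc, ← mul_assoc (T N _), T_mul_subst, mul_assoc, T_mul_T, ← mul_assoc,
    subst_mul_subst]
  simp only [coe_sgnZ]
  rfl

theorem calM_exchange (p : SOSModel N) (hω : 0 < p.ω.im) (ht : ∀ k, p.IsGeneric (p.height k))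
    (l u : ℂ) (i j i' j' : Fin 2) :
    ∑ a, ∑ b, p.dynFun (fun t s => p.R (l - u) (t + p.η * s) (i, i') (a, b)) *
        (p.calM a j l * p.calM b j' u) =
      ∑ a, ∑ b, p.dynFun (fun t _ => p.R (l - u) t (a, b) (j, j')) *
        (p.calM i' b u * p.calM i a l) := by
  have hl : ∀ a b, p.dynFun (fun t s => p.R (l - u) (t + p.η * s) (i, i') (a, b)) *
      (p.calM a j l * p.calM b j' u) = p.subst (fun t => Matrix.of fun g h =>
        p.R (l - u) (t + p.η * spin g) (i, i') (a, b) * p.MM a j b j' l u t g h) *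
        T N (sgnZ j + sgnZ j') := fun a b => by
    rw [calM_mul_calM, dynFun, ← mul_assoc, subst_mul_subst]
    congr 2
    funext t
    ext g h
    rw [Matrix.diagonal_mul, Matrix.of_apply]
  have hr : ∀ a b, p.dynFun (fun t _ => p.R (l - u) t (a, b) (j, j')) *
      (p.calM i' b u * p.calM i a l) = p.subst (fun t => Matrix.of fun g h =>
        p.MM i' b i a u l t g h * p.R (l - u) t (a, b) (j, j')) *
        T N (sgnZ j + sgnZ j') := fun a b => by
    rw [calM_mul_calM, dynFun, ← mul_assoc, subst_mul_subst]
    by_cases hs : sgnZ b + sgnZ a = sgnZ j + sgnZ j'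
    · rw [hs]
      congr 2
      funext t
      ext g h
      rw [Matrix.diagonal_mul, Matrix.of_apply, mul_comm]
    -- Terms whose total height shift differs from that of the left-hand side have zero coefficient
    -- by the ice rule.
    · have hR : ∀ t, p.R (l - u) t (a, b) (j, j') = 0 := fun t => by
        by_contra hne
        have := p.sgn_add_sgn_of_R_ne_zero hne
        rw [← coe_sgnZ, ← coe_sgnZ, ← coe_sgnZ, ← coe_sgnZ, add_comm] at this
        exact hs (by exact_mod_cast this)
      have h1 : (fun t => (Matrix.diagonal fun _ => p.R (l - u) t (a, b) (j, j')) *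
          p.MM i' b i a u l t) = fun _ => 0 := by
        funext t; simp [hR]
      have h2 : (fun t => Matrix.of fun g h =>
          p.MM i' b i a u l t g h * p.R (l - u) t (a, b) (j, j')) = fun _ => 0 := by
        funext t; ext g h; simp [hR]
      rw [h1, h2, subst_zero, zero_mul, zero_mul]
  simp only [hl, hr, ← Finset.sum_mul, ← subst_sum]
  refine congrArg (· * T N (sgnZ j + sgnZ j')) (p.subst_congr fun k => ?_)
  ext g h
  simpa only [Matrix.sum_apply, Matrix.of_apply] using
    p.MM_exchange hω (ht k) l u i j i' j' g h

/-! ### Quantum determinant, degenerations and uniqueness of A. -/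

theorem qdetFactor_eq (p : SOSModel N) :
    p.qdetFactor = p.dynFun fun t s => p.φ (t + p.η * s) / p.φ t := by
  rw [qdetFactor, dynFun]
  congr 1
  funext t
  congr 1
  funext h
  rw [← p.exp_mul_θ_div]
  congr 2
  ring

theorem isUnit_qdetFactor (p : SOSModel N) (ht : ∀ k, p.IsGeneric (p.height k)) :
    IsUnit p.qdetFactor := by
  rw [qdetFactor_eq, dynFun]
  refine p.isUnit_subst fun k => ?_
  rw [Matrix.isUnit_iff_isUnit_det, Matrix.det_diagonal, isUnit_iff_ne_zero]
  refine Finset.prod_ne_zero_iff.mpr fun h _ => div_ne_zero ?_ (by simpa using ht k 0)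
  simpa [mul_comm] using ht k (spin h)

/-- The height shifts cancel in total, and the prefactor is the inverse of the φ-ratio in
`MM_sub_MM`. The two index orders give the two relations of the theorem. -/
theorem qdetFactor_mul_calM_sub (p : SOSModel N) (hω : 0 < p.ω.im)
    (ht : ∀ k, p.IsGeneric (p.height k)) (l : ℂ) (i j : Fin 2) (hij : i ≠ j) :
    p.qdetFactor * (p.calM i i l * p.calM j j (l - p.η) - p.calM i j l * p.calM j i (l - p.η)) =
      (p.aProd l * p.dProd (l - p.η)) • 1 := by
  have hT : ∀ i j : Fin 2, i ≠ j → sgnZ i + sgnZ j = 0 := by simp [Fin.forall_fin_two]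
  have hM : ∀ t g h, p.IsGeneric t → p.MM i i j j l (l - p.η) t g h -
      p.MM i j j i l (l - p.η) t g h = if g = h then
        (p.aProd l * p.dProd (l - p.η)) * (p.φ t / p.φ (t + p.η * spin g)) else 0 := by
    intro t g h ht
    have H := fun i j => p.MM_sub_MM hω ht l i j g h
    revert i j
    simp only [Fin.forall_fin_two]
    refine ⟨⟨fun h => absurd rfl h, fun _ => ?_⟩, fun _ => ?_, fun h => absurd rfl h⟩
    · rw [H]
      simp
    · rw [← neg_sub, H]
      by_cases hg : g = h <;> simp [hg]
  rw [qdetFactor_eq, dynFun, calM_mul_calM, calM_mul_calM, hT i j hij, hT j i hij.symm, T_zero,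
    mul_one, mul_one, ← subst_sub, subst_mul_subst, ← subst_smul_one]
  refine p.subst_congr fun k => ?_
  ext g h
  have h0 : p.φ (p.height k) ≠ 0 := by simpa using ht k 0
  have h1 : p.φ (p.height k + p.η * spin g) ≠ 0 := by simpa [mul_comm] using ht k (spin g)
  rw [Matrix.diagonal_mul, Matrix.sub_apply, hM _ g h (ht k), Matrix.smul_apply, Matrix.one_apply]
  by_cases hg : g = h
  · rw [if_pos hg, if_pos hg, smul_eq_mul]
    field_simp
  · simp [hg]

theorem qDet1_A (p : SOSModel N) (hω : 0 < p.ω.im) (ht : ∀ k, p.IsGeneric (p.height k)) (l : ℂ) :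
    p.QDet1 l (p.A l) :=
  p.qdetFactor_mul_calM_sub hω ht l 0 1 (by simp)

theorem qDet2_A (p : SOSModel N) (hω : 0 < p.ω.im) (ht : ∀ k, p.IsGeneric (p.height k)) (l : ℂ) :
    p.QDet2 l (p.A l) := by
  have := p.qdetFactor_mul_calM_sub hω ht (l + p.η) 1 0 (by simp)
  rwa [add_sub_cancel_right] at this

theorem calC_ξ_mul_calC (p : SOSModel N) (hω : 0 < p.ω.im) (ht : ∀ k, p.IsGeneric (p.height k))
    (n : Fin N) : p.calC (p.ξ n) * p.calC (p.ξ n - p.η) = 0 := by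
  rw [calC_eq, calC_eq, calM_mul_calM, p.subst_congr (G := fun _ => 0) fun k =>
    p.MM_ξ_same_row hω (ht k) n 1 0 0, subst_zero, zero_mul]

/-- The spectral parameters come in the order opposite to `calC_ξ_mul_calC`, so this is the column
degeneration rather than the row one. -/
theorem calB_mul_calB_ξ (p : SOSModel N) (hω : 0 < p.ω.im) (ht : ∀ k, p.IsGeneric (p.height k))
    (n : Fin N) : p.calB (p.ξ n - p.η) * p.calB (p.ξ n) = 0 := by
  rw [calB_eq, calB_eq, calM_mul_calM, p.subst_congr (G := fun _ => 0) fun k =>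
    p.MM_ξ_same_column hω (ht k) n 0 0 1, subst_zero, zero_mul]

theorem commute_calC (p : SOSModel N) (hω : 0 < p.ω.im) (ht : ∀ k, p.IsGeneric (p.height k))
    {l u : ℂ} (h : p.θ (l - u + p.η) ≠ 0) : Commute (p.calC l) (p.calC u) := by
  have := p.calM_exchange hω ht l u 1 0 1 0
  simp only [Fin.sum_univ_two, R_11_00, R_11_01, R_11_10, R_11_11, R_00_00, R_01_00, R_10_00,
    dynFun_zero, zero_mul, zero_add, add_zero, dynFun_const, smul_mul_assoc, one_mul] at this
  exact smul_right_injective _ h this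

theorem φ_ne_zero (p : SOSModel N) (hω : 0 < p.ω.im) {t : ℂ} (ht : t ∉ p.Γ) : p.φ t ≠ 0 :=
  mul_ne_zero (Complex.exp_ne_zero _) fun h => ht ((p.θ_eq_zero_iff hω).mp h)

theorem isGeneric_height (p : SOSModel N) (hω : 0 < p.ω.im)
    (ht : ∀ k : ℤ, p.t0 + k * p.η ∉ p.Γ) (k : ℤ) : p.IsGeneric (p.height k) := fun m => by
  convert p.φ_ne_zero hω (ht (m - k)) using 2
  simp only [height]
  push_cast
  ring

/-- `𝒟(λ)` is invertible outside of the zeros of its eigenvalues. -/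
theorem isUnit_calD (p : SOSModel N) (hω : 0 < p.ω.im) (ht : ∀ k, p.IsGeneric (p.height k)) {l : ℂ}
    (hl : ∀ (n : Fin N) (k : Fin 2), l - p.ξs n k ∉ p.Γ) : IsUnit (p.calD l) := by
  refine (p.isUnit_subst fun k => p.isUnit_Mentry_one_one (ht k) (fun n h => ?_)
    fun n h => ?_).mul (isUnit_T _)
  · exact hl n 0 ((p.θ_eq_zero_iff hω).mp (by simpa [ξs] using h))
  · refine hl n 1 ((p.θ_eq_zero_iff hω).mp ?_)
    rw [← h, ξs]
    congr 1
    simp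
    ring

theorem end_sub_right_cancel {X Y Z : Module.End ℂ (DynSpace N)} (h : X - Z = Y - Z) : X = Y :=
  LinearMap.ext fun v => sub_left_inj.mp (LinearMap.congr_fun h v)

/-- Both X and A(λ|τ) solve an equation that is affine in the unknown, with invertible coefficients:
the prefactor, the shift and 𝒟(λ − η). -/
theorem eq_A_of_QDet1 (p : SOSModel N) (hω : 0 < p.ω.im) (ht : ∀ k, p.IsGeneric (p.height k))
    {l : ℂ} (hl : ∀ (n : Fin N) (k : Fin 2), l - p.η - p.ξs n k ∉ p.Γ)
    {X : Module.End ℂ (DynSpace N)} (hX : p.QDet1 l X) : X = p.A l := by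
  have h := (p.isUnit_qdetFactor ht).mul_left_cancel (hX.trans (p.qDet1_A hω ht l).symm)
  have h' := end_sub_right_cancel h
  exact (isUnit_T 1).mul_right_cancel ((p.isUnit_calD hω ht hl).mul_right_cancel h')

theorem eq_A_of_QDet2 (p : SOSModel N) (hω : 0 < p.ω.im) (ht : ∀ k, p.IsGeneric (p.height k))
    {l : ℂ} (hl : ∀ (n : Fin N) (k : Fin 2), l + p.η - p.ξs n k ∉ p.Γ)
    {X : Module.End ℂ (DynSpace N)} (hX : p.QDet2 l X) : X = p.A l := by
  have h := (p.isUnit_qdetFactor ht).mul_left_cancel (hX.trans (p.qDet2_A hω ht l).symm)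
  have h' := end_sub_right_cancel h
  exact (isUnit_T 1).mul_right_cancel ((p.isUnit_calD hω ht hl).mul_left_cancel h')

theorem countable_Γ (p : SOSModel N) : p.Γ.Countable := by
  refine (Set.countable_range fun m : ℤ × ℤ =>
    (Real.pi : ℂ) * m.1 + (Real.pi : ℂ) * p.ω * m.2).mono ?_
  rintro z ⟨m, n, rfl⟩
  exact ⟨(m, n), rfl⟩

/-- The excluded points form finitely many translates of the countable set Γ. -/
theorem dense_sub_ξs_notMem_Γ (p : SOSModel N) (c : ℂ) :
    Dense {l : ℂ | ∀ (n : Fin N) (k : Fin 2), l + c - p.ξs n k ∉ p.Γ} := by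
  have hc : (⋃ (n : Fin N) (k : Fin 2), (fun z => z + (p.ξs n k - c)) '' p.Γ).Countable :=
    Set.countable_iUnion fun n => Set.countable_iUnion fun k => p.countable_Γ.image _
  refine (hc.dense_compl ℝ).mono ?_
  intro l hl n k hΓ
  refine hl ?_
  simp only [Set.mem_iUnion, Set.mem_image]
  exact ⟨n, k, _, hΓ, by ring⟩

theorem continuous_A_single_apply (p : SOSModel N) (hω : 0 < p.ω.im) (s s' : SpinConfig N × ℤ) :
    Continuous fun l => p.A l (Finsupp.single s 1) s' := by
  have h := (p.differentiable_Mentry hω (p.height s.2) 0 0 s'.1 s.1).continuous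
  have hA : ∀ l, p.A l (Finsupp.single s 1) s' =
      if s.2 = s'.2 then p.Mentry 0 0 l (p.height s.2) s'.1 s.1 else 0 := fun l => by
    obtain ⟨g, k⟩ := s'
    rw [A, subst_single, Finsupp.finsetSum_apply,
      Finset.sum_eq_single g (fun g' _ hg => by simp [hg]) (by simp)]
    by_cases h : s.2 = k
    · simp [h]
    · simp [h]
  simp only [hA]
  split_ifs
  · exact h
  · exact continuous_const

theorem eq_A_of_dense (p : SOSModel N) (hω : 0 < p.ω.im) {X : ℂ → Module.End ℂ (DynSpace N)}
    (hX : ∀ s s' : SpinConfig N × ℤ, Continuous fun l => X l (Finsupp.single s 1) s')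
    {S : Set ℂ} (hS : Dense S) (h : ∀ l ∈ S, X l = p.A l) (l : ℂ) : X l = p.A l :=
  end_ext fun s => Finsupp.ext fun s' => congrFun (Continuous.ext_on hS (hX s s')
    (p.continuous_A_single_apply hω s s') fun l hl => by
      simp only [h l hl]) l

/-! ### Quasi-periodicity and interpolation -/

/-- The shift `xπ/2 + yπω/2` of the dynamical parameter. -/
def c0 (p : SOSModel N) : ℂ := p.xc * (Real.pi / 2) + p.yc * (Real.pi / 2) * p.ω

/-- The sign `(-1)^{x+y+xy}`. -/
def κ (p : SOSModel N) : ℂ := (-1) ^ ((p.x : ℕ) + (p.y : ℕ) + (p.x : ℕ) * (p.y : ℕ))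

theorem κ_mul_κ (p : SOSModel N) : p.κ * p.κ = 1 := by
  rw [κ, ← mul_pow]; norm_num

/-- 2c₀ = xπ + yπω is a lattice vector. The sign (−1)^{x+y+xy} is the combined effect of the
quasi-periods of θ and of the factor e^{iyt}. -/
theorem φ_two_mul_c0_add (p : SOSModel N) (w : ℂ) :
    p.φ (2 * p.c0 + w) = p.κ * Complex.exp (-(2 * Complex.I * p.yc * w)) * p.φ w := by
  have hx : p.x = 0 ∨ p.x = 1 := by omega
  have hy : p.y = 0 ∨ p.y = 1 := by omega
  rcases hx with hx | hx <;> rcases hy with hy | hy <;>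
    simp only [φ, c0, κ, xc, yc, hx, hy, Fin.val_zero, Fin.val_one, Nat.cast_zero, Nat.cast_one]
  · simp
  · rw [show (2 : ℂ) * (0 * (Real.pi / 2) + 1 * (Real.pi / 2) * p.ω) + w =
      w + Real.pi * p.ω by ring,
      θ_add_pi_mul_ω]
    have he : Complex.exp (Complex.I * 1 * (w + Real.pi * p.ω)) *
        Complex.exp (-Complex.I * Real.pi * p.ω - 2 * Complex.I * w) =
        Complex.exp (-(2 * Complex.I * 1 * w)) * Complex.exp (Complex.I * 1 * w) := by
      rw [← Complex.exp_add, ← Complex.exp_add]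
      ring_nf
    norm_num at he ⊢
    linear_combination p.θ w * he
  · rw [show (2 : ℂ) * (1 * (Real.pi / 2) + 0 * (Real.pi / 2) * p.ω) + w = w + Real.pi by ring,
      θ_add_pi]
    simp
  · rw [show (2 : ℂ) * (1 * (Real.pi / 2) + 1 * (Real.pi / 2) * p.ω) + w =
      w + Real.pi + Real.pi * p.ω by ring, θ_add_pi_mul_ω, θ_add_pi]
    have he : Complex.exp (Complex.I * 1 * (w + Real.pi + Real.pi * p.ω)) *
        Complex.exp (-Complex.I * Real.pi * p.ω - 2 * Complex.I * (w + Real.pi)) =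
        -(Complex.exp (-(2 * Complex.I * 1 * w)) * Complex.exp (Complex.I * 1 * w)) := by
      rw [← mul_neg_one (Complex.exp _ * _), ← Complex.exp_pi_mul_I, ← Complex.exp_add,
        ← Complex.exp_add, ← Complex.exp_add, Complex.exp_eq_exp_iff_exists_int]
      exact ⟨-1, by push_cast; ring⟩
    norm_num at he ⊢
    linear_combination p.θ w * he

theorem φ_neg (p : SOSModel N) (w : ℂ) :
    p.φ (-w) = -Complex.exp (-(2 * Complex.I * p.yc * w)) * p.φ w := by
  rw [φ, φ, θ_neg, show Complex.I * p.yc * -w =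
    -(2 * Complex.I * p.yc * w) + Complex.I * p.yc * w by ring, Complex.exp_add]
  ring

theorem φ_two_mul_c0_sub (p : SOSModel N) (w : ℂ) : p.φ (2 * p.c0 - w) = -p.κ * p.φ w := by
  have he := Complex.exp_neg (-(2 * Complex.I * p.yc * w))
  rw [sub_eq_add_neg, φ_two_mul_c0_add, φ_neg, mul_neg, he]
  field_simp

/-- The functions of `λ` of the type of the matrix elements `M_{ij}(λ|t)_{gh}` with `s_g = s`. -/
def IsMatrixElement (p : SOSModel N) (i j : Fin 2) (t : ℂ) (s : ℤ) (F : ℂ → ℂ) : Prop :=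
  ∃ f ∈ p.thetaSpan N (∑ n, p.ξ n - p.η * ((N + sgn i * s) / 2) + (sgn j - sgn i) / 2 * t),
    ∀ l, F l = Complex.exp (Complex.I * p.yc * ((sgn i - sgn j) / 2) * l) * f l

theorem IsMatrixElement.sum (p : SOSModel N) {i j : Fin 2} {t : ℂ} {s : ℤ} {ι : Type*}
    {A : Finset ι} {F : ι → ℂ → ℂ} (c : ι → ℂ)
    (h : ∀ a ∈ A, c a ≠ 0 → p.IsMatrixElement i j t s (F a)) :
    p.IsMatrixElement i j t s fun l => ∑ a ∈ A, c a * F a l := by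
  choose! f hf hF using h
  refine ⟨∑ a ∈ A, c a • f a, Submodule.sum_mem _ fun a ha => ?_, fun l => ?_⟩
  · by_cases hc : c a = 0
    · simp [hc]
    · exact Submodule.smul_mem _ _ (hf a ha hc)
  · rw [Finset.sum_apply, Finset.mul_sum]
    refine Finset.sum_congr rfl fun a ha => ?_
    by_cases hc : c a = 0
    · simp [hc]
    · rw [hF a ha hc, Pi.smul_apply, smul_eq_mul]
      ring

theorem IsMatrixElement.zero (p : SOSModel N) (i j : Fin 2) (t : ℂ) (s : ℤ) :
    p.IsMatrixElement i j t s fun _ => 0 := ⟨0, Submodule.zero_mem _, by simp⟩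

theorem IsMatrixElement.Mentry (p : SOSModel N) (i j : Fin 2) (t : ℂ) (g h : SpinConfig N) :
    p.IsMatrixElement i j t (spin g) fun l => p.Mentry i j l t g h := p.exists_Mentry_eq t i j g h

/-- The hypothesis `hU` fixes S as the excess of the sum of zeros over the sum of nodes; the
exponential prefactor is carried along as a ratio between λ and each node. -/
theorem IsMatrixElement.interpolation {p : SOSModel N} {i j : Fin 2} {t : ℂ} {s : ℤ} {F : ℂ → ℂ}
    (hF : p.IsMatrixElement i j t s F) (hω : 0 < p.ω.im) {z : Fin N → ℂ}
    (hz : ∀ a b, a ≠ b → p.θ (z a - z b) ≠ 0) {S : ℂ} (hS : p.θ S ≠ 0)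
    (hU : ∑ n, p.ξ n - p.η * ((N + sgn i * s) / 2) + (sgn j - sgn i) / 2 * t = S + ∑ n, z n)
    (l : ℂ) : F l = ∑ a, Complex.exp (Complex.I * p.yc * ((sgn i - sgn j) / 2) * (l - z a)) *
      (p.θ (S - l + z a) / p.θ S) * (∏ b ∈ Finset.univ.erase a,
        p.θ (l - z b) / p.θ (z a - z b)) * F (z a) := by
  obtain ⟨f, hf, hF⟩ := hF
  have := p.interpolation_of_mem_thetaSpan hω (A := Finset.univ) (z := z) (s := S)
    (fun a _ b _ => hz a b) hS (f := f) (by rwa [Finset.card_univ, Fintype.card_fin, ← hU]) l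
  rw [hF, eq_div_of_mul_eq hS ((mul_comm _ _).trans this), Finset.sum_div, Finset.mul_sum]
  refine Finset.sum_congr rfl fun a _ => ?_
  rw [hF, lagrangeNum, mul_sub, Complex.exp_sub, show S - l + z a = S + z a - l by ring]
  field_simp [Complex.exp_ne_zero]

theorem tval_eq (p : SOSModel N) (r : ℤ) (h : SpinConfig N) :
    p.tval r h = p.c0 - p.η * (spin h / 2) + r * p.η := by
  rw [tval, c0]; ring

/-- The interpolation of ℬ naturally has the parameter −(t_{r,h} + ηs_h); this identifies it with
t_{−r,h} up to the lattice vector 2c₀. -/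
theorem tval_add_spin (p : SOSModel N) (r : ℤ) (h : SpinConfig N) :
    p.tval (-r) h = 2 * p.c0 + -(p.tval r h + p.η * spin h) := by
  rw [tval_eq, tval_eq]; push_cast; ring

/-- The interpolation coefficient in terms of `φ`. -/
theorem interp_eq_of_eq_two_mul_c0_add (p : SOSModel N) (S : ℂ) (h : SpinConfig N) (i : Fin N)
    (l : ℂ) : p.interp (2 * p.c0 + S) h i l =
      Complex.exp (Complex.I * p.yc * (l - p.ξs i (h i))) *
      (p.θ (S - l + p.ξs i (h i)) / p.θ S) * ∏ b ∈ Finset.univ.erase i,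
        p.θ (l - p.ξs b (h b)) / p.θ (p.ξs i (h i) - p.ξs b (h b)) := by
  have h1 := p.exp_mul_θ_div (2 * p.c0 + S) (2 * p.c0 + S - l + p.ξs i (h i))
  have h2 := p.exp_mul_θ_div S (S - l + p.ξs i (h i))
  rw [show 2 * p.c0 + S - l + p.ξs i (h i) - (2 * p.c0 + S) = p.ξs i (h i) - l by ring,
    show 2 * p.c0 + S - l + p.ξs i (h i) = 2 * p.c0 + (S - l + p.ξs i (h i)) by ring] at h1
  rw [show S - l + p.ξs i (h i) - S = p.ξs i (h i) - l by ring] at h2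
  rw [interp, show 2 * p.c0 + S - l + p.ξs i (h i) = 2 * p.c0 + (S - l + p.ξs i (h i)) by ring, h1]
  congr 1
  rw [φ_two_mul_c0_add, φ_two_mul_c0_add, show -(2 * Complex.I * p.yc * (S - l + p.ξs i (h i))) =
    Complex.I * p.yc * (l - p.ξs i (h i)) + Complex.I * p.yc * (l - p.ξs i (h i)) +
    -(2 * Complex.I * p.yc * S) by ring, Complex.exp_add, Complex.exp_add]
  have hκ : p.κ ≠ 0 := left_ne_zero_of_mul_eq_one p.κ_mul_κ
  have he : Complex.exp (Complex.I * p.yc * (l - p.ξs i (h i))) *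
      Complex.exp (Complex.I * p.yc * (p.ξs i (h i) - l)) = 1 := by
    rw [← Complex.exp_add, ← Complex.exp_zero]; ring_nf
  have he0 := Complex.exp_ne_zero (-(2 * Complex.I * p.yc * S))
  rw [mul_assoc p.κ, mul_assoc p.κ, mul_div_mul_left _ _ hκ, mul_right_comm, mul_comm _ (p.φ S),
    mul_div_mul_right _ _ he0, mul_div_assoc, ← h2]
  linear_combination Complex.exp (Complex.I * p.yc * (l - p.ξs i (h i))) *
    (p.θ (S - l + p.ξs i (h i)) / p.θ S) * he

/-- The value of `aPM`. -/
theorem aPM_eq (p : SOSModel N) (ε r : ℤ) (h : SpinConfig N) (l t : ℂ) (s : ℤ)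
    (ht : p.tval r h + ε * p.η = t) (hs : 2 * p.c0 - (p.tval (-r) h + ε * p.η) = t + p.η * s) :
    p.aPM ε r h l = -(p.φ t / p.φ (t + p.η * s)) * p.aProd l := by
  have hκ : p.κ ≠ 0 := left_ne_zero_of_mul_eq_one p.κ_mul_κ
  have hr : t - (p.tval (-r) h + ε * p.η) = 2 * (r * p.η) := by
    rw [← ht, tval_eq, tval_eq]; push_cast; ring
  have h1 := p.exp_mul_θ_div (p.tval (-r) h + ε * p.η) t
  rw [hr] at h1
  rw [aPM, ← hs, φ_two_mul_c0_sub, ht]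
  change p.κ * _ * _ * _ = _
  rw [show 2 * Complex.I * p.yc * r * p.η = Complex.I * p.yc * (2 * (r * p.η)) by ring,
    mul_assoc p.κ, h1]
  -- With a vanishing denominator both sides are 0 by the convention for division, so no genericity
  -- is needed.
  by_cases h0 : p.φ (p.tval (-r) h + ε * p.η) = 0
  · simp [h0]
  field_simp
  linear_combination p.φ t * p.aProd l * p.κ_mul_κ

theorem dEig_eq (p : SOSModel N) (r : ℤ) (h : SpinConfig N) (l : ℂ) :
    p.dEig r h l = p.φ (p.tval r h) / p.φ (p.tval r fun _ => 1) * ∏ n, p.θ (l - p.ξs n (h n)) := by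
  rw [dEig, ← p.exp_mul_θ_div, tval_eq, tval_eq]
  ring_nf

/-! ### Weight covectors and weight vectors -/

section weights

/-- The covector `ψ` is an eigenvector of `τ` and `S` with eigenvalues `t` and `s`. -/
def IsLeftWeight (p : SOSModel N) (ψ : DynCovector N) (t : ℂ) (s : ℤ) : Prop :=
  ∀ f : ℂ → ℤ → ℂ, ψ ∘ₗ p.dynFun f = f t s • ψ

/-- The vector `v` is an eigenvector of `τ` and `S` with eigenvalues `t` and `s`. -/
def IsRightWeight (p : SOSModel N) (v : DynSpace N) (t : ℂ) (s : ℤ) : Prop :=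
  ∀ f : ℂ → ℤ → ℂ, p.dynFun f v = f t s • v

variable {p : SOSModel N} {ψ : DynCovector N} {v : DynSpace N} {t : ℂ} {s : ℤ}

theorem IsLeftWeight.smul (h : p.IsLeftWeight ψ t s) (c : ℂ) : p.IsLeftWeight (c • ψ) t s :=
  fun f => by rw [LinearMap.smul_comp, h, smul_comm]

theorem IsRightWeight.smul (h : p.IsRightWeight v t s) (c : ℂ) : p.IsRightWeight (c • v) t s :=
  fun f => by rw [map_smul, h, smul_comm]

theorem IsLeftWeight.calM (h : p.IsLeftWeight ψ t s) (i j : Fin 2) (l : ℂ) :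
    p.IsLeftWeight (ψ ∘ₗ p.calM i j l) (t + p.η * sgn j) (s + sgnZ i - sgnZ j) := fun f => by
  rw [LinearMap.comp_assoc, ← Module.End.mul_eq_comp, calM_mul_dynFun, Module.End.mul_eq_comp,
    ← LinearMap.comp_assoc, h, LinearMap.smul_comp]

theorem IsRightWeight.calM (h : p.IsRightWeight v t s) (i j : Fin 2) (l : ℂ) :
    p.IsRightWeight (p.calM i j l v) (t - p.η * sgn j) (s - sgnZ i + sgnZ j) := fun f => by
  have := p.calM_mul_dynFun i j l fun t s => f (t - p.η * sgn j) (s - sgnZ i + sgnZ j)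
  simp only [add_sub_cancel_right, show ∀ s : ℤ, s + sgnZ i - sgnZ j - sgnZ i + sgnZ j = s from
    fun s => by ring] at this
  rw [← Module.End.mul_apply, ← this, Module.End.mul_apply, h, map_smul]

theorem IsLeftWeight.eq_of_ne_zero (h : p.IsLeftWeight ψ t s) {b : SpinConfig N × ℤ}
    (hb : ψ (Finsupp.single b 1) ≠ 0) : p.height b.2 = t ∧ spin b.1 = s := by
  classical
  -- The weight condition holds for arbitrary functions f; an indicator acts as the projection onto
  -- the weight space.
  have := LinearMap.congr_fun (h fun t' s' => if t' = t ∧ s' = s then 1 else 0)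
    (Finsupp.single b 1)
  rw [LinearMap.comp_apply, dynFun_single, map_smul] at this
  by_contra hne
  simp [hne] at this
  exact hb this.symm

theorem IsRightWeight.eq_of_ne_zero (h : p.IsRightWeight v t s) {b : SpinConfig N × ℤ}
    (hb : v b ≠ 0) : p.height b.2 = t ∧ spin b.1 = s := by
  classical
  have := DFunLike.congr_fun (h fun t' s' => if t' = t ∧ s' = s then 1 else 0) b
  rw [dynFun_apply] at this
  by_contra hne
  simp [hne] at this
  exact hb this.symm

/-- Only basis covectors of the given height and spin occur in ψ, so all contributing matrix
elements share one exponential and one sum of zeros. -/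
theorem IsLeftWeight.isMatrixElement (h : p.IsLeftWeight ψ t s) (i j : Fin 2)
    (b : SpinConfig N × ℤ) :
    p.IsMatrixElement i j t s fun l => (ψ ∘ₗ p.calM i j l) (Finsupp.single b 1) := by
  have hF : ∀ l, (ψ ∘ₗ p.calM i j l) (Finsupp.single b 1) = ∑ g, ψ (Finsupp.single
      (g, b.2 + sgnZ j) 1) * p.Mentry i j l (p.height (b.2 + sgnZ j)) g b.1 := fun l => by
    rw [SOSModel.calM, LinearMap.comp_apply, Module.End.mul_apply, T_single, subst_single, map_sum]
    simp only [map_smul, smul_eq_mul, mul_comm]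
  simp only [hF]
  refine IsMatrixElement.sum p _ fun g _ hg => ?_
  obtain ⟨h1, h2⟩ := h.eq_of_ne_zero hg
  simp only at h1 h2
  rw [h1, ← h2]
  exact IsMatrixElement.Mentry p i j t g b.1

/-- The type is read off from the outgoing index b, so it carries the weight of the image vector; at
an index b of another weight the function is zero. -/
theorem IsRightWeight.isMatrixElement (h : p.IsRightWeight v t s) (i j : Fin 2)
    (b : SpinConfig N × ℤ) :
    p.IsMatrixElement i j (t - p.η * sgn j) (s - sgnZ i + sgnZ j) fun l => p.calM i j l v b := by
  by_cases hb : p.height b.2 = t - p.η * sgn j ∧ spin b.1 = s - sgnZ i + sgnZ j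
  · have hF : ∀ l, p.calM i j l v b = ∑ a ∈ v.support,
        (if b.2 = a.2 + sgnZ j then v a else 0) * p.Mentry i j l (p.height b.2) b.1 a.1 :=
      fun l => by
      conv_lhs => rw [← v.sum_single, Finsupp.sum, map_sum, Finsupp.finsetSum_apply]
      refine Finset.sum_congr rfl fun a _ => ?_
      rw [← mul_one (v a), ← smul_eq_mul, ← Finsupp.smul_single, map_smul, Finsupp.smul_apply,
        calM_single_apply]
      split_ifs <;> simp
    simp only [hF]
    refine IsMatrixElement.sum p _ fun a _ _ => ?_
    rw [← hb.1, ← hb.2]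
    exact IsMatrixElement.Mentry p i j _ b.1 a.1
  · have hF : ∀ l, p.calM i j l v b = 0 := fun l => by
      by_contra hne
      exact hb ((h.calM i j l).eq_of_ne_zero hne)
    simp only [hF]
    exact IsMatrixElement.zero p i j _ _

theorem IsMatrixElement.differentiable {i j : Fin 2} {F : ℂ → ℂ}
    (hF : p.IsMatrixElement i j t s F) (hω : 0 < p.ω.im) : Differentiable ℂ F := by
  obtain ⟨f, hf, hF⟩ := hF
  rw [funext hF]
  have := p.differentiable_of_mem_thetaSpan hω hf
  fun_prop

theorem IsLeftWeight.interpolation (h : p.IsLeftWeight ψ t s) (i j : Fin 2) (hω : 0 < p.ω.im)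
    {z : Fin N → ℂ} (hz : ∀ a b, a ≠ b → p.θ (z a - z b) ≠ 0) {S : ℂ} (hS : p.θ S ≠ 0)
    (hU : ∑ n, p.ξ n - p.η * ((N + sgn i * s) / 2) + (sgn j - sgn i) / 2 * t = S + ∑ n, z n)
    (l : ℂ) : ψ ∘ₗ p.calM i j l =
      ∑ a, (Complex.exp (Complex.I * p.yc * ((sgn i - sgn j) / 2) * (l - z a)) *
      (p.θ (S - l + z a) / p.θ S) * (∏ b ∈ Finset.univ.erase a,
        p.θ (l - z b) / p.θ (z a - z b))) • (ψ ∘ₗ p.calM i j (z a)) :=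
  Finsupp.lhom_ext' fun b => LinearMap.ext_ring <| by
    have := (h.isMatrixElement i j b).interpolation hω hz hS hU l
    simpa only [LinearMap.comp_apply, LinearMap.sum_apply, LinearMap.smul_apply, smul_eq_mul,
      Finsupp.lsingle_apply] using this

theorem IsRightWeight.interpolation (h : p.IsRightWeight v t s) (i j : Fin 2) (hω : 0 < p.ω.im)
    {z : Fin N → ℂ} (hz : ∀ a b, a ≠ b → p.θ (z a - z b) ≠ 0) {S : ℂ} (hS : p.θ S ≠ 0)
    (hU : ∑ n, p.ξ n - p.η * ((N + sgn i * ((s - sgnZ i + sgnZ j : ℤ) : ℂ)) / 2) +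
      (sgn j - sgn i) / 2 * (t - p.η * sgn j) = S + ∑ n, z n)
    (l : ℂ) : p.calM i j l v =
      ∑ a, (Complex.exp (Complex.I * p.yc * ((sgn i - sgn j) / 2) * (l - z a)) *
      (p.θ (S - l + z a) / p.θ S) * (∏ b ∈ Finset.univ.erase a,
        p.θ (l - z b) / p.θ (z a - z b))) • p.calM i j (z a) v :=
  Finsupp.ext fun b => by
    have := (h.isMatrixElement i j b).interpolation hω hz hS hU l
    simpa only [Finsupp.finsetSum_apply, Finsupp.smul_apply, smul_eq_mul] using this

/-! ### Exchange of `𝒟` and `𝒞` -/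

/-- On a weight covector the operator coefficients of the exchange relation become scalars. -/
theorem IsLeftWeight.calD_calC (h : p.IsLeftWeight ψ t s) (hω : 0 < p.ω.im)
    (ht : ∀ k, p.IsGeneric (p.height k)) (l u : ℂ) :
    p.θ (l - u + p.η) • (ψ ∘ₗ p.calD l) ∘ₗ p.calC u =
      (p.θ (l - u) * (p.φ (t - p.η) / p.φ t)) • (ψ ∘ₗ p.calC u) ∘ₗ p.calD l +
      (p.θ p.η * (p.φ (t + (l - u)) / p.φ t)) • (ψ ∘ₗ p.calD u) ∘ₗ p.calC l := by
  have := p.calM_exchange hω ht l u 1 1 1 0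
  simp only [Fin.sum_univ_two, R_11_00, R_11_01, R_11_10, R_11_11, R_00_10, R_01_10, R_10_10,
    dynFun_zero, zero_mul, zero_add, add_zero, dynFun_const, smul_mul_assoc, one_mul] at this
  refine LinearMap.ext fun w => ?_
  have hw := congrArg ψ (LinearMap.congr_fun this w)
  have hf : ∀ f x, ψ (p.dynFun f x) = f t s * ψ x := fun f x => LinearMap.congr_fun (h f) x
  simp only [LinearMap.add_apply, LinearMap.smul_apply, Module.End.mul_apply, map_add, map_smul,
    hf, smul_eq_mul] at hw
  simp only [LinearMap.add_apply, LinearMap.smul_apply, LinearMap.comp_apply, smul_eq_mul,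
    calC_eq, calD_eq]
  rw [add_comm (p.θ (l - u) * _ * _)]
  exact hw

theorem IsRightWeight.calD_calC (h : p.IsRightWeight v t s) (hω : 0 < p.ω.im)
    (ht : ∀ k, p.IsGeneric (p.height k)) (l u : ℂ) :
    p.θ (l - u + p.η) • p.calC l (p.calD u v) =
      (p.θ (l - u) * (p.φ (t + p.η) / p.φ t)) • p.calD u (p.calC l v) +
      (p.θ p.η * (p.φ (t - (l - u)) / p.φ t)) • p.calC u (p.calD l v) := by
  have := LinearMap.congr_fun (p.calM_exchange hω ht l u 1 0 1 1) v
  have h1 := (h.calM 1 0 l).calM 1 1 u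
  have h2 := (h.calM 1 1 l).calM 1 0 u
  simp only [sgn_zero, sgn_one, mul_one, mul_neg, sub_neg_eq_add, sub_add_cancel,
    add_sub_cancel_right] at h1 h2
  simp only [Fin.sum_univ_two, R_11_00, R_11_01, R_11_10, R_11_11, R_00_01, R_01_01, R_10_01,
    dynFun_zero, zero_mul, zero_add, add_zero, dynFun_const, smul_mul_assoc, one_mul,
    LinearMap.add_apply, LinearMap.smul_apply, Module.End.mul_apply] at this
  rw [h1, h2] at this
  exact this

end weights

/-! ### Genericity and combinatorics of configurations. -/

/-- The genericity assumptions on the parameters. -/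
structure IsRegular (p : SOSModel N) : Prop where
  im_ω_pos : 0 < p.ω.im
  isGeneric_height : ∀ k, p.IsGeneric (p.height k)
  θ_η_ne_zero : p.θ p.η ≠ 0
  θ_ξ_sub_ne_zero : ∀ a b, a ≠ b → p.θ (p.ξ a - p.ξ b) ≠ 0
  θ_ξ_sub_add_ne_zero : ∀ a b, a ≠ b → p.θ (p.ξ a - p.ξ b + p.η) ≠ 0
  θ_ξ_sub_sub_ne_zero : ∀ a b, a ≠ b → p.θ (p.ξ a - p.ξ b - p.η) ≠ 0

theorem isRegular (p : SOSModel N) (hω : 0 < p.ω.im) (hη : p.η ∉ p.Γ)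
    (ht : ∀ k : ℤ, p.t0 + k * p.η ∉ p.Γ)
    (hξ : ∀ ε ∈ ({-1, 0, 1} : Set ℤ), ∀ i j : Fin N, i ≠ j →
      p.ξ i - p.ξ j + ε * p.η ∉ p.Γ) : p.IsRegular where
  im_ω_pos := hω
  isGeneric_height := p.isGeneric_height hω ht
  θ_η_ne_zero := mt (p.θ_eq_zero_iff hω).mp hη
  θ_ξ_sub_ne_zero a b hab := mt (p.θ_eq_zero_iff hω).mp (by simpa using hξ 0 (by simp) a b hab)
  θ_ξ_sub_add_ne_zero a b hab := mt (p.θ_eq_zero_iff hω).mp (by simpa using hξ 1 (by simp) a b hab)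
  θ_ξ_sub_sub_ne_zero a b hab :=
    mt (p.θ_eq_zero_iff hω).mp (by simpa [sub_eq_add_neg] using hξ (-1) (by simp) a b hab)

theorem IsRegular.isGeneric_tval {p : SOSModel N} (hp : p.IsRegular) (r : ℤ) (h : SpinConfig N) :
    p.IsGeneric (p.tval r h) := by
  rw [← height_heightIndex]
  exact hp.isGeneric_height _

theorem IsRegular.aProd_ξ_ne_zero {p : SOSModel N} (hp : p.IsRegular) (a : Fin N) :
    p.aProd (p.ξ a) ≠ 0 := by
  rw [aProd_eq]
  refine Finset.prod_ne_zero_iff.mpr fun n _ => ?_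
  by_cases hn : a = n
  · simpa [hn] using hp.θ_η_ne_zero
  · exact hp.θ_ξ_sub_add_ne_zero a n hn

theorem IsRegular.dProd_ξ_sub_ne_zero {p : SOSModel N} (hp : p.IsRegular) (a : Fin N) :
    p.dProd (p.ξ a - p.η) ≠ 0 := by
  rw [dProd_eq]
  refine Finset.prod_ne_zero_iff.mpr fun n _ => ?_
  by_cases hn : a = n
  · simpa [hn, θ_neg] using hp.θ_η_ne_zero
  · rw [sub_right_comm]
    exact hp.θ_ξ_sub_sub_ne_zero a n hn

theorem IsRegular.θ_ξs_sub_ne_zero {p : SOSModel N} (hp : p.IsRegular) (h : SpinConfig N)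
    (a b : Fin N) (hab : a ≠ b) :
    p.θ (p.ξs a (h a) - p.ξs b (h b)) ≠ 0 := by
  have h0 := hp.θ_ξ_sub_ne_zero a b hab
  have h1 := hp.θ_ξ_sub_add_ne_zero a b hab
  have h2 := hp.θ_ξ_sub_sub_ne_zero a b hab
  generalize h a = k
  generalize h b = m
  revert k m
  simp only [Fin.forall_fin_two, ξs, Fin.val_zero, Fin.val_one, Nat.cast_zero, Nat.cast_one,
    mul_zero, mul_one, sub_zero]
  refine ⟨⟨h0, by convert h1 using 2; ring⟩, by convert h2 using 2; ring,
    by convert h0 using 2; ring⟩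

theorem IsRegular.commute_calC_ξ {p : SOSModel N} (hp : p.IsRegular) (a b : Fin N) :
    Commute (p.calC (p.ξ a)) (p.calC (p.ξ b)) := by
  by_cases hab : a = b
  · rw [hab]
  · exact p.commute_calC hp.im_ω_pos hp.isGeneric_height (hp.θ_ξ_sub_add_ne_zero a b hab)

theorem IsRegular.commute_calC_ξ_sub {p : SOSModel N} (hp : p.IsRegular) (a b : Fin N) :
    Commute (p.calC (p.ξ a - p.η)) (p.calC (p.ξ b - p.η)) := by
  by_cases hab : a = b
  · rw [hab]
  · exact p.commute_calC hp.im_ω_pos hp.isGeneric_height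
      (by simpa using hp.θ_ξ_sub_add_ne_zero a b hab)

theorem dProd_ξ (p : SOSModel N) (a : Fin N) : p.dProd (p.ξ a) = 0 := by
  rw [dProd_eq]
  exact Finset.prod_eq_zero (Finset.mem_univ a) (by rw [sub_self, θ_zero])

theorem aProd_ξ_sub (p : SOSModel N) (a : Fin N) : p.aProd (p.ξ a - p.η) = 0 := by
  rw [aProd_eq]
  exact Finset.prod_eq_zero (Finset.mem_univ a) (by
    rw [show p.ξ a - p.η - p.ξ a + p.η = 0 by ring, θ_zero])

@[simp] theorem ξs_zero (p : SOSModel N) (a : Fin N) : p.ξs a 0 = p.ξ a := by simp [ξs]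

@[simp] theorem ξs_one (p : SOSModel N) (a : Fin N) : p.ξs a 1 = p.ξ a - p.η := by simp [ξs]

theorem sum_ξs (p : SOSModel N) (h : SpinConfig N) :
    ∑ n, p.ξs n (h n) = ∑ n, p.ξ n - p.η * ((N - spin h) / 2) := by
  have : (spin h : ℂ) = N - 2 * ∑ n, ((h n : ℕ) : ℂ) := by
    simp [coe_spin, sgn, Finset.sum_sub_distrib, Finset.mul_sum]
  simp only [ξs, Finset.sum_sub_distrib, ← Finset.mul_sum]
  rw [this]
  ring

theorem raise_apply_self (a : Fin N) (h : SpinConfig N) : raise a h a = 1 := by simp [raise]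

theorem lower_apply_self (a : Fin N) (h : SpinConfig N) : lower a h a = 0 := by simp [lower]

theorem lower_raise {a : Fin N} {h : SpinConfig N} (ha : h a = 0) : lower a (raise a h) = h := by
  simp [lower, raise, ← ha]

theorem raise_lower {a : Fin N} {h : SpinConfig N} (ha : h a = 1) : raise a (lower a h) = h := by
  simp [lower, raise, ← ha]

theorem spin_raise {a : Fin N} {h : SpinConfig N} (ha : h a = 0) :
    spin (raise a h) = spin h - 2 := by
  have h1 := Finset.add_sum_erase Finset.univ (fun n => (1 - 2 * ((h n : ℕ) : ℤ)))
    (Finset.mem_univ a)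
  have h2 := Finset.add_sum_erase Finset.univ (fun n => (1 - 2 * ((raise a h n : ℕ) : ℤ)))
    (Finset.mem_univ a)
  have h3 : ∑ n ∈ Finset.univ.erase a, (1 - 2 * ((raise a h n : ℕ) : ℤ)) =
      ∑ n ∈ Finset.univ.erase a, (1 - 2 * ((h n : ℕ) : ℤ)) :=
    Finset.sum_congr rfl fun n hn => by
      rw [raise, Function.update_of_ne (Finset.ne_of_mem_erase hn)]
  rw [spin, spin, ← h1, ← h2, h3, raise_apply_self, ha]
  simp
  ring

theorem tval_raise (p : SOSModel N) (r : ℤ) {a : Fin N} {h : SpinConfig N} (ha : h a = 0) :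
    p.tval r (raise a h) = p.tval r h + p.η := by
  rw [tval_eq, tval_eq, spin_raise ha]; push_cast; ring

theorem tval_sub_one (p : SOSModel N) (r : ℤ) (h : SpinConfig N) :
    p.tval (r - 1) h = p.tval r h - p.η := by
  rw [tval_eq, tval_eq]; push_cast; ring

theorem tval_add_one (p : SOSModel N) (r : ℤ) (h : SpinConfig N) :
    p.tval (r + 1) h = p.tval r h + p.η := by
  rw [tval_eq, tval_eq]; push_cast; ring

theorem spinConfig_raise_induction {P : SpinConfig N → Prop} (zero : P fun _ => 0)
    (raise : ∀ h a, h a = 0 → P h → P (raise a h)) (h : SpinConfig N) : P h := by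
  have key : ∀ S : Finset (Fin N), P fun n => if n ∈ S then 1 else 0 := fun S => by
    induction S using Finset.induction_on with
    | empty => simpa using zero
    | insert a S ha ih =>
      convert raise _ a (by simp [ha]) ih using 1
      funext n
      by_cases hn : n = a
      · simp [hn, raise_apply_self]
      · simp [SOSModel.raise, hn]
  convert key (Finset.univ.filter fun n => h n = 1) using 1
  funext n
  by_cases hn : h n = 1
  · simp [hn]
  · simp only [Finset.mem_filter, Finset.mem_univ, true_and, hn, if_false]
    omega

theorem spinConfig_lower_induction {P : SpinConfig N → Prop} (one : P fun _ => 1)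
    (lower : ∀ h a, h a = 1 → P h → P (lower a h)) (h : SpinConfig N) : P h := by
  have key : ∀ S : Finset (Fin N), P fun n => if n ∈ S then 0 else 1 := fun S => by
    induction S using Finset.induction_on with
    | empty => simpa using one
    | insert a S ha ih =>
      convert lower _ a (by simp [ha]) ih using 1
      funext n
      by_cases hn : n = a
      · simp [hn, lower_apply_self]
      · simp [SOSModel.lower, hn]
  convert key (Finset.univ.filter fun n => h n = 0) using 1
  funext n
  by_cases hn : h n = 0
  · simp [hn]
  · simp only [Finset.mem_filter, Finset.mem_univ, true_and, hn, if_false]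
    omega

/-- A factor inserted at site a commutes past all later factors. This makes changing h_a the same as
multiplying by one more 𝒞. -/
theorem opProd_update (O : Fin N → Module.End ℂ (DynSpace N)) (a : Fin N)
    {X : Module.End ℂ (DynSpace N)} (hX : ∀ n, Commute (O n) X) :
    opProd (Function.update O a (O a * X)) = opProd O * X := by
  have key : ∀ L : List (Fin N), L.Nodup → a ∈ L →
      (L.map (Function.update O a (O a * X))).prod = (L.map O).prod * X := fun L => by
    induction L with
    | nil => simp
    | cons b L ih =>
      intro hL ha
      rw [List.nodup_cons] at hL
      rw [List.map_cons, List.prod_cons, List.map_cons, List.prod_cons]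
      by_cases hb : a = b
      · subst hb
        have hmap : L.map (Function.update O a (O a * X)) = L.map O :=
          List.map_congr_left fun n hn => Function.update_of_ne (by rintro rfl; exact hL.1 hn) _ _
        have hc : Commute (L.map O).prod X :=
          Commute.list_prod_left _ _ (by simpa using fun n _ => hX n)
        rw [Function.update_self, hmap, mul_assoc, mul_assoc, hc.eq]
      · rw [Function.update_of_ne (Ne.symm hb), ih hL.2 ((List.mem_cons.mp ha).resolve_left hb),
          mul_assoc]
  exact key _ (List.nodup_finRange N) (List.mem_finRange a)

theorem conj_T_opProd (k : ℤ) (O : Fin N → Module.End ℂ (DynSpace N)) :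
    opProd (fun n => T N (-k) * O n * T N k) = T N (-k) * opProd O * T N k := by
  have key : ∀ L : List (Fin N), (L.map fun n => T N (-k) * O n * T N k).prod =
      T N (-k) * (L.map O).prod * T N k := fun L => by
    induction L with
    | nil => simp [T_mul_T]
    | cons b L ih =>
      have hT : ∀ Y : Module.End ℂ (DynSpace N), T N k * (T N (-k) * Y) = Y := fun Y => by
        rw [← mul_assoc, T_mul_T, add_neg_cancel, T_zero, one_mul]
      rw [List.map_cons, List.prod_cons, List.map_cons, List.prod_cons, ih]
      simp only [mul_assoc, hT]
  exact key _

/-! ### Left states -/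

theorem smul_conj_T_pow (c : ℂ) (k : ℤ) (X : Module.End ℂ (DynSpace N)) {m : ℕ} (hm : m ≤ 1) :
    (c • (T N (-k) * X * T N k)) ^ m = T N (-k) * (c • X) ^ m * T N k := by
  have : m = 0 ∨ m = 1 := by omega
  rcases this with rfl | rfl
  · simp [T_mul_T]
  · simp

theorem leftRef_comp_T (nz : ℂ) (r : ℤ) :
    (leftRef nz r : DynCovector N) ∘ₗ T N (-1) = leftRef nz (r - 1) :=
  Finsupp.lhom_ext' fun b => LinearMap.ext_ring <| by
    obtain ⟨h, k⟩ := b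
    have : (k - 1 = heightIndex r (fun _ => 0 : SpinConfig N)) ↔
        k = heightIndex (r - 1) (fun _ => 0 : SpinConfig N) := by
      simp only [heightIndex]; omega
    simp only [leftRef, LinearMap.comp_apply, LinearMap.smul_apply, Finsupp.lsingle_apply,
      T_single, Finsupp.lapply_apply, Finsupp.single_apply, Prod.mk.injEq, ← sub_eq_add_neg, this]

/-- Conjugation by T collapses in the product and T⁻ lowers r on the reference covector. The formula
for D thus follows from the one for 𝒟 = D T⁻, which maps r to r − 1. -/
theorem leftStateShift_eq (p : SOSModel N) (nz : ℂ) (r : ℤ) (h : SpinConfig N) :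
    p.leftStateShift nz r h = p.leftState nz (r - 1) h ∘ₗ T N 1 := by
  rw [leftStateShift, leftState]
  simp only [smul_conj_T_pow _ _ _ (Fin.is_le (h _))]
  rw [conj_T_opProd, ← leftRef_comp_T]
  rfl

theorem leftState_zero (p : SOSModel N) (nz : ℂ) (r : ℤ) :
    p.leftState nz r (fun _ => 0) = leftRef nz r := by
  simp only [leftState, opProd, Fin.val_zero, pow_zero]
  rw [List.map_const', List.prod_replicate, one_pow]
  rfl

theorem IsRegular.leftState_raise {p : SOSModel N} (hp : p.IsRegular) (nz : ℂ) (r : ℤ)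
    {h : SpinConfig N} {a : Fin N} (ha : h a = 0) : p.leftState nz r (raise a h) =
      (1 / p.dProd (p.ξ a - p.η)) • (p.leftState nz r h ∘ₗ p.calC (p.ξ a)) := by
  set c : Fin N → Module.End ℂ (DynSpace N) :=
    fun n => (1 / p.dProd (p.ξ n - p.η)) • p.calC (p.ξ n) with hc
  have hcc : ∀ m n, Commute (c m) (c n) := fun m n =>
    ((hp.commute_calC_ξ m n).smul_left _).smul_right _
  have hu : (fun n => c n ^ (raise a h n : ℕ)) =
      Function.update (fun n => c n ^ (h n : ℕ)) a (c a ^ (h a : ℕ) * c a) := by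
    funext n
    by_cases hn : n = a
    · subst hn; simp [raise, ha]
    · simp [raise, hn]
  change leftRef nz r ∘ₗ opProd (fun n => c n ^ (raise a h n : ℕ)) = _
  rw [hu, opProd_update (fun n => c n ^ (h n : ℕ)) a fun n => (hcc n a).pow_left _]
  exact LinearMap.comp_smul (p.leftState nz r h) (1 / p.dProd (p.ξ a - p.η)) (p.calC (p.ξ a))

theorem IsRegular.leftState_comp_calC {p : SOSModel N} (hp : p.IsRegular) (nz : ℂ) (r : ℤ)
    {h : SpinConfig N} {a : Fin N} (ha : h a = 0) :
    p.leftState nz r h ∘ₗ p.calC (p.ξ a) =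
      p.dProd (p.ξ a - p.η) • p.leftState nz r (raise a h) := by
  rw [hp.leftState_raise nz r ha, smul_smul, mul_one_div_cancel (hp.dProd_ξ_sub_ne_zero a),
    one_smul]

theorem isLeftWeight_leftRef (p : SOSModel N) (nz : ℂ) (r : ℤ) :
    p.IsLeftWeight (leftRef nz r) (p.tval r fun _ => 0) (spin (fun _ => 0 : SpinConfig N)) :=
  fun f => LinearMap.ext fun v => by
    simp only [leftRef, LinearMap.comp_apply, LinearMap.smul_apply, Finsupp.lapply_apply,
      dynFun_apply, height_heightIndex, smul_eq_mul]
    ring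

theorem IsRegular.isLeftWeight_leftState {p : SOSModel N} (hp : p.IsRegular) (nz : ℂ) (r : ℤ)
    (h : SpinConfig N) : p.IsLeftWeight (p.leftState nz r h) (p.tval r h) (spin h) := by
  induction h using spinConfig_raise_induction with
  | zero => rw [leftState_zero]; exact p.isLeftWeight_leftRef nz r
  | raise h a ha ih =>
    rw [hp.leftState_raise nz r ha, tval_raise p r ha, spin_raise ha]
    have := (ih.calM 1 0 (p.ξ a)).smul (1 / p.dProd (p.ξ a - p.η))
    rwa [sgn_zero, mul_one, sgnZ_zero, sgnZ_one, show spin h + -1 - 1 = spin h - 2 by ring] at this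

theorem IsRegular.leftRef_comp_calD {p : SOSModel N} (hp : p.IsRegular) (nz : ℂ) (r : ℤ) (l : ℂ) :
    leftRef nz r ∘ₗ p.calD l = p.dEig (r - 1) (fun _ => 0) l • leftRef nz (r - 1) :=
  Finsupp.lhom_ext' fun b => LinearMap.ext_ring <| by
    obtain ⟨h, k⟩ := b
    have hk : (heightIndex r (fun _ => 0 : SpinConfig N) = k + sgnZ 1) ↔
        k = heightIndex (r - 1) (fun _ => 0 : SpinConfig N) := by
      simp only [heightIndex, sgnZ_one]; omega
    simp only [leftRef, LinearMap.comp_apply, LinearMap.smul_apply, Finsupp.lsingle_apply,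
      calD_eq, Finsupp.lapply_apply, calM_single_apply, height_heightIndex,
      p.Mentry_one_one_zero (hp.isGeneric_tval _ _), Finsupp.single_apply, Prod.mk.injEq, hk,
      smul_eq_mul, dEig_eq, tval_sub_one]
    by_cases hh : h = fun _ => 0
    · by_cases hk' : k = heightIndex (r - 1) (fun _ => 0 : SpinConfig N)
      -- The telescoped denominator φ(t_{r,0} + (N−1)η) is the normalization φ(t_{r−1,1}) in `dEig`.
      · have ht : p.tval r (fun _ => 1) - p.η = p.tval r (fun _ => 0) + (N - 1) * p.η := by
          rw [tval_eq, tval_eq, spin_const_one, spin_const_zero]; push_cast; ring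
        simp only [hh, hk', and_self, if_true, ht, Fin.val_zero, ξs_zero]
        ring
      · simp [hk']
    · simp [hh]

/-- Raising h_a multiplies by 𝒞(ξ_a). In the exchange with 𝒟(λ) the unwanted term contains 𝒟(ξ_a) on
the previous state, which vanishes because h_a = 0. -/
theorem IsRegular.leftState_comp_calD {p : SOSModel N} (hp : p.IsRegular) (nz : ℂ) (r : ℤ)
    (h : SpinConfig N) (l : ℂ) : p.leftState nz r h ∘ₗ p.calD l =
      p.dEig (r - 1) h l • p.leftState nz (r - 1) h := by
  induction h using spinConfig_raise_induction generalizing l with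
  | zero => rw [leftState_zero, leftState_zero, hp.leftRef_comp_calD]
  | raise h a ha ih =>
    have hw := hp.isLeftWeight_leftState nz r h
    have hd := hp.dProd_ξ_sub_ne_zero a
    have hξ : p.dEig (r - 1) h (p.ξ a) = 0 := by
      rw [dEig_eq, Finset.prod_eq_zero (Finset.mem_univ a) (by simp [ha, θ_zero]), mul_zero]
    have h0 : p.φ (p.tval r h) ≠ 0 := by simpa using hp.isGeneric_tval r h 0
    have h1 : p.φ (p.tval r h - p.η) ≠ 0 := by
      simpa [← sub_eq_add_neg] using hp.isGeneric_tval r h (-1)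
    have hdEig : ∀ l, p.θ (l - p.ξ a + p.η) * p.dEig (r - 1) h l * (p.φ (p.tval r h) /
        p.φ (p.tval r h - p.η)) = p.θ (l - p.ξ a) * p.dEig (r - 1) (raise a h) l := fun l => by
      rw [dEig_eq, dEig_eq, ← Finset.mul_prod_erase _ _ (Finset.mem_univ a),
        ← Finset.mul_prod_erase _ (fun n => p.θ (l - p.ξs n (raise a h n))) (Finset.mem_univ a),
        raise_apply_self, ha, tval_sub_one p r (raise a h), tval_raise p r ha, tval_sub_one,
        add_sub_cancel_right]
      have : ∏ n ∈ Finset.univ.erase a, p.θ (l - p.ξs n (raise a h n)) =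
          ∏ n ∈ Finset.univ.erase a, p.θ (l - p.ξs n (h n)) :=
        Finset.prod_congr rfl fun n hn => by
          rw [raise, Function.update_of_ne (Finset.ne_of_mem_erase hn)]
      rw [this, Fin.val_zero, Fin.val_one, ξs_zero, ξs_one,
        show l - (p.ξ a - p.η) = l - p.ξ a + p.η by ring]
      field_simp
    have key : ∀ l b, p.θ (l - p.ξ a) * ((p.leftState nz r (raise a h) ∘ₗ p.calD l)
        (Finsupp.single b 1) - p.dEig (r - 1) (raise a h) l *
        p.leftState nz (r - 1) (raise a h) (Finsupp.single b 1)) = 0 := fun l b => by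
      have hE := LinearMap.congr_fun (hw.calD_calC hp.im_ω_pos hp.isGeneric_height l (p.ξ a))
        (Finsupp.single b 1)
      rw [ih, ih, hξ, zero_smul, LinearMap.zero_comp, smul_zero, add_zero,
        hp.leftState_comp_calC nz r ha, LinearMap.smul_comp, hp.leftState_comp_calC nz (r - 1) ha,
        LinearMap.smul_comp] at hE
      simp only [LinearMap.smul_apply, smul_eq_mul] at hE
      rw [mul_sub, sub_eq_zero, ← mul_assoc (p.θ _) (p.dEig _ _ _), ← hdEig]
      apply mul_left_cancel₀ hd
      apply mul_left_cancel₀ (div_ne_zero h1 h0)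
      field_simp at hE ⊢
      linear_combination -hE
    have hw' := hp.isLeftWeight_leftState nz r (raise a h)
    refine Finsupp.lhom_ext' fun b => LinearMap.ext_ring <| ?_
    have hdiff : Differentiable ℂ fun l => p.dEig (r - 1) (raise a h) l := by
      simp only [dEig_eq]
      have := p.differentiable_θ hp.im_ω_pos
      fun_prop
    -- The exchange relation determines the action only up to the factor θ(λ − ξ_a), divided out as
    -- entire functions of λ.
    rcases Differentiable.eq_zero_or_eq_zero_of_mul_eq_zero
      (f := fun l => p.θ (l - p.ξ a)) ((p.differentiable_θ hp.im_ω_pos).comp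
        (differentiable_id.sub_const _))
      (((hw'.isMatrixElement 1 1 b).differentiable hp.im_ω_pos).sub (hdiff.mul_const _))
      fun l => key l b with hz | hz
    · exact absurd (by simpa using hz (p.ξ a + p.η)) hp.θ_η_ne_zero
    · exact sub_eq_zero.mp (hz l)

theorem IsRegular.leftState_comp_D {p : SOSModel N} (hp : p.IsRegular) (nz : ℂ) (r : ℤ)
    (h : SpinConfig N) (l : ℂ) : p.leftState nz r h ∘ₗ p.D l =
      p.dEig (r - 1) h l • p.leftStateShift nz r h := by
  have hD : p.D l = p.calD l * T N 1 := by
    rw [calD, mul_assoc, T_mul_T, neg_add_cancel, T_zero, mul_one]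
  rw [leftStateShift_eq, ← LinearMap.smul_comp, ← hp.leftState_comp_calD, hD]
  rfl

theorem dEig_ξs (p : SOSModel N) (r : ℤ) (h : SpinConfig N) (a : Fin N) :
    p.dEig r h (p.ξs a (h a)) = 0 := by
  rw [dEig_eq, Finset.prod_eq_zero (Finset.mem_univ a) (by rw [sub_self, θ_zero]), mul_zero]

/-- For h_a = 0 this is how the states are built. For h_a = 1 the state already ends in 𝒞(ξ_a), so
𝒞(ξ_a − η) annihilates it, matching 𝖽(ξ_a) = 0. -/
theorem IsRegular.leftState_comp_calC_ξs {p : SOSModel N} (hp : p.IsRegular) (nz : ℂ) (r : ℤ)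
    (h : SpinConfig N) (a : Fin N) : p.leftState nz r h ∘ₗ p.calC (p.ξs a (h a)) =
      p.dProd (p.ξs a (1 - (h a : ℕ))) • p.leftState nz r (raise a h) := by
  by_cases ha : h a = 0
  · simp only [ha, Fin.val_zero, ξs_zero, tsub_zero, ξs_one]
    exact hp.leftState_comp_calC nz r ha
  · replace ha : h a = 1 := by omega
    simp only [ha, Fin.val_one, ξs_one, tsub_self, ξs_zero, dProd_ξ, zero_smul]
    rw [← raise_lower ha, hp.leftState_raise nz r (lower_apply_self a h), LinearMap.smul_comp,
      LinearMap.comp_assoc, ← Module.End.mul_eq_comp,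
      p.calC_ξ_mul_calC hp.im_ω_pos hp.isGeneric_height, LinearMap.comp_zero, smul_zero]

/-- Interpolation at the zeros ξ_a^{(h_a)} of the 𝒟-coefficient; the balance of zeros gives S =
t_{r,h}. -/
theorem IsRegular.leftState_comp_calC_eq {p : SOSModel N} (hp : p.IsRegular) (nz : ℂ) (r : ℤ)
    (h : SpinConfig N) (l : ℂ) : p.leftState nz r h ∘ₗ p.calC l =
      ∑ i, (p.interp (p.tval r h) h i l * p.dProd (p.ξs i (1 - (h i : ℕ)))) •
        p.leftState nz r (raise i h) := by
  have hθ : p.θ (p.tval r h) ≠ 0 := fun h0 => hp.isGeneric_tval r h 0 (by simp [φ, h0])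
  rw [calC_eq, (hp.isLeftWeight_leftState nz r h).interpolation 1 0 hp.im_ω_pos
    (hp.θ_ξs_sub_ne_zero h) hθ (by rw [sum_ξs, sgn_one, sgn_zero]; ring) l]
  refine Finset.sum_congr rfl fun a _ => ?_
  rw [← calC_eq, hp.leftState_comp_calC_ξs, smul_smul, interp, sgn_one, sgn_zero]
  congr 4
  ring_nf

/-- Action of `ℬ(ξ_a - η)` by the quantum determinant. -/
theorem IsRegular.leftState_raise_comp_calB {p : SOSModel N} (hp : p.IsRegular) (nz : ℂ) (r : ℤ)
    {h : SpinConfig N} {a : Fin N} (ha : h a = 0) :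
    p.leftState nz r (raise a h) ∘ₗ p.calB (p.ξ a - p.η) =
      (-(p.φ (p.tval r h) / p.φ (p.tval r h + p.η * spin h)) * p.aProd (p.ξ a)) •
        p.leftState nz r h := by
  -- In the second quantum determinant relation at ξ_a only 𝒞(ξ_a)ℬ(ξ_a − η) survives on this
  -- covector, and 𝒞(ξ_a) produces the raised state.
  have hD : p.leftState nz r h ∘ₗ p.calD (p.ξ a) = 0 := by
    have := p.dEig_ξs (r - 1) h a
    rw [ha, Fin.val_zero, ξs_zero] at this
    rw [hp.leftState_comp_calD, this, zero_smul]
  have hd := hp.dProd_ξ_sub_ne_zero a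
  have h0 : p.φ (p.tval r h) ≠ 0 := by simpa using hp.isGeneric_tval r h 0
  have h1 : p.φ (p.tval r h + p.η * spin h) ≠ 0 := by
    simpa [mul_comm] using hp.isGeneric_tval r h (spin h)
  have hQ := p.qDet2_A hp.im_ω_pos hp.isGeneric_height (p.ξ a - p.η)
  rw [QDet2, sub_add_cancel, qdetFactor_eq] at hQ
  refine LinearMap.ext fun v => ?_
  have hv := congrArg (p.leftState nz r h) (LinearMap.congr_fun hQ v)
  have hf := fun x => LinearMap.congr_fun (hp.isLeftWeight_leftState nz r h
    fun t s => p.φ (t + p.η * s) / p.φ t) x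
  have hD' := fun x => LinearMap.congr_fun hD x
  rw [hp.leftState_raise nz r ha]
  simp only [LinearMap.comp_apply, LinearMap.smul_apply, LinearMap.zero_apply,
    smul_eq_mul] at hf hD'
  simp only [LinearMap.sub_apply, LinearMap.smul_apply, Module.End.mul_apply, hf, map_sub, hD',
    map_smul, Module.End.one_apply, smul_eq_mul] at hv
  simp only [LinearMap.comp_apply, LinearMap.smul_apply, smul_eq_mul]
  field_simp at hv ⊢
  linear_combination -hv

/-- For h_a = 0 the state is a multiple of an image under ℬ(ξ_a − η), so ℬ(ξ_a) annihilates it; for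
h_a = 1 the quantum determinant gives the value. -/
theorem IsRegular.leftState_comp_calB_ξs {p : SOSModel N} (hp : p.IsRegular) (nz : ℂ) (r : ℤ)
    (h : SpinConfig N) (a : Fin N) : p.leftState nz r h ∘ₗ p.calB (p.ξs a (h a)) =
      p.aPM (-1) r h (p.ξs a (1 - (h a : ℕ))) • p.leftState nz r (lower a h) := by
  by_cases ha : h a = 0
  · have hB := hp.leftState_raise_comp_calB nz r ha
    have h0 : p.φ (p.tval r h) ≠ 0 := by simpa using hp.isGeneric_tval r h 0
    have h1 : p.φ (p.tval r h + p.η * spin h) ≠ 0 := by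
      simpa [mul_comm] using hp.isGeneric_tval r h (spin h)
    have hc : -(p.φ (p.tval r h) / p.φ (p.tval r h + p.η * spin h)) * p.aProd (p.ξ a) ≠ 0 :=
      mul_ne_zero (neg_ne_zero.mpr (div_ne_zero h0 h1)) (hp.aProd_ξ_ne_zero a)
    simp only [ha, Fin.val_zero, ξs_zero, tsub_zero, ξs_one]
    rw [aPM, aProd_ξ_sub, mul_zero, zero_smul]
    apply smul_right_injective _ hc
    simp only
    rw [← LinearMap.smul_comp, ← hB, LinearMap.comp_assoc, ← Module.End.mul_eq_comp,
      p.calB_mul_calB_ξ hp.im_ω_pos hp.isGeneric_height, LinearMap.comp_zero, smul_zero]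
  · replace ha : h a = 1 := by omega
    have hl := lower_apply_self a h
    have hr := raise_lower ha
    have ht := p.tval_raise r hl
    have ht' := p.tval_raise (-r) hl
    have hs := spin_raise hl
    have hB := hp.leftState_raise_comp_calB nz r hl
    rw [hr] at ht ht' hs hB
    simp only [ha, Fin.val_one, ξs_one, tsub_self, ξs_zero]
    rw [hB, p.aPM_eq (-1) r h (p.ξ a) (p.tval r (lower a h)) (spin (lower a h)) (by
      rw [ht]; push_cast; ring) (by
      rw [tval_add_spin, ht, hs]; push_cast; ring)]

theorem IsRegular.leftState_comp_calB_eq {p : SOSModel N} (hp : p.IsRegular) (nz : ℂ) (r : ℤ)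
    (h : SpinConfig N) (l : ℂ) : p.leftState nz r h ∘ₗ p.calB l =
      ∑ i, (p.interp (p.tval (-r) h) h i l * p.aPM (-1) r h (p.ξs i (1 - (h i : ℕ)))) •
        p.leftState nz r (lower i h) := by
  have hθ : p.θ (-(p.tval r h + p.η * spin h)) ≠ 0 := fun h0 =>
    hp.isGeneric_tval r h (spin h) (by rw [θ_neg, neg_eq_zero] at h0; rw [φ, mul_comm _ p.η, h0,
      mul_zero])
  rw [calB_eq, (hp.isLeftWeight_leftState nz r h).interpolation 0 1 hp.im_ω_pos
    (hp.θ_ξs_sub_ne_zero h) hθ (by rw [sum_ξs, sgn_one, sgn_zero]; ring) l]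
  refine Finset.sum_congr rfl fun a _ => ?_
  rw [← calB_eq, hp.leftState_comp_calB_ξs, smul_smul, tval_add_spin,
    interp_eq_of_eq_two_mul_c0_add, sgn_one, sgn_zero]
  congr 5
  ring

/-! ### Right states -/

theorem T_rightRef (nz : ℂ) (r : ℤ) :
    T N (-1) (rightRef nz r) = rightRef nz (r + 1) := by
  rw [rightRef, map_smul, T_single, rightRef]
  simp only [heightIndex]
  congr 3
  ring

theorem rightStateShift_eq (p : SOSModel N) (nz : ℂ) (h : SpinConfig N) (r : ℤ) :
    p.rightStateShift nz h r = T N 1 (p.rightState nz h (r + 1)) := by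
  have hO := conj_T_opProd (-1) fun n =>
    ((1 / p.dProd (p.ξ n - p.η)) • p.calC (p.ξ n - p.η)) ^ (1 - (h n : ℕ))
  have hc : ∀ n, ((1 / p.dProd (p.ξ n - p.η)) • (T N 1 * p.calC (p.ξ n - p.η) * T N (-1))) ^
      (1 - (h n : ℕ)) = T N 1 * ((1 / p.dProd (p.ξ n - p.η)) • p.calC (p.ξ n - p.η)) ^
      (1 - (h n : ℕ)) * T N (-1) := fun n => by
    have := smul_conj_T_pow (1 / p.dProd (p.ξ n - p.η)) (-1) (p.calC (p.ξ n - p.η))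
      (m := 1 - (h n : ℕ)) (Nat.sub_le _ _)
    rwa [neg_neg] at this
  rw [neg_neg] at hO
  rw [rightStateShift, rightState, ← T_rightRef]
  simp only [hc]
  rw [hO]
  rfl

theorem rightState_one (p : SOSModel N) (nz : ℂ) (r : ℤ) :
    p.rightState nz (fun _ => 1) r = rightRef nz r := by
  simp only [rightState, opProd, Fin.val_one, tsub_self, pow_zero]
  rw [List.map_const', List.prod_replicate, one_pow]
  rfl

theorem IsRegular.rightState_lower {p : SOSModel N} (hp : p.IsRegular) (nz : ℂ) (r : ℤ)
    {h : SpinConfig N} {a : Fin N} (ha : h a = 1) : p.rightState nz (lower a h) r =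
      (1 / p.dProd (p.ξ a - p.η)) • p.calC (p.ξ a - p.η) (p.rightState nz h r) := by
  set c : Fin N → Module.End ℂ (DynSpace N) :=
    fun n => (1 / p.dProd (p.ξ n - p.η)) • p.calC (p.ξ n - p.η) with hc
  have hcc : ∀ m n, Commute (c m) (c n) := fun m n =>
    ((hp.commute_calC_ξ_sub m n).smul_left _).smul_right _
  have hu : (fun n => c n ^ (1 - (lower a h n : ℕ))) =
      Function.update (fun n => c n ^ (1 - (h n : ℕ))) a (c a ^ (1 - (h a : ℕ)) * c a) := by
    funext n
    by_cases hn : n = a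
    · subst hn; simp [lower, ha]
    · simp [lower, hn]
  have hO : Commute (opProd fun n => c n ^ (1 - (h n : ℕ))) (c a) :=
    Commute.list_prod_left _ _ (by simpa using fun n => (hcc n a).pow_left _)
  change opProd (fun n => c n ^ (1 - (lower a h n : ℕ))) (rightRef nz r) = _
  rw [hu, opProd_update (fun n => c n ^ (1 - (h n : ℕ))) a fun n => (hcc n a).pow_left _, hO.eq]
  rfl

theorem IsRegular.calC_rightState {p : SOSModel N} (hp : p.IsRegular) (nz : ℂ) (r : ℤ)
    {h : SpinConfig N} {a : Fin N} (ha : h a = 1) :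
    p.calC (p.ξ a - p.η) (p.rightState nz h r) =
      p.dProd (p.ξ a - p.η) • p.rightState nz (lower a h) r := by
  rw [hp.rightState_lower nz r ha, smul_smul, mul_one_div_cancel (hp.dProd_ξ_sub_ne_zero a),
    one_smul]

theorem isRightWeight_rightRef (p : SOSModel N) (nz : ℂ) (r : ℤ) :
    p.IsRightWeight (rightRef nz r) (p.tval r fun _ => 1) (spin (fun _ => 1 : SpinConfig N)) :=
  fun f => by
    rw [rightRef, map_smul, dynFun_single, height_heightIndex, smul_comm]

theorem spin_lower {a : Fin N} {h : SpinConfig N} (ha : h a = 1) :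
    spin (lower a h) = spin h + 2 := by
  have := spin_raise (lower_apply_self a h)
  rw [raise_lower ha] at this
  omega

theorem tval_lower (p : SOSModel N) (r : ℤ) {a : Fin N} {h : SpinConfig N} (ha : h a = 1) :
    p.tval r (lower a h) = p.tval r h - p.η := by
  rw [tval_eq, tval_eq, spin_lower ha]; push_cast; ring

theorem IsRegular.isRightWeight_rightState {p : SOSModel N} (hp : p.IsRegular) (nz : ℂ) (r : ℤ)
    (h : SpinConfig N) : p.IsRightWeight (p.rightState nz h r) (p.tval r h) (spin h) := by
  induction h using spinConfig_lower_induction with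
  | one => rw [rightState_one]; exact p.isRightWeight_rightRef nz r
  | lower h a ha ih =>
    rw [hp.rightState_lower nz r ha, tval_lower p r ha, spin_lower ha]
    have := (ih.calM 1 0 (p.ξ a - p.η)).smul (1 / p.dProd (p.ξ a - p.η))
    rwa [sgn_zero, mul_one, sgnZ_zero, sgnZ_one, show spin h - -1 + 1 = spin h + 2 by ring] at this

theorem IsRegular.calD_rightRef {p : SOSModel N} (hp : p.IsRegular) (nz : ℂ) (r : ℤ) (l : ℂ) :
    p.calD l (rightRef nz r) = p.dEig (r + 1) (fun _ => 1) l • rightRef nz (r + 1) :=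
  Finsupp.ext fun b => by
    obtain ⟨g, k⟩ := b
    have hk : (k = heightIndex r (fun _ => 1 : SpinConfig N) + sgnZ 1) ↔
        heightIndex (r + 1) (fun _ => 1 : SpinConfig N) = k := by
      simp only [heightIndex, sgnZ_one]; omega
    have h1 : p.φ (p.tval (r + 1) fun _ => 1) ≠ 0 := by
      simpa using hp.isGeneric_tval (r + 1) (fun _ => 1) 0
    simp only [rightRef, map_smul, Finsupp.smul_apply, calD_eq, calM_single_apply,
      p.Mentry_one_one_one, Finsupp.single_apply, Prod.mk.injEq, hk, smul_eq_mul, dEig_eq,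
      div_self h1, Fin.val_one, ξs_one, @eq_comm _ (fun _ => (1 : Fin 2)) g, one_mul,
      show ∀ n, l - (p.ξ n - p.η) = l - p.ξ n + p.η from fun n => by ring]
    by_cases hh : g = fun _ => 1
    · by_cases hk' : heightIndex (r + 1) (fun _ => 1 : SpinConfig N) = k
      · simp only [hh, hk', and_self, if_true]
        ring
      · simp [hk']
    · simp [hh]

/-- Mirror of the left case: states are built by lowering with 𝒞(ξ_a − η), the unwanted term
contains 𝒟(ξ_a − η) on a state with h_a = 1, and the factor to divide out is θ(λ − ξ_a + η). -/
theorem IsRegular.calD_rightState {p : SOSModel N} (hp : p.IsRegular) (nz : ℂ) (r : ℤ)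
    (h : SpinConfig N) (l : ℂ) : p.calD l (p.rightState nz h r) =
      p.dEig (r + 1) h l • p.rightState nz h (r + 1) := by
  induction h using spinConfig_lower_induction generalizing l with
  | one => rw [rightState_one, rightState_one, hp.calD_rightRef]
  | lower h a ha ih =>
    have hw := hp.isRightWeight_rightState nz r h
    have hd := hp.dProd_ξ_sub_ne_zero a
    have hξ : p.dEig (r + 1) h (p.ξ a - p.η) = 0 := by
      have := p.dEig_ξs (r + 1) h a
      rwa [ha, Fin.val_one, ξs_one] at this
    have h0 : p.φ (p.tval r h) ≠ 0 := by simpa using hp.isGeneric_tval r h 0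
    have h1 : p.φ (p.tval r h + p.η) ≠ 0 := by simpa using hp.isGeneric_tval r h 1
    have hdEig : ∀ l, p.θ (l - p.ξ a) * p.dEig (r + 1) h l * (p.φ (p.tval r h) /
        p.φ (p.tval r h + p.η)) =
        p.θ (l - p.ξ a + p.η) * p.dEig (r + 1) (lower a h) l := fun l => by
      rw [dEig_eq, dEig_eq, ← Finset.mul_prod_erase _ _ (Finset.mem_univ a),
        ← Finset.mul_prod_erase _ (fun n => p.θ (l - p.ξs n (lower a h n))) (Finset.mem_univ a),
        lower_apply_self, ha, tval_add_one p r (lower a h), tval_lower p r ha, tval_add_one,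
        sub_add_cancel]
      have : ∏ n ∈ Finset.univ.erase a, p.θ (l - p.ξs n (lower a h n)) =
          ∏ n ∈ Finset.univ.erase a, p.θ (l - p.ξs n (h n)) :=
        Finset.prod_congr rfl fun n hn => by
          rw [lower, Function.update_of_ne (Finset.ne_of_mem_erase hn)]
      rw [this, Fin.val_zero, Fin.val_one, ξs_zero, ξs_one,
        show l - (p.ξ a - p.η) = l - p.ξ a + p.η by ring]
      field_simp
    have key : ∀ l b, p.θ (l - p.ξ a + p.η) * (p.calD l (p.rightState nz (lower a h) r) b -
        p.dEig (r + 1) (lower a h) l * p.rightState nz (lower a h) (r + 1) b) = 0 := fun l b => by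
      have hE := DFunLike.congr_fun
        (hw.calD_calC hp.im_ω_pos hp.isGeneric_height (p.ξ a - p.η) l) b
      rw [ih, ih, hξ, zero_smul, map_zero, smul_zero, add_zero, map_smul,
        hp.calC_rightState nz r ha, map_smul, hp.calC_rightState nz (r + 1) ha,
        show p.ξ a - p.η - l + p.η = -(l - p.ξ a) by ring,
        show p.ξ a - p.η - l = -(l - p.ξ a + p.η) by ring, θ_neg, θ_neg] at hE
      simp only [Finsupp.smul_apply, smul_eq_mul] at hE
      rw [mul_sub, sub_eq_zero, ← mul_assoc (p.θ _) (p.dEig _ _ _), ← hdEig]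
      apply mul_left_cancel₀ hd
      apply mul_left_cancel₀ (div_ne_zero h1 h0)
      field_simp at hE ⊢
      linear_combination hE
    have hw' := hp.isRightWeight_rightState nz r (lower a h)
    refine Finsupp.ext fun b => ?_
    have hdiff : Differentiable ℂ fun l => p.dEig (r + 1) (lower a h) l := by
      simp only [dEig_eq]
      have := p.differentiable_θ hp.im_ω_pos
      fun_prop
    rcases Differentiable.eq_zero_or_eq_zero_of_mul_eq_zero
      (f := fun l => p.θ (l - p.ξ a + p.η)) ((p.differentiable_θ hp.im_ω_pos).comp
        ((differentiable_id.sub_const _).add_const _))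
      (((hw'.isMatrixElement 1 1 b).differentiable hp.im_ω_pos).sub (hdiff.mul_const _))
      fun l => key l b with hz | hz
    · exact absurd (by simpa using hz (p.ξ a)) hp.θ_η_ne_zero
    · exact sub_eq_zero.mp (hz l)

/-- With operators acting to the right, the shift has to be undone on the left of 𝒟; commuting it
through moves τ to τ + η. -/
theorem Dshift_eq (p : SOSModel N) (l : ℂ) : p.Dshift l = T N 1 * p.calD l := by
  rw [calD, D, ← mul_assoc, T_mul_subst, mul_assoc, T_mul_T, add_neg_cancel, T_zero, mul_one,
    Dshift]
  simp

theorem IsRegular.Dshift_rightState {p : SOSModel N} (hp : p.IsRegular) (nz : ℂ) (r : ℤ)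
    (h : SpinConfig N) (l : ℂ) : p.Dshift l (p.rightState nz h r) =
      p.dEig (r + 1) h l • p.rightStateShift nz h r := by
  rw [Dshift_eq, Module.End.mul_apply, hp.calD_rightState, map_smul, rightStateShift_eq]

theorem IsRegular.calC_ξs_rightState {p : SOSModel N} (hp : p.IsRegular) (nz : ℂ) (r : ℤ)
    (h : SpinConfig N) (a : Fin N) : p.calC (p.ξs a (h a)) (p.rightState nz h r) =
      p.dProd (p.ξs a (h a)) • p.rightState nz (lower a h) r := by
  by_cases ha : h a = 1
  · simp only [ha, Fin.val_one, ξs_one]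
    exact hp.calC_rightState nz r ha
  · replace ha : h a = 0 := by omega
    simp only [ha, Fin.val_zero, ξs_zero, dProd_ξ, zero_smul]
    rw [← lower_raise ha, hp.rightState_lower nz r (raise_apply_self a h), map_smul,
      ← Module.End.mul_apply, p.calC_ξ_mul_calC hp.im_ω_pos hp.isGeneric_height,
      LinearMap.zero_apply, smul_zero]

theorem IsRegular.calC_rightState_eq {p : SOSModel N} (hp : p.IsRegular) (nz : ℂ) (r : ℤ)
    (h : SpinConfig N) (l : ℂ) : p.calC l (p.rightState nz h r) =
      ∑ i, (p.interp (p.tval r h) h i l * p.dProd (p.ξs i (h i))) •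
        p.rightState nz (lower i h) r := by
  have hθ : p.θ (p.tval r h) ≠ 0 := fun h0 => hp.isGeneric_tval r h 0 (by simp [φ, h0])
  rw [calC_eq, (hp.isRightWeight_rightState nz r h).interpolation 1 0 hp.im_ω_pos
    (hp.θ_ξs_sub_ne_zero h) hθ (by
      rw [sum_ξs, sgn_one, sgn_zero, sgnZ_one, sgnZ_zero]; push_cast; ring) l]
  refine Finset.sum_congr rfl fun a _ => ?_
  rw [← calC_eq, hp.calC_ξs_rightState, smul_smul, interp, sgn_one, sgn_zero]
  congr 4
  ring_nf

/-- Action of `ℬ(ξ_a)` by the quantum determinant. -/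
theorem IsRegular.calB_rightState_lower {p : SOSModel N} (hp : p.IsRegular) (nz : ℂ) (r : ℤ)
    {h : SpinConfig N} {a : Fin N} (ha : h a = 1) :
    p.calB (p.ξ a) (p.rightState nz (lower a h) r) =
      (-(p.φ (p.tval r h) / p.φ (p.tval r h + p.η * spin h)) * p.aProd (p.ξ a)) •
        p.rightState nz h r := by
  have hD : p.calD (p.ξ a - p.η) (p.rightState nz h r) = 0 := by
    have := p.dEig_ξs (r + 1) h a
    rw [ha, Fin.val_one, ξs_one] at this
    rw [hp.calD_rightState, this, zero_smul]
  have hd := hp.dProd_ξ_sub_ne_zero a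
  have h0 : p.φ (p.tval r h) ≠ 0 := by simpa using hp.isGeneric_tval r h 0
  have h1 : p.φ (p.tval r h + p.η * spin h) ≠ 0 := by
    simpa [mul_comm] using hp.isGeneric_tval r h (spin h)
  have hQ := p.qDet1_A hp.im_ω_pos hp.isGeneric_height (p.ξ a)
  rw [QDet1, qdetFactor_eq] at hQ
  have hv := LinearMap.congr_fun hQ (p.rightState nz h r)
  -- The product ℬ𝒞 preserves height and spin, so the quantum determinant prefactor acts on the
  -- result by the scalar of the original state.
  have hw := ((hp.isRightWeight_rightState nz r h).calM 1 0 (p.ξ a - p.η)).calM 0 1 (p.ξ a)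
    fun t s => p.φ (t + p.η * s) / p.φ t
  rw [← calB_eq, ← calC_eq, sgn_zero, sgn_one, sgnZ_zero, sgnZ_one] at hw
  rw [show p.tval r h - p.η * 1 - p.η * -1 = p.tval r h by ring,
    show spin h - -1 + 1 - 1 + -1 = spin h by ring] at hw
  simp only [Module.End.mul_apply, LinearMap.sub_apply, hD, map_zero, zero_sub, map_neg, hw] at hv
  rw [hp.calC_rightState nz r ha, map_smul] at hv
  refine Finsupp.ext fun b => ?_
  have hb := DFunLike.congr_fun hv b
  simp only [LinearMap.smul_apply, Finsupp.smul_apply, Finsupp.neg_apply, Module.End.one_apply,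
    smul_eq_mul] at hb ⊢
  field_simp at hb ⊢
  linear_combination -hb

/-- For h_a = 1 the state is a multiple of an image under ℬ(ξ_a), which ℬ(ξ_a − η) annihilates; for
h_a = 0 the first quantum determinant relation gives the value. -/
theorem IsRegular.calB_ξs_rightState {p : SOSModel N} (hp : p.IsRegular) (nz : ℂ) (r : ℤ)
    (h : SpinConfig N) (a : Fin N) : p.calB (p.ξs a (h a)) (p.rightState nz h r) =
      p.aPM 1 r h (p.ξs a (h a)) • p.rightState nz (raise a h) r := by
  by_cases ha : h a = 1
  · have hB := hp.calB_rightState_lower nz r ha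
    have h0 : p.φ (p.tval r h) ≠ 0 := by simpa using hp.isGeneric_tval r h 0
    have h1 : p.φ (p.tval r h + p.η * spin h) ≠ 0 := by
      simpa [mul_comm] using hp.isGeneric_tval r h (spin h)
    have hc : -(p.φ (p.tval r h) / p.φ (p.tval r h + p.η * spin h)) * p.aProd (p.ξ a) ≠ 0 :=
      mul_ne_zero (neg_ne_zero.mpr (div_ne_zero h0 h1)) (hp.aProd_ξ_ne_zero a)
    simp only [ha, Fin.val_one, ξs_one]
    rw [aPM, aProd_ξ_sub, mul_zero, zero_smul]
    apply smul_right_injective _ hc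
    simp only
    rw [← map_smul, ← hB, ← Module.End.mul_apply,
      p.calB_mul_calB_ξ hp.im_ω_pos hp.isGeneric_height, LinearMap.zero_apply, smul_zero]
  · replace ha : h a = 0 := by omega
    have hr := raise_apply_self a h
    have ht := p.tval_raise r ha
    have hs := spin_raise ha
    have hB := hp.calB_rightState_lower nz r hr
    rw [lower_raise ha] at hB
    simp only [ha, Fin.val_zero, ξs_zero]
    rw [hB, p.aPM_eq 1 r h (p.ξ a) (p.tval r (raise a h)) (spin (raise a h)) (by
      rw [ht]; push_cast; ring) (by
      rw [tval_add_spin, ht, hs]; push_cast; ring)]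

theorem IsRegular.calB_rightState_eq {p : SOSModel N} (hp : p.IsRegular) (nz : ℂ) (r : ℤ)
    (h : SpinConfig N) (l : ℂ) : p.calB l (p.rightState nz h r) =
      ∑ i, (p.interp (p.tval (-r) h) h i l * p.aPM 1 r h (p.ξs i (h i))) •
        p.rightState nz (raise i h) r := by
  have hθ : p.θ (-(p.tval r h + p.η * spin h)) ≠ 0 := fun h0 =>
    hp.isGeneric_tval r h (spin h) (by rw [θ_neg, neg_eq_zero] at h0; rw [φ, mul_comm _ p.η, h0,
      mul_zero])
  rw [calB_eq, (hp.isRightWeight_rightState nz r h).interpolation 0 1 hp.im_ω_pos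
    (hp.θ_ξs_sub_ne_zero h) hθ (by
      rw [sum_ξs, sgn_one, sgn_zero, sgnZ_one, sgnZ_zero]; push_cast; ring) l]
  refine Finset.sum_congr rfl fun a _ => ?_
  rw [← calB_eq, hp.calB_ξs_rightState, smul_smul, tval_add_spin,
    interp_eq_of_eq_two_mul_c0_add, sgn_one, sgn_zero]
  congr 5
  ring

end SOSModel
end

theorem mainTheorem8 {N : ℕ} (p : SOSModel N) (nz : ℂ) (hnz : nz ≠ 0)
    (hω : 0 < p.ω.im) (hη : p.η ∉ p.Γ)
    (ht : ∀ k : ℤ, p.t0 + k * p.η ∉ p.Γ)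
    (hξ : ∀ ε ∈ ({-1, 0, 1} : Set ℤ), ∀ i j : Fin N, i ≠ j →
      p.ξ i - p.ξ j + ε * p.η ∉ p.Γ) :
    -- the quantum determinant relations
    (∀ l : ℂ, p.QDet1 l (p.A l) ∧ p.QDet2 l (p.A l)) ∧
    -- left representations
    ((∀ (l : ℂ) (r : ℤ) (h : SpinConfig N),
        p.leftState nz r h ∘ₗ p.D l = p.dEig (r - 1) h l • p.leftStateShift nz r h ∧
        p.leftState nz r h ∘ₗ p.calC l =
          ∑ i, (p.interp (p.tval r h) h i l * p.dProd (p.ξs i (1 - (h i : ℕ)))) •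
            p.leftState nz r (SOSModel.raise i h) ∧
        p.leftState nz r h ∘ₗ p.calB l =
          ∑ i, (p.interp (p.tval (-r) h) h i l * p.aPM (-1) r h (p.ξs i (1 - (h i : ℕ)))) •
            p.leftState nz r (SOSModel.lower i h)) ∧
      -- `A(λ|τ)` is determined at each generic `λ` by either quantum determinant relation
      (∀ (l : ℂ) (X : Module.End ℂ (DynSpace N)),
        (p.QDet1 l X ∧ ∀ (n : Fin N) (k : Fin 2), l - p.η - p.ξs n k ∉ p.Γ) ∨
          (p.QDet2 l X ∧ ∀ (n : Fin N) (k : Fin 2), l + p.η - p.ξs n k ∉ p.Γ) →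
        ∀ (r : ℤ) (h : SpinConfig N),
          p.leftState nz r h ∘ₗ X = p.leftState nz r h ∘ₗ p.A l) ∧
      -- and at all `λ` among the families with continuous matrix elements
      (∀ X : ℂ → Module.End ℂ (DynSpace N),
        (∀ s s' : SpinConfig N × ℤ, Continuous fun l => X l (Finsupp.single s 1) s') →
        ((∀ l, p.QDet1 l (X l)) ∨ (∀ l, p.QDet2 l (X l))) →
        ∀ (l : ℂ) (r : ℤ) (h : SpinConfig N),
          p.leftState nz r h ∘ₗ X l = p.leftState nz r h ∘ₗ p.A l)) ∧
    -- right representations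
    ((∀ (l : ℂ) (r : ℤ) (h : SpinConfig N),
        p.Dshift l (p.rightState nz h r) = p.dEig (r + 1) h l • p.rightStateShift nz h r ∧
        p.calC l (p.rightState nz h r) =
          ∑ i, (p.interp (p.tval r h) h i l * p.dProd (p.ξs i (h i))) •
            p.rightState nz (SOSModel.lower i h) r ∧
        p.calB l (p.rightState nz h r) =
          ∑ i, (p.interp (p.tval (-r) h) h i l * p.aPM 1 r h (p.ξs i (h i))) •
            p.rightState nz (SOSModel.raise i h) r) ∧
      (∀ (l : ℂ) (X : Module.End ℂ (DynSpace N)),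
        (p.QDet1 l X ∧ ∀ (n : Fin N) (k : Fin 2), l - p.η - p.ξs n k ∉ p.Γ) ∨
          (p.QDet2 l X ∧ ∀ (n : Fin N) (k : Fin 2), l + p.η - p.ξs n k ∉ p.Γ) →
        ∀ (r : ℤ) (h : SpinConfig N),
          X (p.rightState nz h r) = p.A l (p.rightState nz h r)) ∧
      (∀ X : ℂ → Module.End ℂ (DynSpace N),
        (∀ s s' : SpinConfig N × ℤ, Continuous fun l => X l (Finsupp.single s 1) s') →
        ((∀ l, p.QDet1 l (X l)) ∨ (∀ l, p.QDet2 l (X l))) →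
        ∀ (l : ℂ) (r : ℤ) (h : SpinConfig N),
          X l (p.rightState nz h r) = p.A l (p.rightState nz h r))) := by
  have hp := p.isRegular hω hη ht hξ
  have hgen := hp.isGeneric_height
  -- Uniqueness holds at the level of operators, so the statements on left and right states follow
  -- by substitution.
  have hA : ∀ (l : ℂ) (X : Module.End ℂ (DynSpace N)),
      (p.QDet1 l X ∧ ∀ (n : Fin N) (k : Fin 2), l - p.η - p.ξs n k ∉ p.Γ) ∨
        (p.QDet2 l X ∧ ∀ (n : Fin N) (k : Fin 2), l + p.η - p.ξs n k ∉ p.Γ) → X = p.A l := by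
    rintro l X (⟨hX, hl⟩ | ⟨hX, hl⟩)
    · exact p.eq_A_of_QDet1 hω hgen hl hX
    · exact p.eq_A_of_QDet2 hω hgen hl hX
  have hA' : ∀ X : ℂ → Module.End ℂ (DynSpace N),
      (∀ s s' : SpinConfig N × ℤ, Continuous fun l => X l (Finsupp.single s 1) s') →
      ((∀ l, p.QDet1 l (X l)) ∨ (∀ l, p.QDet2 l (X l))) → ∀ l, X l = p.A l := by
    rintro X hX (hQ | hQ)
    · exact p.eq_A_of_dense hω hX (p.dense_sub_ξs_notMem_Γ (-p.η)) fun l hl =>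
        p.eq_A_of_QDet1 hω hgen hl (hQ l)
    · exact p.eq_A_of_dense hω hX (p.dense_sub_ξs_notMem_Γ p.η) fun l hl =>
        p.eq_A_of_QDet2 hω hgen hl (hQ l)
  exact ⟨fun l => ⟨p.qDet1_A hω hgen l, p.qDet2_A hω hgen l⟩,
    ⟨fun l r h => ⟨hp.leftState_comp_D nz r h l, hp.leftState_comp_calC_eq nz r h l,
        hp.leftState_comp_calB_eq nz r h l⟩,
      fun l X hX r h => by rw [hA l X hX],
      fun X hX hQ l r h => by rw [hA' X hX hQ l]⟩,
    fun l r h => ⟨hp.Dshift_rightState nz r h l, hp.calC_rightState_eq nz r h l,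
        hp.calB_rightState_eq nz r h l⟩,
      fun l X hX r h => by rw [hA l X hX],
      fun X hX hQ l r h => by rw [hA' X hX hQ l]⟩
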